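/- **Theorem 4.6.** Machines are multi-tape Turing machines; a probabilistic machine reads one fair coin per step. $\mathsf{BPTIME}[t(n)]$ is the class of languages $L\subseteq\{0,1\}^*$ decided by a probabilistic machine that, on every input $x$, halts in $O(t(|x|))$ steps for all outcomes of its coins and gives the correct answer with probability at least $2/3$; $\mathsf{BPP}=\bigcup_k \mathsf{BPTIME}[n^k]$. A function $t:\mathbb N\to\mathbb N$ is *time-constructible* if a deterministic machine on input $1^n$ halts within $O(t(n))$ steps and outputs $t(n)$ in binary. (A bound $O(g)$ means at most $a\,g+a$ for some constant $a$.) A language $L$ is *$\mathsf{BPTIME}$-hard* if there is a positive constant $c$ such that for every time-constructible $t$ and every $L'\in\mathsf{BPTIME}[t(n)]$ there is a function $f:\{0,1\}^*\to\{0,1\}^*$, computable by a deterministic machine in time $O(t(|x|)^c)$, with $x\in L'\iff f(x)\in L$ for all $x$. It is *$\mathsf{BPP}$-complete* if it is $\mathsf{BPTIME}$-hard and lies in $\mathsf{BPP}$. Fix an integer $C\ge 1$ and let $s(n)=n\cdot\lfloor\log_2 n\rfloor^C$. An instance of $\mathsf{CAPP}_n$ is a pair $(1^n,w)$ with $w\in\{0,1\}^{s(n)}$,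 where $w$ is interpreted as the description of a Boolean circuit $D_w$ (fan-in at most two, with gates AND, OR, NOT and constants) with at most $s(n)$ input variables and at most $s(n)$ gates; a solution is a number $\mu\in[0,1]$ (written in binary) with $$\Big|\Pr_{y\in\{0,1\}^{s(n)}}[D_w(y)=1]-\mu\Big|\le \tfrac1{10}.$$ A *worst-case pseudodeterministic algorithm for $\mathsf{CAPP}_n$ that runs in time $T(n)$ and is correct on all large inputs* is a probabilistic machine $A$ such that, for every $n$ and every instance $(1^n,w)$, $A$ halts in $O(T(n))$ steps for all outcomes of its coins and outputs some fixed string $\mu_w$ with probability at least $2/3$, and such that for some $n_0$ the string $\mu_w$ is a solution for every instance with $n\ge n_0$. Let $T:\mathbb N\to\mathbb N$ be time-constructible and suppose that there is a worst-case pseudodeterministic algorithm for $\mathsf{CAPP}_n$ that runs in time $T(n)$ and is correct on all large inputs. Then there is a language in $\mathsf{BPTIME}[T(n)]$ that is $\mathsf{BPTIME}$-hard. In particular, if $T$ is polynomially bounded, then there is a $\mathsf{BPP}$-complete language. -/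

import Mathlib

/-! Multi-tape probabilistic Turing machines with a step count, `BPTIME`, Boolean circuits given by
bit strings, and the circuit acceptance probability problem. -/

namespace PseudoDet

/-- The probability that `P y` holds for a uniformly random `y ∈ {0,1}^m`. -/
noncomputable def unifProb (m : ℕ) (P : (Fin m → Bool) → Prop) : ℝ :=
  (Nat.card {y : Fin m → Bool // P y} : ℝ) / 2 ^ m

/-! ### Turing machines -/

/-- A probabilistic multi-tape Turing machine. There are finitely many two-way infinite tapes,
indexed by `K`, over the alphabet `{0, 1, blank}` (`none` is the blank); two different tapes are
singled out for the input and for the output. In every step the machine reads the scanned symbols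
and one fresh fair coin, and the transition function gives the next state, the symbols to be
written, and the head moves (`none` means that the head stays). -/
structure TM where
  K : Type
  Q : Type
  finK : Finite K
  finQ : Finite Q
  inp : K
  out : K
  inp_ne_out : inp ≠ out
  start : Q
  halt : Q
  δ : Q → (K → Option Bool) → Bool → Q × (K → Option Bool) × (K → Option Turing.Dir)

namespace TM

/-- A configuration: the state, and the tapes with their head positions. -/
structure Cfg (M : TM) where
  state : M.Q
  tape : M.K → Turing.Tape (Option Bool)

/-- The move of a head; `none` means to stay. -/
def moveHead : Option Turing.Dir → Turing.Tape (Option Bool) → Turing.Tape (Option Bool)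
  | none, t => t
  | some d, t => t.move d

open Classical in
/-- The initial configuration on input `x`: the input tape holds `x`, with the head on its first
symbol, and all other tapes are blank. -/
noncomputable def init (M : TM) (x : List Bool) : M.Cfg where
  state := M.start
  tape := fun k => if k = M.inp then Turing.Tape.mk₁ (x.map some) else Turing.Tape.mk₁ []

open Classical in
/-- One step with coin `b`. A halted machine stays as it is. -/
noncomputable def step (M : TM) (c : M.Cfg) (b : Bool) : M.Cfg :=
  if c.state = M.halt then c
  else
    let a := M.δ c.state (fun k => (c.tape k).head) b
    { state := a.1
      tape := fun k => moveHead (a.2.2 k) ((c.tape k).write (a.2.1 k)) }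

/-- The configuration reached from input `x` after `m` steps with coins `r`. -/
noncomputable def run (M : TM) (x : List Bool) {m : ℕ} (r : Fin m → Bool) : M.Cfg :=
  (List.ofFn r).foldl M.step (M.init x)

/-- The configuration is halted and its output is `y`: the output tape, read from its head to the
right up to the first blank, holds `y`. -/
def Cfg.HaltedWith {M : TM} (c : M.Cfg) (y : List Bool) : Prop :=
  c.state = M.halt ∧ ∀ j : ℕ, j ≤ y.length → (c.tape M.out).nth (j : ℤ) = y[j]?

/-- On input `x`, the machine halts within `m` steps, whatever its coins are. -/
def HaltsWithin (M : TM) (x : List Bool) (m : ℕ) : Prop :=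
  ∀ r : Fin m → Bool, (M.run x r).state = M.halt

/-- The probability over the coins that `M`, on input `x`, halts within `m` steps with
output `y`. -/
noncomputable def outputProb (M : TM) (x : List Bool) (m : ℕ) (y : List Bool) : ℝ :=
  unifProb m fun r => (M.run x r).HaltedWith y

/-- A deterministic machine is one that ignores its coins. -/
def Deterministic (M : TM) : Prop :=
  ∀ q s, M.δ q s false = M.δ q s true

/-- On input `x`, the machine halts within `m` steps with output `y`, whatever its coins are. -/
def Computes (M : TM) (x : List Bool) (m : ℕ) (y : List Bool) : Prop :=
  ∀ r : Fin m → Bool, (M.run x r).HaltedWith y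

end TM

/-! ### Complexity classes

A bound `O(t(n))` is read as `a * t n + a` for some constant `a`, so that it also makes sense
where `t n = 0`. -/

/-- `t` is time-constructible: a deterministic machine, on input `1^n`, halts within `O(t(n))`
steps and outputs `t(n)` (in binary, least significant bit first). -/
def TimeConstructible (t : ℕ → ℕ) : Prop :=
  ∃ M : TM, M.Deterministic ∧
    ∃ a : ℕ, ∀ n : ℕ, M.Computes (List.replicate n true) (a * t n + a) (Nat.bits (t n))

open Classical in
/-- `BPTIME[t(n)]`: the languages that are decided by a probabilistic machine in time `O(t(n))`
(on all inputs and all coin sequences) and with error probability at most `1/3`. -/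
def BPTIME (t : ℕ → ℕ) : Set (Language Bool) :=
  {L | ∃ M : TM, ∃ a : ℕ, ∀ x : List Bool,
    M.HaltsWithin x (a * t x.length + a) ∧
    2 / 3 ≤ M.outputProb x (a * t x.length + a) [decide (x ∈ L)]}

/-- `BPP` is the union of the classes `BPTIME[n^k]`. -/
def BPP : Set (Language Bool) :=
  {L | ∃ k : ℕ, L ∈ BPTIME fun n => n ^ k}

/-- `f` is computable by a deterministic machine in time `O(t(|x|))`. -/
def ComputableInTime (t : ℕ → ℕ) (f : List Bool → List Bool) : Prop :=
  ∃ M : TM, M.Deterministic ∧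
    ∃ a : ℕ, ∀ x : List Bool, M.Computes x (a * t x.length + a) (f x)

/-- `L` is `BPTIME`-hard: for one constant `c`, every language in `BPTIME[t(n)]`, for every
time-constructible `t`, is many-one reducible to `L` in deterministic time `O(t(|x|)^c)`. -/
def BPTIMEHard (L : Language Bool) : Prop :=
  ∃ c : ℕ, 0 < c ∧ ∀ t : ℕ → ℕ, TimeConstructible t → ∀ L' ∈ BPTIME t,
    ∃ f : List Bool → List Bool, ComputableInTime (fun n => t n ^ c) f ∧
      ∀ x : List Bool, x ∈ L' ↔ f x ∈ L

/-- `L` is `BPP`-complete. -/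
def BPPComplete (L : Language Bool) : Prop :=
  BPTIMEHard L ∧ L ∈ BPP

/-! ### Boolean circuits -/

/-- The gates of a Boolean circuit of fan-in at most two. A circuit is a list of gates in
topological order; a gate refers to an earlier gate by its distance: `0` is the gate just before
it, `1` the one before that, and so on. -/
inductive Gate where
  | const (b : Bool)
  | input (i : ℕ)
  | not (i : ℕ)
  | and (i j : ℕ)
  | or (i j : ℕ)
  deriving DecidableEq

/-- The value of a gate on the assignment `y`; `v` lists the values of the earlier gates, the most
recent one first. References to variables or gates that do not exist have the value `0`. -/
def Gate.eval {m : ℕ} (y : Fin m → Bool) (v : List Bool) : Gate → Bool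
  | .const b => b
  | .input i => if h : i < m then y ⟨i, h⟩ else false
  | .not i => !(v.getD i false)
  | .and i j => v.getD i false && v.getD j false
  | .or i j => v.getD i false || v.getD j false

/-- The value of a circuit is the value of its last gate (and `0` for the empty circuit). -/
def evalCircuit {m : ℕ} (gs : List Gate) (y : Fin m → Bool) : Bool :=
  (gs.foldl (fun v g => g.eval y v :: v) []).headD false

/-- Reads a number off the front of a bit string: each binary digit `b`, least significant first,
is written as `1b`, and a `0` ends the number. -/
def parseNat : List Bool → Option (ℕ × List Bool)
  | false :: w => some (0, w)
  | true :: b :: w => (parseNat w).map fun p => (Nat.bit b p.1, p.2)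
  | _ => none

/-- Reads two numbers off the front of a bit string. -/
def parsePair (w : List Bool) : Option ((ℕ × ℕ) × List Bool) :=
  (parseNat w).bind fun p => (parseNat p.2).map fun q => ((p.1, q.1), q.2)

/-- Reads a gate off the front of a bit string: a `1`, a tag of three bits, and the arguments. -/
def parseGate : List Bool → Option (Gate × List Bool)
  | true :: false :: false :: b :: w => some (.const b, w)
  | true :: false :: true :: false :: w => (parseNat w).map fun p => (.input p.1, p.2)
  | true :: false :: true :: true :: w => (parseNat w).map fun p => (.not p.1, p.2)
  | true :: true :: false :: false :: w =>
      (parsePair w).map fun p => (.and p.1.1 p.1.2, p.2)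
  | true :: true :: false :: true :: w =>
      (parsePair w).map fun p => (.or p.1.1 p.1.2, p.2)
  | _ => none

/-- Reads up to the given number of gates, and stops where no gate can be read. -/
def parseGates : ℕ → List Bool → List Gate
  | 0, _ => []
  | k + 1, w =>
    match parseGate w with
    | none => []
    | some (g, w') => g :: parseGates k w'

/-- The circuit described by a bit string `w`. Gates are read as long as possible and the rest of
the string (for instance a padding by `0`s) is ignored, so every string describes a circuit. The
circuit has at most `w.length` gates, and has an encoding with `O(log s)` bits per gate if it has
`s` gates and at most `s` variables. -/
def decodeCircuit (w : List Bool) : List Gate :=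
  parseGates w.length w

/-! ### The circuit acceptance probability problem -/

/-- The size parameter `n · (log n)^C`. -/
def cappSize (C n : ℕ) : ℕ :=
  n * Nat.log 2 n ^ C

/-- The string that presents the instance `(1^n, w)`. -/
def cappInput (n : ℕ) (w : List Bool) : List Bool :=
  List.replicate n true ++ false :: w

/-- The number `b₀.b₁b₂…` (in binary) that is presented by the string `b₀b₁b₂…`. -/
noncomputable def binValue (y : List Bool) : ℝ :=
  ∑ i : Fin y.length, if y[i] then (1 / 2 : ℝ) ^ (i : ℕ) else 0

/-- `y` presents a number in `[0,1]` that differs by at most `1/10` from the acceptance probability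
of the circuit described by `w`, whose variables are assigned uniformly from `{0,1}^|w|`. -/
def IsCAPPSolution (w y : List Bool) : Prop :=
  binValue y ∈ Set.Icc (0 : ℝ) 1 ∧
    |unifProb w.length (fun z => evalCircuit (decodeCircuit w) z = true) - binValue y| ≤ 1 / 10

/-- There is a pseudodeterministic algorithm for the circuit acceptance probability problem with
circuits of description length `n · (log n)^C`, which runs in time `O(T(n))` and is correct in the
worst case for all sufficiently large `n`: on every instance it outputs some canonical string with
probability at least `2/3`, and for `n ≥ n₀` the canonical string is a solution. -/
def HasPseudodetCAPP (C : ℕ) (T : ℕ → ℕ) : Prop :=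
  ∃ A : TM, ∃ a n₀ : ℕ, ∀ n : ℕ, ∀ w : List Bool, w.length = cappSize C n →
    A.HaltsWithin (cappInput n w) (a * T n + a) ∧
    ∃ y : List Bool, 2 / 3 ≤ A.outputProb (cappInput n w) (a * T n + a) y ∧
      (n₀ ≤ n → IsCAPPSolution w y)

end PseudoDet

/-! Read a string `x` of length `n` as a circuit description, pad it with zeros to length `s(n)`,
and give the instance to the assumed algorithm `A`. The language `circuitLang` consists of the `x`
whose canonical output has a 1 among its first two digits, a syntactic test for "estimate at least
1/2". Only a fixed canonical answer makes this a language: a circuit whose acceptance probability is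
close to 1/2 may fall on either side, but it always falls on the same one.

Membership in BPTIME[T] (`circuitLang_mem_BPTIME`): write the instance, run `A`, inspect two output
cells. Writing the instance must fit into O(T). It does, because `A` itself has to read nearly all
of its input (`Solves.cappSize_le`): the constant circuits 0 and 1 can be described by strings that
differ only in one bit close to the end, and a faster `A` would give both the same canonical answer.

Hardness (`bptimeHard_circuitLang`): let `B` decide a language in time O(t). The reduction computes
`t(|x|)` and writes a circuit that simulates `B` on `x`, with the coins as variables. Its acceptance
probability is at least 2/3 or at most 1/3, so an error of 1/10 leaves the estimate on the correct
side of 1/2. The circuit string is itself the new input; its length exceeds the number of coins, and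
`s(m) ≥ m` for `m ≥ 2`, so variables and room suffice.

The circuit is designed to be written by a very simple program. A configuration is stored relative
to the heads: a control, followed by cells that hold the symbols at distance 1, 2, ... on both sides
of every head, together with future coins. Rows of `N + 2` states are laid one after another, and
every new state is a fixed function of the state just before it and the one `N + 1` places before it
(`sim_correct`). Since gates are referenced by distance, all later blocks are the same string,
repeated `N * N` times (`exists_blocks`, `exists_circuitStr`). Blocks have 2^g gates, so a long
distance is written by putting g fixed low digits in front of the digits of `N`. The cost is
O((t+1)³), which gives the exponent 3.

The simulation needs `n` to be O(t(n)). If this fails, the machine that computes `t` cannot see the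
end of some input 1^n, so `t` is eventually constant (`eq_of_computes`); the language then depends
on a bounded prefix and is reduced by table lookup. -/

namespace PseudoDet

open Turing

/-! ### Program fragments over a fixed set of tapes -/

/-- Pointwise update of a function. -/
noncomputable def upd {K α : Type} (σ : K → α) (k : K) (a : α) : K → α :=
  open Classical in fun k' => if k' = k then a else σ k'

section upd

variable {K α β : Type} (σ : K → α) (k k' : K) (a b : α)

@[simp] theorem upd_same : upd σ k a k = a := by simp [upd]

theorem upd_ne {k k' : K} (h : k' ≠ k) : upd σ k a k' = σ k' := by simp [upd, h]

@[simp] theorem upd_upd : upd (upd σ k a) k b = upd σ k b := by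
  funext k'; by_cases h : k' = k <;> simp [upd, h]

@[simp] theorem upd_eq_self : upd σ k (σ k) = σ := by
  funext k'; by_cases h : k' = k <;> simp [upd, h]

theorem upd_comp (f : α → β) : (fun j => f (upd σ k a j)) = upd (fun j => f (σ j)) k (f a) := by
  funext j; by_cases h : j = k <;> simp [upd, h]

end upd

/-- The contents of the tapes. -/
abbrev Tapes (K : Type) := K → Tape (Option Bool)

/-- The effect of one step on the tapes. -/
def actTapes {K : Type} (a : (K → Option Bool) × (K → Option Dir)) (τ : Tapes K) : Tapes K :=
  fun k => TM.moveHead (a.2 k) ((τ k).write (a.1 k))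

/-- A program fragment: a machine without distinguished input and output tapes. -/
structure Frag (K : Type) where
  Q : Type
  finQ : Finite Q
  start : Q
  halt : Q
  δ : Q → (K → Option Bool) → Bool → Q × (K → Option Bool) × (K → Option Dir)

/-! ### Paths of fragments and their composition. -/

namespace Frag

variable {K : Type}

/-- One step of a fragment. -/
def next (F : Frag K) (c : F.Q × Tapes K) (b : Bool) : F.Q × Tapes K :=
  ((F.δ c.1 (fun k => (c.2 k).head) b).1, actTapes (F.δ c.1 (fun k => (c.2 k).head) b).2 c.2)

/-- `Path c r c'`: with the coins `r`, the fragment goes from `c` to `c'`, and it is not halted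
before the last configuration. -/
inductive Path (F : Frag K) : F.Q × Tapes K → List Bool → F.Q × Tapes K → Prop
  | nil (c) : Path F c [] c
  | cons (c b r c') : c.1 ≠ F.halt → Path F (F.next c b) r c' → Path F c (b :: r) c'

theorem Path.append {F : Frag K} {c c' c'' r r'} (h : F.Path c r c') (h' : F.Path c' r' c'') :
    F.Path c (r ++ r') c'' := by
  induction h with
  | nil c => simpa
  | cons c b r c' hc _ ih => exact .cons _ _ _ _ hc (ih h')

/-- Composite fragments contain their parts as sets of states on which, before halting, they behave
identically. This transfers a run of a part into the composite. -/
theorem Path.map {F H : Frag K} (φ : F.Q → H.Q)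
    (hφ : ∀ q s b, q ≠ F.halt →
      φ q ≠ H.halt ∧ H.δ (φ q) s b = (φ (F.δ q s b).1, (F.δ q s b).2))
    {c r c'} (h : F.Path c r c') : H.Path (φ c.1, c.2) r (φ c'.1, c'.2) := by
  induction h with
  | nil c => exact .nil _
  | cons c b r c' hc _ ih =>
    refine .cons _ _ _ _ (hφ c.1 (fun _ => none) b hc).1 ?_
    simpa [next, (hφ c.1 _ b hc).2] using ih

/-- With the coins `r`, the fragment halts after exactly `r.length` steps. -/
def Halts (F : Frag K) (τ : Tapes K) (r : List Bool) (τ' : Tapes K) : Prop :=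
  F.Path (F.start, τ) r (F.halt, τ')

/-- A fragment that ignores its coins. -/
def Det (F : Frag K) : Prop := ∀ q s, F.δ q s false = F.δ q s true

theorem actTapes_id (τ : Tapes K) : actTapes ((fun k => (τ k).head), fun _ => none) τ = τ := by
  funext k; simp [actTapes, TM.moveHead]

open Classical in
/-- Sequential composition. -/
noncomputable def seq (F G : Frag K) : Frag K where
  Q := F.Q ⊕ G.Q
  finQ := by have := F.finQ; have := G.finQ; infer_instance
  start := .inl F.start
  halt := .inr G.halt
  δ := fun q s b => match q with
    | .inl q => if q = F.halt then (.inr G.start, s, fun _ => none)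
        else (.inl (F.δ q s b).1, (F.δ q s b).2)
    | .inr q => (.inr (G.δ q s b).1, (G.δ q s b).2)

/-- The coin `b` is consumed by the idle step that passes control from `F` to `G`. -/
theorem Halts.seq {F G : Frag K} {τ τ' τ'' r r'} (h : F.Halts τ r τ') (b : Bool)
    (h' : G.Halts τ' r' τ'') : (F.seq G).Halts τ (r ++ b :: r') τ'' := by
  have h1 := Path.map (H := F.seq G) Sum.inl
    (fun q s b hq => ⟨by simp [Frag.seq], by simp [Frag.seq, hq]⟩) h
  have h2 := Path.map (H := F.seq G) Sum.inr
    (fun q s b hq => ⟨by simpa [Frag.seq] using hq, by simp [Frag.seq]⟩) h'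
  refine h1.append (.cons _ _ _ _ (by simp [Frag.seq]) ?_)
  simpa [next, Frag.seq, actTapes_id] using h2

theorem Det.seq {F G : Frag K} (hF : F.Det) (hG : G.Det) : (F.seq G).Det := by
  intro q s
  cases q with
  | inl q => simp only [Frag.seq, hF q s]
  | inr q => simp only [Frag.seq, hG q s]

open Classical in
/-- A single action on the tape `k`: write `w` (`none` means to keep the symbol), then move. -/
noncomputable def basic (k : K) (w : Option (Option Bool)) (d : Option Dir) : Frag K where
  Q := Bool
  finQ := inferInstance
  start := false
  halt := true
  δ := fun _ s _ => (true, (fun k' => if k' = k then w.getD (s k) else s k'),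
    fun k' => if k' = k then d else none)

/-- The effect of a single action on its tape. -/
def basicTape (w : Option (Option Bool)) (d : Option Dir) (t : Tape (Option Bool)) :
    Tape (Option Bool) := TM.moveHead d (t.write (w.getD t.head))

theorem halts_basic (k : K) (w d) (τ : Tapes K) (b : Bool) :
    (basic k w d).Halts τ [b] (upd τ k (basicTape w d (τ k))) := by
  refine .cons _ _ _ _ (by simp [basic]) ?_
  have : (basic k w d).next ((basic k w d).start, τ) b =
      ((basic k w d).halt, upd τ k (basicTape w d (τ k))) := by
    simp only [next, basic, Prod.mk.injEq, true_and]
    funext k'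
    by_cases h : k' = k
    · subst h; simp [actTapes, basicTape]
    · simp [actTapes, h, upd, TM.moveHead]
  rw [this]
  exact .nil _

open Classical in
/-- Branching on the symbol scanned on the tape `k`. -/
noncomputable def branch (k : K) (F : Option Bool → Frag K) : Frag K where
  Q := Bool ⊕ (Σ o, (F o).Q)
  finQ := by have := fun o => (F o).finQ; infer_instance
  start := .inl false
  halt := .inl true
  δ := fun q s b => match q with
    | .inl _ => (.inr ⟨s k, (F (s k)).start⟩, s, fun _ => none)
    | .inr ⟨o, q⟩ => if q = (F o).halt then (.inl true, s, fun _ => none)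
        else (.inr ⟨o, ((F o).δ q s b).1⟩, ((F o).δ q s b).2)

theorem Halts.branch {k : K} {F : Option Bool → Frag K} {τ τ' r}
    (h : (F (τ k).head).Halts τ r τ') (b b' : Bool) :
    (Frag.branch k F).Halts τ (b :: (r ++ [b'])) τ' := by
  have h1 := Path.map (H := Frag.branch k F) (fun q => Sum.inr ⟨_, q⟩)
    (fun q s b hq => ⟨by simp [Frag.branch], by simp [Frag.branch, hq]⟩) h
  refine .cons _ _ _ _ (by simp [Frag.branch]) ?_
  have e : (Frag.branch k F).next ((Frag.branch k F).start, τ) b =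
      (Sum.inr ⟨_, (F (τ k).head).start⟩, τ) := by
    simp [next, Frag.branch, actTapes_id]
  rw [e]
  refine h1.append (.cons _ _ _ _ (by simp [Frag.branch]) ?_)
  simp only [next, Frag.branch, actTapes_id, if_true]
  exact .nil _

open Classical in
/-- Repetition as long as the tape `k` does not scan a blank. -/
noncomputable def loop (k : K) (F : Frag K) : Frag K where
  Q := Bool ⊕ F.Q
  finQ := by have := F.finQ; infer_instance
  start := .inl false
  halt := .inl true
  δ := fun q s b => match q with
    | .inl _ => if s k = none then (.inl true, s, fun _ => none)
        else (.inr F.start, s, fun _ => none)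
    | .inr q => if q = F.halt then (.inl false, s, fun _ => none)
        else (.inr (F.δ q s b).1, (F.δ q s b).2)

theorem halts_loop_nil {k : K} {F : Frag K} {τ : Tapes K} (h : (τ k).head = none) (b : Bool) :
    (loop k F).Halts τ [b] τ := by
  refine .cons _ _ _ _ (by simp [loop]) ?_
  simp only [next, loop, h, if_true, actTapes_id]
  exact .nil _

theorem Halts.loop_cons {k : K} {F : Frag K} {τ τ' τ'' : Tapes K} {r r'}
    (h : (τ k).head ≠ none) (h1 : F.Halts τ r τ') (h2 : (loop k F).Halts τ' r' τ'') (b b' : Bool) :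
    (loop k F).Halts τ (b :: (r ++ b' :: r')) τ'' := by
  have h1 := Path.map (H := loop k F) Sum.inr
    (fun q s b hq => ⟨by simp [loop], by simp [loop, hq]⟩) h1
  refine .cons _ _ _ _ (by simp [loop]) ?_
  have e : (loop k F).next ((loop k F).start, τ) b = (Sum.inr F.start, τ) := by
    simp [next, loop, actTapes_id, h]
  rw [e]
  refine h1.append (.cons _ _ _ _ (by simp [loop]) ?_)
  have e : (loop k F).next (Sum.inr F.halt, τ') b' = ((loop k F).start, τ') := by
    simp [next, loop, actTapes_id]
  rw [e]
  exact h2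

/-- A fragment on the tapes `K` as a fragment with the additional tapes `K'`. -/
def lift (K' : Type) (F : Frag K) : Frag (K' ⊕ K) where
  Q := F.Q
  finQ := F.finQ
  start := F.start
  halt := F.halt
  δ := fun q s b => ((F.δ q (fun k => s (.inr k)) b).1,
    Sum.elim (fun k => s (.inl k)) (F.δ q (fun k => s (.inr k)) b).2.1,
    Sum.elim (fun _ => none) (F.δ q (fun k => s (.inr k)) b).2.2)

theorem Path.lift {K' : Type} {F : Frag K} {c r c'} (h : F.Path c r c') (τ₀ : Tapes K') :
    (F.lift K').Path (c.1, Sum.elim τ₀ c.2) r (c'.1, Sum.elim τ₀ c'.2) := by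
  induction h with
  | nil c => exact .nil _
  | cons c b r c' hc _ ih =>
    refine .cons _ _ _ _ hc ?_
    have : (F.lift K').next (c.1, Sum.elim τ₀ c.2) b =
        ((F.next c b).1, Sum.elim τ₀ (F.next c b).2) := by
      simp only [next, Frag.lift, Sum.elim_inr, Sum.elim_inl, Prod.mk.injEq, true_and]
      funext k
      cases k <;> simp [actTapes, TM.moveHead]
    rw [this]
    exact ih

theorem Det.lift {K' : Type} {F : Frag K} (hF : F.Det) : (F.lift K').Det := by
  intro q s
  simp only [Frag.lift, hF q]

/-- A fragment as a machine. -/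
def toTM [Finite K] (F : Frag K) (i o : K) (h : i ≠ o) : TM where
  K := K
  Q := F.Q
  finK := inferInstance
  finQ := F.finQ
  inp := i
  out := o
  inp_ne_out := h
  start := F.start
  halt := F.halt
  δ := F.δ

theorem foldl_step_halt {M : TM} (c : M.Cfg) (h : c.state = M.halt) (r : List Bool) :
    r.foldl M.step c = c := by
  induction r with
  | nil => rfl
  | cons b r ih => simpa [TM.step, h] using ih

theorem Path.foldl_toTM [Finite K] {F : Frag K} {i o : K} {h : i ≠ o} {c r c'}
    (hp : F.Path c r c') :
    r.foldl (F.toTM i o h).step ⟨c.1, c.2⟩ = ⟨c'.1, c'.2⟩ := by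
  induction hp with
  | nil c => rfl
  | cons c b r c' hc _ ih =>
    rw [List.foldl_cons, ← ih]
    congr 1
    exact if_neg (c := c.1 = F.halt) hc

end Frag

/-- A machine as a fragment. -/
def TM.frag (M : TM) : Frag M.K where
  Q := M.Q
  finQ := M.finQ
  start := M.start
  halt := M.halt
  δ := M.δ

/-- A run that ends halted is a genuine computation followed by idle steps. The cut depends on the
coins, which is why only its existence is asserted. -/
theorem TM.exists_path {M : TM} (r : List Bool) (c : M.Cfg)
    (h : (r.foldl M.step c).state = M.halt) :
    ∃ r₁ r₂, r = r₁ ++ r₂ ∧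
      M.frag.Path (c.state, c.tape) r₁ (M.halt, (r.foldl M.step c).tape) := by
  induction r generalizing c with
  | nil => exact ⟨[], [], rfl, by
      have : c.state = M.halt := h
      simpa [this] using Frag.Path.nil (F := M.frag) (M.halt, c.tape)⟩
  | cons b r ih =>
    by_cases hc : c.state = M.halt
    · refine ⟨[], b :: r, rfl, ?_⟩
      rw [Frag.foldl_step_halt c hc, hc]
      exact .nil _
    · obtain ⟨r₁, r₂, e, hp⟩ := ih (M.step c b) h
      refine ⟨b :: r₁, r₂, by simp [e], .cons _ _ _ _ hc ?_⟩
      have : M.frag.next (c.state, c.tape) b = ((M.step c b).state, (M.step c b).tape) := by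
        simp only [TM.step, hc, if_false]
        rfl
      rw [this]
      exact hp

/-! ### Structured programs -/

/-- Structured deterministic programs over the tapes `K`. -/
inductive Prog (K : Type) where
  | basic (k : K) (w : Option (Option Bool)) (d : Option Dir)
  | seq (p q : Prog K)
  | branch (k : K) (p : Option Bool → Prog K)
  | loop (k : K) (p : Prog K)

namespace Prog

variable {K : Type}

infixr:67 " ;; " => Prog.seq

/-- The fragment that executes a program. -/
noncomputable def compile : Prog K → Frag K
  | .basic k w d => Frag.basic k w d
  | .seq p q => p.compile.seq q.compile
  | .branch k p => Frag.branch k fun o => (p o).compile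
  | .loop k p => Frag.loop k p.compile

/-- `Exec p τ n τ'`: the program turns the tapes `τ` into `τ'` in exactly `n` steps. -/
inductive Exec : Prog K → Tapes K → ℕ → Tapes K → Prop
  | basic (k w d τ) : Exec (.basic k w d) τ 1 (upd τ k (Frag.basicTape w d (τ k)))
  | seq {p q τ n τ' m τ''} : Exec p τ n τ' → Exec q τ' m τ'' → Exec (p ;; q) τ (n + (m + 1)) τ''
  | branch {k p τ n τ'} : Exec (p (τ k).head) τ n τ' → Exec (.branch k p) τ (n + 1 + 1) τ'
  | loop_nil {k p τ} : (τ k).head = none → Exec (.loop k p) τ 1 τ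
  | loop_cons {k p τ n τ' m τ''} : (τ k).head ≠ none → Exec p τ n τ' → Exec (.loop k p) τ' m τ'' →
      Exec (.loop k p) τ (n + (m + 1) + 1) τ''

theorem det_compile (p : Prog K) : p.compile.Det := by
  induction p with
  | basic k w d => intro q s; rfl
  | seq p q hp hq => exact hp.seq hq
  | branch k p ih =>
    rintro (q | ⟨o, q⟩) s
    · rfl
    · simp only [compile, Frag.branch, ih o q s]
  | loop k p ih =>
    rintro (q | q) s
    · rfl
    · simp only [compile, Frag.loop, ih q s]

/-- Programs ignore coins, so their exact running time does not depend on them. This later allows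
the coins of a subroutine to be located at a fixed offset. -/
theorem Exec.halts {p : Prog K} {τ n τ'} (h : Exec p τ n τ') :
    ∀ r : List Bool, r.length = n → p.compile.Halts τ r τ' := by
  induction h with
  | basic k w d τ =>
    intro r hr
    obtain ⟨b, rfl⟩ := List.length_eq_one_iff.1 hr
    exact Frag.halts_basic k w d τ b
  | @seq p q τ n τ' m τ'' _ _ ih1 ih2 =>
    intro r hr
    have h1 := ih1 (r.take n) (by simp; omega)
    rcases hd : r.drop n with _ | ⟨b, r'⟩
    · have := congrArg List.length hd
      simp at this; omega
    · have hl := congrArg List.length hd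
      simp at hl
      have := h1.seq b (ih2 r' (by omega))
      rwa [← hd, List.take_append_drop] at this
  | @branch k p τ n τ' _ ih =>
    intro r hr
    rcases r with _ | ⟨b, r⟩
    · simp at hr
    · rcases List.eq_nil_or_concat r with rfl | ⟨r, b', rfl⟩
      · simp at hr
      · have := Frag.Halts.branch (F := fun o => (p o).compile) (ih r (by simpa using hr)) b b'
        simpa [compile] using this
  | loop_nil h =>
    intro r hr
    obtain ⟨b, rfl⟩ := List.length_eq_one_iff.1 hr
    exact Frag.halts_loop_nil h b
  | @loop_cons k p τ n τ' m τ'' h _ _ ih1 ih2 =>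
    intro r hr
    rcases r with _ | ⟨b, r⟩
    · simp at hr
    · have hr' : r.length = n + (m + 1) := by simpa using hr
      have h1 := ih1 (r.take n) (by simp; omega)
      rcases hd : r.drop n with _ | ⟨b', r'⟩
      · have := congrArg List.length hd
        simp at this; omega
      · have hl := congrArg List.length hd
        simp at hl
        have := h1.loop_cons h (ih2 r' (by omega)) b b'
        rwa [← hd, List.take_append_drop] at this

/-- The program turns the tapes `τ` into `τ'` in at most `N` steps. -/
def Run (p : Prog K) (τ : Tapes K) (N : ℕ) (τ' : Tapes K) : Prop := ∃ n ≤ N, Exec p τ n τ'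

theorem Run.mono {p : Prog K} {τ N τ' N'} (h : p.Run τ N τ') (hN : N ≤ N') : p.Run τ N' τ' := by
  obtain ⟨n, hn, h⟩ := h
  exact ⟨n, hn.trans hN, h⟩

theorem run_basic (k : K) (w d) (τ : Tapes K) :
    Run (.basic k w d) τ 1 (upd τ k (Frag.basicTape w d (τ k))) := ⟨1, le_rfl, .basic ..⟩

theorem Run.seq {p q : Prog K} {τ N τ' M τ''} (h : p.Run τ N τ') (h' : q.Run τ' M τ'') :
    (p ;; q).Run τ (N + M + 1) τ'' := by
  obtain ⟨n, hn, h⟩ := h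
  obtain ⟨m, hm, h'⟩ := h'
  exact ⟨_, by omega, h.seq h'⟩

theorem Run.branch {k : K} {p : Option Bool → Prog K} {τ N τ'} (h : (p (τ k).head).Run τ N τ') :
    (Prog.branch k p).Run τ (N + 2) τ' := by
  obtain ⟨n, hn, h⟩ := h
  exact ⟨_, by omega, h.branch⟩

theorem run_loop_nil {k : K} {p : Prog K} {τ : Tapes K} (h : (τ k).head = none) :
    (Prog.loop k p).Run τ 1 τ := ⟨1, le_rfl, .loop_nil h⟩

theorem Run.loop_cons {k : K} {p : Prog K} {τ N τ' M τ''} (h : (τ k).head ≠ none)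
    (h1 : p.Run τ N τ') (h2 : (Prog.loop k p).Run τ' M τ'') :
    (Prog.loop k p).Run τ (N + M + 2) τ'' := by
  obtain ⟨n, hn, h1⟩ := h1
  obtain ⟨m, hm, h2⟩ := h2
  exact ⟨_, by omega, h1.loop_cons h h2⟩

/-- A program on the tapes `K` as a program with additional tapes. -/
def lift (K' : Type) : Prog K → Prog (K ⊕ K')
  | .basic k w d => .basic (.inl k) w d
  | .seq p q => p.lift K' ;; q.lift K'
  | .branch k p => .branch (.inl k) fun o => (p o).lift K'
  | .loop k p => .loop (.inl k) (p.lift K')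

theorem elim_upd_inl {K K' α : Type} (τ : K → α) (τ₀ : K' → α) (k : K) (a : α) :
    Sum.elim (upd τ k a) τ₀ = upd (Sum.elim τ τ₀) (.inl k) a := by
  funext j
  rcases j with j | j
  · by_cases h : j = k <;> simp [upd, h]
  · simp [upd]

theorem elim_upd_inr {K K' α : Type} (τ : K → α) (τ₀ : K' → α) (k : K') (a : α) :
    Sum.elim τ (upd τ₀ k a) = upd (Sum.elim τ τ₀) (.inr k) a := by
  funext j
  rcases j with j | j
  · simp [upd]
  · by_cases h : j = k <;> simp [upd, h]

theorem Exec.lift {K' : Type} {p : Prog K} {τ n τ'} (h : Exec p τ n τ') (τ₀ : Tapes K') :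
    Exec (p.lift K') (Sum.elim τ τ₀) n (Sum.elim τ' τ₀) := by
  induction h with
  | basic k w d τ =>
    rw [elim_upd_inl]
    exact .basic (.inl k) w d (Sum.elim τ τ₀)
  | seq _ _ ih1 ih2 => exact .seq ih1 ih2
  | branch _ ih => exact .branch ih
  | loop_nil h => exact .loop_nil h
  | loop_cons h _ _ ih1 ih2 => exact .loop_cons h ih1 ih2

theorem Run.lift {K' : Type} {p : Prog K} {τ N τ'} (h : p.Run τ N τ') (τ₀ : Tapes K') :
    (p.lift K').Run (Sum.elim τ τ₀) N (Sum.elim τ' τ₀) := by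
  obtain ⟨n, hn, h⟩ := h
  exact ⟨n, hn, h.lift τ₀⟩

end Prog

/-! ### Tapes as stacks -/

/-- The tape that holds the stack `l`, with the head on the top. -/
def stk (l : List Bool) : Tape (Option Bool) := Tape.mk₁ (l.map some)

@[simp] theorem head_stk (l : List Bool) : (stk l).head = l.head? := by
  cases l <;> rfl

/-- Popping erases a cell and leaves it to the left of the head; as that side is otherwise blank,
the result is literally the tape of a shorter stack. -/
theorem mk_none : ListBlank.mk [(none : Option Bool)] = ListBlank.mk [] := by
  refine ListBlank.ext fun i => ?_
  cases i <;> simp [ListBlank.nth_mk] <;> rfl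

theorem basicTape_pop (l : List Bool) :
    Frag.basicTape (some none) (some .right) (stk l) = stk l.tail := by
  cases l <;>
    simp [Frag.basicTape, TM.moveHead, stk, Tape.mk₁, Tape.mk₂, Tape.mk', Tape.write, Tape.move,
      mk_none]

theorem basicTape_push (b : Bool) (l : List Bool) :
    Frag.basicTape (some (some b)) none (Frag.basicTape none (some .left) (stk l)) =
      stk (b :: l) := by
  cases l <;>
    simp [Frag.basicTape, TM.moveHead, stk, Tape.mk₁, Tape.mk₂, Tape.mk', Tape.write, Tape.move]
  exact mk_none

/-! ### Programs on stacks -/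

namespace Prog

variable {K : Type}

/-- The program turns the stacks `σ` into `σ'` in at most `N` steps. -/
def SRun (p : Prog K) (σ : K → List Bool) (N : ℕ) (σ' : K → List Bool) : Prop :=
  p.Run (fun k => stk (σ k)) N (fun k => stk (σ' k))

theorem SRun.mono {p : Prog K} {σ N σ' N'} (h : p.SRun σ N σ') (hN : N ≤ N') : p.SRun σ N' σ' :=
  Run.mono h hN

theorem SRun.seq {p q : Prog K} {σ N σ' M σ''} (h : p.SRun σ N σ') (h' : q.SRun σ' M σ'') :
    (p ;; q).SRun σ (N + M + 1) σ'' := Run.seq h h'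

theorem SRun.branch {k : K} {p : Option Bool → Prog K} {σ N σ'}
    (h : (p (σ k).head?).SRun σ N σ') : (Prog.branch k p).SRun σ (N + 2) σ' := by
  refine Run.branch (p := p) ?_
  rw [head_stk]
  exact h

theorem srun_loop_nil {k : K} {p : Prog K} {σ : K → List Bool} (h : σ k = []) :
    (Prog.loop k p).SRun σ 1 σ := run_loop_nil (by simp [h])

theorem SRun.loop_cons {k : K} {p : Prog K} {σ N σ' M σ''} (h : σ k ≠ [])
    (h1 : p.SRun σ N σ') (h2 : (Prog.loop k p).SRun σ' M σ'') :
    (Prog.loop k p).SRun σ (N + M + 2) σ'' :=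
  Run.loop_cons (by simpa using h) h1 h2

/-- The program that does nothing (for one step). -/
def skip (k : K) : Prog K := .basic k none none

theorem run_skip (k : K) (τ : Tapes K) : (skip k).Run τ 1 τ := by
  have := run_basic k none none τ
  have h : Frag.basicTape none none (τ k) = τ k := by simp [Frag.basicTape, TM.moveHead]
  rwa [h, upd_eq_self] at this

theorem srun_skip (k : K) (σ : K → List Bool) : (skip k).SRun σ 1 σ := run_skip k _

/-- Pushes the symbol `b` onto the stack `k`. -/
def push (k : K) (b : Bool) : Prog K :=
  .basic k none (some .left) ;; .basic k (some (some b)) none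

theorem run_push (k : K) (b : Bool) (τ : Tapes K) (l : List Bool) (h : τ k = stk l) :
    (push k b).Run τ 3 (upd τ k (stk (b :: l))) := by
  have := (run_basic k none (some .left) τ).seq (run_basic k (some (some b)) none _)
  rwa [upd_same, upd_upd, h, basicTape_push] at this

theorem srun_push (k : K) (b : Bool) (σ : K → List Bool) :
    (push k b).SRun σ 3 (upd σ k (b :: σ k)) := by
  have := run_push k b (fun k => stk (σ k)) (σ k) rfl
  rwa [← upd_comp] at this

/-- Removes the top of the stack `k`. -/
def pop (k : K) : Prog K := .basic k (some none) (some .right)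

theorem srun_pop (k : K) (σ : K → List Bool) : (pop k).SRun σ 1 (upd σ k (σ k).tail) := by
  have := run_basic k (some none) (some .right) (fun k => stk (σ k))
  rwa [basicTape_pop, ← upd_comp] at this

/-- Pops the symbols `c` of the stack `k` one by one and executes `body c`. -/
def each (k : K) (body : Bool → Prog K) : Prog K :=
  .loop k (.branch k fun o => match o with
    | none => skip k
    | some c => pop k ;; body c)

theorem srun_each_nil {k : K} {body : Bool → Prog K} {σ : K → List Bool} (h : σ k = []) :
    (each k body).SRun σ 1 σ := srun_loop_nil h

theorem SRun.each_cons {k : K} {body : Bool → Prog K} {σ N σ' M σ'' c l} (h : σ k = c :: l)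
    (h1 : (body c).SRun (upd σ k l) N σ') (h2 : (each k body).SRun σ' M σ'') :
    (each k body).SRun σ (N + M + 6) σ'' := by
  refine (SRun.loop_cons (N := N + 4) (by simp [h]) ?_ h2).mono (by omega)
  refine (SRun.branch (N := N + 2) ?_)
  have := srun_pop k σ
  rw [h] at this ⊢
  exact (this.seq h1).mono (by omega)

/-- `S i` is the loop invariant after `i` symbols; its value at `k` is irrelevant, being overwritten
by the unread rest of `l`. -/
theorem srun_each {k : K} {body : Bool → Prog K} {N : ℕ} (l : List Bool) (S : ℕ → K → List Bool)
    (hb : ∀ i (hi : i < l.length), (body l[i]).SRun (upd (S i) k (l.drop (i + 1))) N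
      (upd (S (i + 1)) k (l.drop (i + 1)))) :
    (each k body).SRun (upd (S 0) k l) (l.length * (N + 6) + 1) (upd (S l.length) k []) := by
  induction l generalizing S with
  | nil => exact (srun_each_nil (by simp)).mono (by simp)
  | cons c l ih =>
    have h0 := hb 0 (by simp)
    have h1 := ih (fun i => S (i + 1)) fun i hi => hb (i + 1) (by simpa using hi)
    refine (SRun.each_cons (c := c) (l := l) (by simp) (by simpa using h0)
      (by simpa using h1)).mono ?_
    simp only [List.length_cons]
    ring_nf
    omega

theorem srun_each' {k : K} {body : Bool → Prog K} {N : ℕ} (σ σ' : K → List Bool)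
    (S : ℕ → K → List Bool) (h0 : upd (S 0) k (σ k) = σ) (h1 : upd (S (σ k).length) k [] = σ')
    (hb : ∀ i (hi : i < (σ k).length), (body (σ k)[i]).SRun (upd (S i) k ((σ k).drop (i + 1))) N
      (upd (S (i + 1)) k ((σ k).drop (i + 1)))) :
    (each k body).SRun σ ((σ k).length * (N + 6) + 1) σ' := by
  have := srun_each (σ k) S hb
  rwa [h0, h1] at this

theorem SRun.congr {p : Prog K} {σ N σ' σ₁ σ₁' N'} (h : p.SRun σ N σ') (h0 : σ = σ₁)
    (hN : N ≤ N') (h1 : σ' = σ₁') : p.SRun σ₁ N' σ₁' := by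
  subst h0 h1
  exact h.mono hN

/-- Moves the contents of the stack `a`, in reverse order, onto the stack `b`. -/
def move (a b : K) : Prog K := each a fun c => push b c

theorem srun_move {a b : K} (hab : a ≠ b) (σ : K → List Bool) :
    (move a b).SRun σ ((σ a).length * 9 + 1) (upd (upd σ a []) b ((σ a).reverse ++ σ b)) := by
  induction h : σ a generalizing σ with
  | nil =>
    refine (srun_each_nil h).congr rfl (by simp) ?_
    funext j
    by_cases h1 : j = a <;> by_cases h2 : j = b <;> simp_all [upd]
  | cons c l ih =>
    refine (SRun.each_cons h (srun_push b c _) (ih _ ?_)).congr rfl ?_ ?_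
    · rw [upd_ne _ _ hab]; simp
    · simp only [List.length_cons]; omega
    · funext j
      by_cases h1 : j = a <;> by_cases h2 : j = b <;> simp_all [upd]

/-- Empties the stack `k`. -/
def clear (k : K) : Prog K := each k fun _ => skip k

theorem srun_clear (k : K) (σ : K → List Bool) :
    (clear k).SRun σ ((σ k).length * 7 + 1) (upd σ k []) :=
  srun_each' σ _ (fun _ => σ) (by simp) rfl fun _ _ => srun_skip _ _

/-- Pushes the symbols of `l` one after the other. -/
def pushes (k : K) : List Bool → Prog K
  | [] => skip k
  | b :: l => push k b ;; pushes k l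

theorem srun_pushes (k : K) (l : List Bool) (σ : K → List Bool) :
    (pushes k l).SRun σ (l.length * 4 + 1) (upd σ k (l.reverse ++ σ k)) := by
  induction l generalizing σ with
  | nil => exact (srun_skip k σ).congr rfl (by simp) (by simp)
  | cons b l ih =>
    exact ((srun_push k b σ).seq (ih _)).congr rfl (by simp only [List.length_cons]; omega)
      (by simp)

/-- Moves the contents of the stack `a`, in reverse order, onto the stacks `b` and `c`. -/
def move₂ (a b c : K) : Prog K := each a fun x => push b x ;; push c x

theorem srun_move₂ {a b c : K} (hab : a ≠ b) (hac : a ≠ c) (hbc : b ≠ c) (σ : K → List Bool) :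
    (move₂ a b c).SRun σ ((σ a).length * 13 + 1)
      (upd (upd (upd σ a []) b ((σ a).reverse ++ σ b)) c ((σ a).reverse ++ σ c)) := by
  induction h : σ a generalizing σ with
  | nil =>
    refine (srun_each_nil h).congr rfl (by simp) ?_
    funext j
    by_cases h1 : j = a <;> by_cases h2 : j = b <;> by_cases h3 : j = c <;> simp_all [upd]
  | cons x l ih =>
    refine (SRun.each_cons h ((srun_push b x _).seq (srun_push c x _)) (ih _ ?_)).congr rfl ?_ ?_
    · rw [upd_ne _ _ hac, upd_ne _ _ hab]; simp
    · simp only [List.length_cons]; omega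
    · funext j
      by_cases h1 : j = a <;> by_cases h2 : j = b <;> by_cases h3 : j = c <;> simp_all [upd]

/-- Puts a copy of the stack `a` on top of the stack `b`. -/
def copy (a b aux : K) : Prog K := move a aux ;; move₂ aux a b

theorem srun_copy {a b aux : K} (hab : a ≠ b) (ha : a ≠ aux) (hb : b ≠ aux) (σ : K → List Bool)
    (hσ : σ aux = []) :
    (copy a b aux).SRun σ ((σ a).length * 22 + 3) (upd σ b (σ a ++ σ b)) := by
  refine ((srun_move ha σ).seq (srun_move₂ ha.symm hb.symm hab _)).congr rfl ?_ ?_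
  · simp [hσ]; omega
  · funext j
    by_cases h1 : j = a <;> by_cases h2 : j = b <;> by_cases h3 : j = aux <;> simp_all [upd]

/-! #### Binary numbers on stacks -/

/-- The number with the binary digits `l`, least significant digit first. -/
def val (l : List Bool) : ℕ := l.foldr Nat.bit 0

@[simp] theorem val_nil : val [] = 0 := rfl

@[simp] theorem val_cons (b l) : val (b :: l) = Nat.bit b (val l) := rfl

theorem val_append (l l' : List Bool) : val (l ++ l') = val l + 2 ^ l.length * val l' := by
  induction l with
  | nil => simp
  | cons b l ih =>
    simp only [List.cons_append, val_cons, ih, Nat.bit_val, List.length_cons, pow_succ]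
    ring

theorem val_bits (n : ℕ) : val (Nat.bits n) = n := by
  induction n using Nat.binaryRec' with
  | zero => simp
  | bit b n h ih => rw [Nat.bits_append_bit _ _ h, val_cons, ih]

theorem val_lt (l : List Bool) : val l < 2 ^ l.length := by
  induction l with
  | nil => simp
  | cons b l ih =>
    simp only [val_cons, Nat.bit_val, List.length_cons, pow_succ]
    cases b <;> simp <;> omega

/-- The `m` least significant binary digits of `n`. -/
def dig : ℕ → ℕ → List Bool
  | 0, _ => []
  | m + 1, n => n.bodd :: dig m n.div2

@[simp] theorem length_dig (m n : ℕ) : (dig m n).length = m := by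
  induction m generalizing n with
  | zero => rfl
  | succ m ih => simp [dig, ih]

/-- Digit strings of a fixed width correspond exactly to their values. Counters keep this width,
leading zeros included. -/
theorem dig_val (l : List Bool) : dig l.length (val l) = l := by
  induction l with
  | nil => rfl
  | cons b l ih => simp [dig, ih]

theorem val_dig {m n : ℕ} (h : n < 2 ^ m) : val (dig m n) = n := by
  induction m generalizing n with
  | zero => simp at h; simp [h, dig]
  | succ m ih =>
    rw [dig, val_cons, ih, Nat.bit_bodd_div2]
    rw [Nat.div2_val]
    omega

/-- Decrements a binary number; the second component says that the number was `0`. -/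
def decr : List Bool → List Bool × Bool
  | [] => ([], true)
  | true :: l => (false :: l, false)
  | false :: l => (true :: (decr l).1, (decr l).2)

theorem decr_zero {l : List Bool} (h : val l = 0) : (decr l).2 = true := by
  induction l with
  | nil => rfl
  | cons b l ih => cases b <;> simp_all [decr, Nat.bit_val]

theorem length_decr (l : List Bool) : (decr l).1.length = l.length := by
  induction l with
  | nil => rfl
  | cons b l ih => cases b <;> simp_all [decr]

theorem decr_succ {l : List Bool} {v : ℕ} (h : val l = v + 1) :
    decr l = (dig l.length v, false) := by
  have key : (decr l).2 = false ∧ val (decr l).1 = v := by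
    induction l generalizing v with
    | nil => simp at h
    | cons b l ih =>
      cases b
      · simp only [val_cons, Nat.bit_val, Bool.toNat_false, add_zero] at h
        obtain ⟨h1, h2⟩ := ih (v := val l - 1) (by omega)
        simp only [decr, h1, val_cons, h2, Nat.bit_val, Bool.toNat_true, true_and]
        omega
      · simp only [val_cons, Nat.bit_val, Bool.toNat_true] at h
        simp [decr, Nat.bit_val]
        omega
  rw [← length_decr, ← key.2, dig_val, ← key.1]

/-- One step of `dec`. -/
def decBody (aux fl : K) (c : Bool) : Prog K :=
  .branch fl fun o => match o with
    | none => push aux c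
    | some _ => if c then pop fl ;; push aux false else push aux true

/-- Decrements the number on the stack `k`, and empties the stack if the number is `0`. -/
def dec (k aux fl : K) : Prog K :=
  push fl true ;; each k (decBody aux fl) ;; .branch fl fun o => match o with
    | none => move aux k
    | some _ => pop fl ;; clear aux

/-! ### Correctness of the binary decrement. -/

section dec

variable {k aux fl : K}

/-- An empty `fl` means that the borrow has been absorbed; the remaining digits are merely copied.
-/
theorem srun_decBody_none (h1 : k ≠ aux) (h2 : k ≠ fl) (h3 : aux ≠ fl)
    (σ : K → List Bool) (hf : σ fl = []) :
    (each k (decBody aux fl)).SRun σ ((σ k).length * 13 + 1)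
      (upd (upd σ k []) aux ((σ k).reverse ++ σ aux)) := by
  induction h : σ k generalizing σ with
  | nil =>
    refine (srun_each_nil h).congr rfl (by simp) ?_
    funext j
    by_cases h1 : j = k <;> by_cases h2 : j = aux <;> simp_all [upd]
  | cons c l ih =>
    have hb : (decBody aux fl c).SRun (upd σ k l) 5
        (upd (upd σ k l) aux (c :: upd σ k l aux)) := by
      refine SRun.branch ?_
      rw [upd_ne _ _ h2.symm, hf]
      exact srun_push _ _ _
    refine (SRun.each_cons h hb (ih _ ?_ ?_)).congr rfl ?_ ?_
    · rw [upd_ne _ _ h3.symm, upd_ne _ _ h2.symm, hf]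
    · rw [upd_ne _ _ h1]; simp
    · simp only [List.length_cons]; omega
    · funext j
      by_cases h1 : j = k <;> by_cases h2 : j = aux <;> simp_all [upd]

/-- A symbol on `fl` is a pending borrow: it turns zeros into ones until the first one absorbs it.
If it survives all digits, the number was zero. -/
theorem srun_decBody_some (h1 : k ≠ aux) (h2 : k ≠ fl) (h3 : aux ≠ fl)
    (σ : K → List Bool) (hf : σ fl = [true]) :
    (each k (decBody aux fl)).SRun σ ((σ k).length * 13 + 1)
      (upd (upd (upd σ k []) aux ((decr (σ k)).1.reverse ++ σ aux)) fl
        (bif (decr (σ k)).2 then [true] else [])) := by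
  induction h : σ k generalizing σ with
  | nil =>
    refine (srun_each_nil h).congr rfl (by simp) ?_
    simp only [decr]
    funext j
    by_cases h1 : j = k <;> by_cases h2 : j = aux <;> by_cases h3 : j = fl <;> simp_all [upd]
  | cons c l ih =>
    cases c with
    | true =>
      have hb : (decBody aux fl true).SRun (upd σ k l) 7
          (upd (upd (upd σ k l) fl []) aux (false :: σ aux)) := by
        refine SRun.branch ?_
        rw [upd_ne _ _ h2.symm, hf]
        refine ((srun_pop fl _).seq (srun_push aux false _)).congr rfl (by norm_num) ?_
        funext j
        by_cases h1 : j = k <;> by_cases h2 : j = aux <;> by_cases h3 : j = fl <;> simp_all [upd]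
      refine (SRun.each_cons h hb (srun_decBody_none h1 h2 h3 _ ?_)).congr rfl ?_ ?_
      · rw [upd_ne _ _ h3.symm, upd_same]
      · rw [upd_ne _ _ h1, upd_ne _ _ h2, upd_same]
        simp only [List.length_cons]; omega
      · funext j
        by_cases h1 : j = k <;> by_cases h2 : j = aux <;> by_cases h3 : j = fl <;>
          simp_all [upd, decr]
    | false =>
      have hb : (decBody aux fl false).SRun (upd σ k l) 5
          (upd (upd σ k l) aux (true :: upd σ k l aux)) := by
        refine SRun.branch ?_
        rw [upd_ne _ _ h2.symm, hf]
        exact srun_push _ _ _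
      refine (SRun.each_cons h hb (ih _ ?_ ?_)).congr rfl ?_ ?_
      · rw [upd_ne _ _ h3.symm, upd_ne _ _ h2.symm, hf]
      · rw [upd_ne _ _ h1]; simp
      · simp only [List.length_cons]; omega
      · funext j
        by_cases h1 : j = k <;> by_cases h2 : j = aux <;> by_cases h3 : j = fl <;>
          simp_all [upd, decr]

theorem srun_dec (h1 : k ≠ aux) (h2 : k ≠ fl) (h3 : aux ≠ fl)
    (σ : K → List Bool) (ha : σ aux = []) (hf : σ fl = []) :
    (dec k aux fl).SRun σ ((σ k).length * 22 + 11)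
      (upd σ k (bif (decr (σ k)).2 then [] else (decr (σ k)).1)) := by
  have e1 := srun_push fl true σ
  have e2 := srun_decBody_some h1 h2 h3 (upd σ fl (true :: σ fl)) (by simp [hf])
  rw [upd_ne _ _ h2, upd_ne _ _ h3] at e2
  refine (e1.seq (e2.seq (SRun.branch (N := (σ k).length * 9 + 3) (σ' := upd σ k
    (bif (decr (σ k)).2 then [] else (decr (σ k)).1)) ?_))).mono (by omega)
  have hl := length_decr (σ k)
  cases hd : (decr (σ k)).2 with
  | true =>
    simp only [upd_same, cond_true, List.head?_cons]
    refine ((srun_pop fl _).seq (srun_clear aux _)).congr rfl ?_ ?_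
    · simp [upd, h3, ha, hl]; omega
    · funext j
      by_cases h1 : j = k <;> by_cases h2 : j = aux <;> by_cases h3 : j = fl <;>
          simp_all [upd]
  | false =>
    simp only [upd_same]
    refine (srun_move h1.symm _).congr rfl ?_ ?_
    · simp [upd, h3, ha, hl]
    · funext j
      by_cases h1 : j = k <;> by_cases h2 : j = aux <;> by_cases h3 : j = fl <;>
          simp_all [upd]

end dec

/-- Executes `body` as often as the number on the stack `k` says; on the way the number is counted
down. -/
def forDec (k aux fl : K) (body : Prog K) : Prog K :=
  dec k aux fl ;; .loop k (body ;; dec k aux fl)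

/-- The loop test sees only whether the stack is empty. This works because `dec` empties the stack
exactly when asked to decrement zero, while a counter with value zero still shows its digits. The
decrement precedes the body, so round `i` sees `n - 1 - i`. -/
theorem srun_forDec {k aux fl : K} (h1 : k ≠ aux) (h2 : k ≠ fl) (h3 : aux ≠ fl) (body : Prog K)
    (len N : ℕ) (n : ℕ) (hn : n < 2 ^ len) (S : ℕ → K → List Bool)
    (hb : ∀ i < n, body.SRun (upd (S i) k (dig len (n - 1 - i))) N
      (upd (S (i + 1)) k (dig len (n - 1 - i))))
    (ha : ∀ i, S i aux = []) (hf : ∀ i, S i fl = []) :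
    (forDec k aux fl body).SRun (upd (S 0) k (dig len n)) ((n + 1) * (N + len * 22 + 15))
      (upd (S n) k []) := by
  have hdec : ∀ i v, v < 2 ^ len → (dec k aux fl).SRun (upd (S i) k (dig len v)) (len * 22 + 11)
      (upd (S i) k (if v = 0 then [] else dig len (v - 1))) := by
    intro i v hv
    refine (srun_dec h1 h2 h3 (upd (S i) k (dig len v)) ?_ ?_).congr rfl ?_ ?_
    · rw [upd_ne _ _ h1.symm, ha]
    · rw [upd_ne _ _ h2.symm, hf]
    · simp
    · simp only [upd_same, upd_upd]
      rcases v with _ | v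
      · rw [decr_zero (val_dig hv)]; simp
      · rw [decr_succ (val_dig hv)]; simp
  have hloop : ∀ v, ∀ i, i + v = n →
      (Prog.loop k (body ;; dec k aux fl)).SRun
        (upd (S i) k (if v = 0 then [] else dig len (v - 1))) (v * (N + len * 22 + 14) + 1)
        (upd (S n) k []) := by
    intro v
    induction v with
    | zero =>
      intro i hi
      obtain rfl : i = n := by omega
      exact (srun_loop_nil (by simp)).mono (by simp)
    | succ v ih =>
      intro i hi
      have e1 := hb i (by omega)
      rw [show n - 1 - i = v by omega] at e1
      refine (SRun.loop_cons ?_ (e1.seq (hdec (i + 1) v (by omega))) (ih (i + 1) (by omega))).mono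
        (by ring_nf; omega)
      -- With width zero the digits of a live counter would be an empty stack and the loop would
      -- stop too early; a positive `n` below `2 ^ len` excludes this.
      have : len ≠ 0 := by rintro rfl; simp at hn; omega
      rw [upd_same]
      intro h
      have := congrArg List.length h
      simp at this
      omega
  exact ((hdec 0 n hn).seq (hloop n 0 (by omega))).mono (by ring_nf; omega)

end Prog

/-! ### Presenting a padded string to an algorithm for the circuit problem -/

/-- The string `x`, cut or padded by zeros to the length `m`. -/
def padTo (m : ℕ) (x : List Bool) : List Bool := (x ++ List.replicate m false).take m

@[simp] theorem length_padTo (m : ℕ) (x : List Bool) : (padTo m x).length = m := by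
  simp [padTo]

theorem padTo_eq {m : ℕ} {x : List Bool} (h : x.length ≤ m) :
    padTo m x = x ++ List.replicate (m - x.length) false := by
  rw [padTo, List.take_append, List.take_of_length_le h, List.take_replicate]
  congr 2
  omega

/-- The stacks of the padding program. -/
inductive PadStk where
  | inp | out | x | u | v | w | lg | lg' | z | y
  deriving DecidableEq

instance : Finite PadStk :=
  have : Fintype PadStk :=
    ⟨{.inp, .out, .x, .u, .v, .w, .lg, .lg', .z, .y}, fun k => by cases k <;> simp⟩
  inferInstance

/-! ### Computing the instance size in unary, and padding to it. -/

namespace Prog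

open PadStk

/-- The number `m` in unary. -/
abbrev ones (m : ℕ) : List Bool := List.replicate m true

/-- Halves the unary number on the stack `v`. -/
def halve : Prog PadStk :=
  each v (fun _ => .branch v fun o => match o with
    | none => skip v
    | some _ => pop v ;; push w true) ;; move w v

/-- Each round removes two symbols and writes one; an odd last symbol is dropped. -/
theorem srun_halve_loop (m : ℕ) (σ : PadStk → List Bool) (hv : σ v = ones m) :
    (each v (fun _ => .branch v fun o => match o with
    | none => skip v
    | some _ => pop v ;; push w true)).SRun σ (m * 13 + 10)
      (upd (upd σ v []) w (ones (m / 2) ++ σ w)) := by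
  induction m using Nat.strong_induction_on generalizing σ with
  | _ m ih =>
    match m with
    | 0 =>
      refine (srun_each_nil hv).congr rfl (by simp) ?_
      funext j; cases j <;> simp_all [upd]
    | 1 =>
      refine (SRun.each_cons (l := []) hv (SRun.branch (N := 1) (σ' := upd σ v []) ?_)
        (srun_each_nil (by simp))).congr rfl (by norm_num) ?_
      · rw [upd_same]
        exact srun_skip v _
      · funext j; cases j <;> simp [upd]
    | m + 2 =>
      refine (SRun.each_cons (l := ones (m + 1)) hv (SRun.branch (N := 5) (σ' :=
        upd (upd σ v (ones m)) w (true :: σ w)) ?_) (ih m (by omega) _ (by simp [upd]))).congr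
        rfl (by omega) ?_
      · simp only [upd_same, List.replicate_succ, List.head?_cons]
        refine ((srun_pop v _).seq (srun_push w true _)).congr rfl (by norm_num) ?_
        funext j; cases j <;> simp [upd]
      · rw [show (m + 2) / 2 = m / 2 + 1 by omega]
        funext j; cases j <;> simp [upd, List.replicate_succ']

theorem srun_halve (m : ℕ) (σ : PadStk → List Bool) (hv : σ v = ones m) (hw : σ w = []) :
    halve.SRun σ (m * 18 + 12) (upd σ v (ones (m / 2))) := by
  refine ((srun_halve_loop m σ hv).seq (srun_move (by simp) _)).congr rfl ?_ ?_
  · simp [hw]; omega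
  · funext j; cases j <;> simp [upd, hw]

/-- Puts the logarithm of the unary number on the stack `v` onto the stack `lg`. -/
def logProg : Prog PadStk := halve ;; .loop v (push lg true ;; halve)

/-- Counting the halvings costs a geometric series, hence linear time in total. The initial halving
aligns the loop test with `Nat.log`, which is zero for both 0 and 1. -/
theorem srun_logProg (n : ℕ) (σ : PadStk → List Bool) (hv : σ v = ones n) (hw : σ w = [])
    (hlg : σ lg = []) :
    logProg.SRun σ (n * 70 + 14) (upd (upd σ v []) lg (ones (Nat.log 2 n))) := by
  have hloop : ∀ n (σ : PadStk → List Bool), σ v = ones (n / 2) → σ w = [] →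
      (Prog.loop v (push lg true ;; halve)).SRun σ (n * 44 + 1)
        (upd (upd σ v []) lg (ones (Nat.log 2 n) ++ σ lg)) := by
    intro n
    induction n using Nat.strong_induction_on with
    | _ n ih =>
      intro σ hv hw
      by_cases hn : n < 2
      · have h0 : n / 2 = 0 := by omega
        rw [h0] at hv
        refine (srun_loop_nil hv).congr rfl (by omega) ?_
        rw [Nat.log_of_lt hn]
        funext j; cases j <;> simp_all [upd]
      · refine (SRun.loop_cons ?_ ((srun_push lg true σ).seq (srun_halve (n / 2) _ ?_ ?_))
          (ih (n / 2) (by omega) _ ?_ ?_)).congr rfl (by omega) ?_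
        · rw [hv]; simp; omega
        · simpa [upd] using hv
        · simpa [upd] using hw
        · simp
        · simpa [upd] using hw
        · rw [Nat.log_of_one_lt_of_le (by norm_num) (by omega : 2 ≤ n)]
          funext j; cases j <;> simp [upd, List.replicate_succ']
  refine ((srun_halve n σ hv hw).seq (hloop n _ (by simp) (by simpa [upd] using hw))).congr rfl
    (by omega) ?_
  simp [upd_ne, hlg]

/-- Multiplies the unary number on the stack `z` by the one on the stack `lg`. -/
def mulProg : Prog PadStk :=
  each lg (fun _ => push lg' true ;; copy z w y) ;; clear z ;; move w z ;; move lg' lg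

theorem srun_mulProg (m k : ℕ) (σ : PadStk → List Bool) (hz : σ z = ones m) (hlg : σ lg = ones k)
    (hlg' : σ lg' = []) (hw : σ w = []) (hy : σ y = []) :
    mulProg.SRun σ (31 * (m * k) + 22 * k + 7 * m + 10) (upd σ z (ones (m * k))) := by
  have h1 : (each lg (fun _ => push lg' true ;; copy z w y)).SRun σ (k * ((m * 22 + 7) + 6) + 1)
      (upd (upd (upd σ lg []) lg' (ones k)) w (ones (m * k))) := by
    have hk : k = (σ lg).length := by simp [hlg]
    have := srun_each' (k := lg) (body := fun _ => push lg' true ;; copy z w y)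
      (N := m * 22 + 7) σ (upd (upd (upd σ lg []) lg' (ones k)) w (ones (m * k)))
      (fun i => upd (upd σ lg' (ones i)) w (ones (m * i))) ?_ ?_ ?_
    · rwa [← hk] at this
    · rw [hlg]
      funext j; cases j <;> simp [upd, hlg, hlg', hw]
    · rw [← hk]
      funext j; cases j <;> simp [upd]
    · intro i hi
      refine ((srun_push lg' true _).seq (srun_copy (by simp) (by simp) (by simp) _ ?_)).congr
        rfl ?_ ?_
      · simpa [upd] using hy
      · simp [upd, hz]; omega
      · funext j; cases j <;> simp [upd, List.replicate_succ, hz, mul_add, add_comm (m * i)]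
  refine (h1.seq ((srun_clear z _).seq ((srun_move (by simp) _).seq
    (srun_move (by simp) _)))).congr rfl ?_ ?_
  · simp [upd, hz]
    ring_nf
    omega
  · funext j; cases j <;> simp [upd, hw, hlg, hlg']

/-- Multiplies the unary number on the stack `z` by a power of the one on the stack `lg`. -/
def mulPow : ℕ → Prog PadStk
  | 0 => skip lg
  | C + 1 => mulPow C ;; mulProg

/-- `B` bounds all intermediate products, not only the last: for `k = 0` the products collapse to
zero although the first one is `m`. -/
theorem srun_mulPow (m k B : ℕ) (σ : PadStk → List Bool) (hz : σ z = ones m)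
    (hlg : σ lg = ones k) (hlg' : σ lg' = []) (hw : σ w = []) (hy : σ y = []) (hk : k ≤ B) (C : ℕ)
    (hB : ∀ i ≤ C, m * k ^ i ≤ B) :
    (mulPow C).SRun σ (C * (60 * B + 11) + 1) (upd σ z (ones (m * k ^ C))) := by
  induction C with
  | zero =>
    refine (srun_skip lg σ).congr rfl (by simp) ?_
    simp [← hz]
  | succ C ih =>
    have hC := hB C (by omega)
    have hC' := hB (C + 1) le_rfl
    rw [pow_succ, ← mul_assoc] at hC'
    refine ((ih fun i hi => hB i (by omega)).seq (srun_mulProg (m * k ^ C) k _ (by simp)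
      (by simpa [upd] using hlg) (by simpa [upd] using hlg') (by simpa [upd] using hw)
      (by simpa [upd] using hy))).congr rfl ?_ ?_
    · rw [add_mul]; omega
    · simp [pow_succ, mul_assoc]

/-- Cuts or pads the string on the stack `inp` to the length of `z`. -/
def fit : Prog PadStk :=
  each z fun _ => .branch inp fun o => match o with
    | none => push w false
    | some b => pop inp ;; push w b

theorem srun_fit (m : ℕ) (σ : PadStk → List Bool) (hz : σ z = ones m) :
    fit.SRun σ (m * 13 + 1)
      (upd (upd (upd σ z []) inp ((σ inp).drop m)) w ((padTo m (σ inp)).reverse ++ σ w)) := by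
  induction m generalizing σ with
  | zero =>
    refine (srun_each_nil hz).congr rfl (by simp) ?_
    funext j; cases j <;> simp_all [upd, padTo]
  | succ m ih =>
    have hb : (Prog.branch inp fun o => match o with
        | none => push w false
        | some b => pop inp ;; push w b).SRun (upd σ z (ones m)) 7
        (upd (upd (upd σ z (ones m)) inp (σ inp).tail) w ((σ inp).headD false :: σ w)) := by
      refine SRun.branch ?_
      rcases h : σ inp with _ | ⟨b, l⟩
      · rw [upd_ne _ _ (by simp), h]
        refine (srun_push w false _).congr rfl (by norm_num) ?_
        funext j; cases j <;> simp [upd, h]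
      · rw [upd_ne _ _ (by simp), h]
        refine ((srun_pop inp _).seq (srun_push w b _)).congr rfl (by norm_num) ?_
        funext j; cases j <;> simp [upd, h]
    refine (SRun.each_cons hz hb (ih _ (by simp [upd]))).congr rfl (by omega) ?_
    have hp : padTo (m + 1) (σ inp) = (σ inp).headD false :: padTo m (σ inp).tail := by
      cases h : σ inp with
      | nil => simp [padTo, List.replicate_succ]
      | cons b l =>
        simp only [padTo, List.cons_append, List.take_succ_cons, List.headD_cons, List.tail_cons]
        rw [List.replicate_succ', ← List.append_assoc, List.take_append_of_le_length]
        simp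
    funext j; cases j <;> simp [upd, hp]

/-- Puts the instance that is presented by the string on the stack `inp`, in reverse order, onto
the stack `w`. -/
def padProg (C : ℕ) : Prog PadStk :=
  each inp (fun c => push x c ;; push u true ;; push v true) ;; logProg ;; copy u z y ;;
    mulPow C ;; move x inp ;; fit ;; move w x ;; push x false ;; move u x ;; move x w

/-- The initial stacks. -/
noncomputable def initStacks {K : Type} (k : K) (x : List Bool) : K → List Bool :=
  upd (fun _ => []) k x

/-- The bound uses `log + 1` in place of `log` so that it also dominates `n` for the lengths at
which the logarithm vanishes. -/
theorem srun_padProg (C : ℕ) : ∃ c, ∀ s : List Bool, ∃ σ,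
    (padProg C).SRun (initStacks inp s) (c * (s.length * (Nat.log 2 s.length + 1) ^ C + 1)) σ ∧
    σ w = (cappInput s.length (padTo (cappSize C s.length) s)).reverse ∧ σ out = [] := by
  refine ⟨C * (60 + 11) + 400, fun s => ?_⟩
  set n := s.length with hn
  set B := n * (Nat.log 2 n + 1) ^ C with hB
  have hnB : n ≤ B := Nat.le_mul_of_pos_right _ (by positivity)
  have hlB : Nat.log 2 n ≤ B := (Nat.log_le_self 2 n).trans hnB
  have hiB : ∀ i ≤ C, n * Nat.log 2 n ^ i ≤ B := fun i hi =>
    Nat.mul_le_mul_left _ ((Nat.pow_le_pow_left (Nat.le_succ _) i).trans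
      (Nat.pow_le_pow_right (Nat.succ_pos _) hi))
  have hsB : cappSize C n ≤ B := hiB C le_rfl
  have e1 : (each inp (fun c => push x c ;; push u true ;; push v true)).SRun
      (initStacks inp s) (n * 17 + 1)
      (upd (upd (upd (fun _ => []) x s.reverse) u (ones n)) v (ones n)) := by
    have := srun_each' (k := inp) (body := fun c => push x c ;; push u true ;; push v true)
      (N := 11) (initStacks inp s)
      (upd (upd (upd (fun _ => []) x s.reverse) u (ones n)) v (ones n))
      (fun i => (upd (upd (upd (fun _ => []) x (s.take i).reverse) u (ones i)) v (ones i)))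
      ?_ ?_ ?_
    · simpa [initStacks] using this
    · funext j; cases j <;> simp [upd, initStacks]
    · funext j; cases j <;> simp [upd, initStacks, hn]
    · intro i hi
      refine ((srun_push x _ _).seq ((srun_push u true _).seq (srun_push v true _))).congr rfl
        (by norm_num) ?_
      have hi' : i < s.length := by simpa [initStacks] using hi
      have ht : (s.take (i + 1)).reverse = s[i] :: (s.take i).reverse := by
        rw [List.take_succ_eq_append_getElem hi']; simp
      funext j; cases j <;> simp [upd, initStacks, List.replicate_succ, ht]
  have e2 := srun_logProg n (upd (upd (upd (fun _ => []) x s.reverse) u (ones n)) v (ones n))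
    (by simp) (by simp [upd]) (by simp [upd])
  have e3 := srun_copy (a := u) (b := z) (aux := y) (by simp) (by simp) (by simp)
    (upd (upd (upd (upd (upd (fun _ => []) x s.reverse) u (ones n)) v (ones n)) v []) lg (ones (Nat.log 2 n)))
    (by simp [upd])
  refine ⟨_, (e1.seq (e2.seq (e3.seq ((srun_mulPow n (Nat.log 2 n) B _ ?_ ?_ ?_ ?_ ?_ hlB C hiB).seq
    ((srun_move (by simp) _).seq ((srun_fit (cappSize C n) _ ?_).seq ((srun_move (by simp) _).seq
    ((srun_push x false _).seq ((srun_move (by simp) _).seq (srun_move (by simp) _)))))))))).mono ?_, ?_, ?_⟩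
  · simp [upd]
  · simp [upd]
  · simp [upd]
  · simp [upd]
  · simp [upd]
  · simp [upd, cappSize]
  · simp [upd, ← hn]
    have h1 : C * (60 * B + 11) ≤ C * 71 * (B + 1) := by nlinarith
    have h2 : (C * 71 + 400) * (B + 1) = C * 71 * (B + 1) + 400 * (B + 1) := by ring
    omega
  · simp [upd, cappInput]
  · simp [upd]

end Prog

/-! ### Uniform probabilities -/

theorem unifProb_mono {m : ℕ} {P Q : (Fin m → Bool) → Prop} (h : ∀ y, P y → Q y) :
    unifProb m P ≤ unifProb m Q := by
  unfold unifProb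
  gcongr
  exact Nat.card_le_card_of_injective (fun y : {y // P y} => (⟨y.1, h _ y.2⟩ : {y // Q y}))
    fun a b hab => Subtype.ext (by simpa using hab)

theorem unifProb_congr {m : ℕ} {P Q : (Fin m → Bool) → Prop} (h : ∀ y, P y ↔ Q y) :
    unifProb m P = unifProb m Q := by
  rw [show P = Q from funext fun y => propext (h y)]

theorem unifProb_true (m : ℕ) : unifProb m (fun _ => True) = 1 := by
  have : Nat.card {y : Fin m → Bool // True} = 2 ^ m := by
    rw [Nat.card_congr (Equiv.subtypeUnivEquiv fun _ => trivial)]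
    simp
  rw [unifProb, this]
  norm_num

theorem unifProb_false (m : ℕ) : unifProb m (fun _ => False) = 0 := by
  simp [unifProb]

theorem unifProb_add_le {m : ℕ} {P Q : (Fin m → Bool) → Prop} (h : ∀ y, P y → ¬ Q y) :
    unifProb m P + unifProb m Q ≤ 1 := by
  have hc : Nat.card {y // P y} + Nat.card {y // Q y} ≤ 2 ^ m := by
    have h2 : Nat.card (Fin m → Bool) = 2 ^ m := by simp
    rw [← Nat.card_sum, ← h2]
    refine Nat.card_le_card_of_injective (Sum.elim Subtype.val Subtype.val) ?_
    rintro (a | a) (b | b) hab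
    · exact congrArg _ (Subtype.ext hab)
    · exact (h _ a.2 (by rw [show a.1 = b.1 from hab]; exact b.2)).elim
    · exact (h _ b.2 (by rw [← show a.1 = b.1 from hab]; exact a.2)).elim
    · exact congrArg _ (Subtype.ext hab)
  rw [unifProb, unifProb, ← add_div, div_le_one (by positivity)]
  exact_mod_cast hc

/-- A marginal of the uniform distribution is uniform: the unused coordinates contribute the factor
`2 ^ (m' - m)`. Every change of the number or order of the coins goes through this lemma. -/
theorem unifProb_comp {m m' : ℕ} {ι : Fin m → Fin m'} (hι : Function.Injective ι)
    (P : (Fin m → Bool) → Prop) :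
    unifProb m' (fun y => P fun i => y (ι i)) = unifProb m P := by
  classical
  let e1 : (Fin m' → Bool) ≃ (Set.range ι → Bool) × ({j // j ∉ Set.range ι} → Bool) :=
    Equiv.piEquivPiSubtypeProd (fun j => j ∈ Set.range ι) fun _ => Bool
  let e2 : (Set.range ι → Bool) ≃ (Fin m → Bool) :=
    (Equiv.ofInjective ι hι).symm.arrowCongr (Equiv.refl _)
  let e : (Fin m' → Bool) ≃ (Fin m → Bool) × ({j // j ∉ Set.range ι} → Bool) :=
    e1.trans (e2.prodCongr (Equiv.refl _))
  have he : ∀ y, (e y).1 = fun i => y (ι i) := by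
    intro y; funext i
    simp [e, e1, e2, Equiv.arrowCongr, Equiv.piEquivPiSubtypeProd]
  have hcard : Nat.card {j // j ∉ Set.range ι} = m' - m := by
    have : Nat.card (Set.range ι) = m := by
      rw [Nat.card_congr (Equiv.ofInjective ι hι).symm]; simp
    have h2 := Nat.card_congr (Equiv.sumCompl fun j => j ∈ Set.range ι)
    rw [Nat.card_sum, Nat.card_eq_fintype_card (α := Fin m'), Fintype.card_fin] at h2
    have : Nat.card {j // j ∈ Set.range ι} = m := this
    omega
  have hm : m ≤ m' := by simpa using Fintype.card_le_of_injective ι hι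
  have h1 : Nat.card {y : Fin m' → Bool // P fun i => y (ι i)} =
      Nat.card {y : Fin m → Bool // P y} * 2 ^ (m' - m) := by
    have e3 : {y : Fin m' → Bool // P fun i => y (ι i)} ≃
        {p : (Fin m → Bool) × ({j // j ∉ Set.range ι} → Bool) // P p.1} :=
      e.subtypeEquiv fun y => by rw [he]
    have e4 : {p : (Fin m → Bool) × ({j // j ∉ Set.range ι} → Bool) // P p.1} ≃
        {y : Fin m → Bool // P y} × ({j // j ∉ Set.range ι} → Bool) :=
      { toFun := fun p => (⟨p.1.1, p.2⟩, p.1.2)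
        invFun := fun p => ⟨(p.1.1, p.2), p.1.2⟩
        left_inv := fun _ => rfl
        right_inv := fun _ => rfl }
    rw [Nat.card_congr (e3.trans e4), Nat.card_prod, Nat.card_fun, hcard]
    simp
  rw [unifProb, unifProb, h1]
  have : (2 : ℝ) ^ m' = 2 ^ m * 2 ^ (m' - m) := by rw [← pow_add, Nat.add_sub_cancel' hm]
  rw [this]
  push_cast
  field_simp

/-! ### Runs of machines -/

namespace TM

variable {M : TM}

/-- The configuration reached with the coins `l`. -/
noncomputable def runList (M : TM) (x l : List Bool) : M.Cfg := l.foldl M.step (M.init x)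

theorem run_eq_runList (x : List Bool) {m : ℕ} (r : Fin m → Bool) :
    M.run x r = M.runList x (List.ofFn r) := rfl

theorem runList_append (x l l' : List Bool) :
    M.runList x (l ++ l') = l'.foldl M.step (M.runList x l) := by
  simp [runList]

theorem runList_of_halted {x l : List Bool} (h : (M.runList x l).state = M.halt) (l' : List Bool) :
    M.runList x (l ++ l') = M.runList x l := by
  rw [runList_append, Frag.foldl_step_halt _ h]

theorem HaltsWithin.runList {x : List Bool} {m : ℕ} (h : M.HaltsWithin x m) {l : List Bool}
    (hl : m ≤ l.length) : (M.runList x l).state = M.halt ∧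
      M.runList x l = M.runList x (l.take m) := by
  have h1 : (M.runList x (l.take m)).state = M.halt := by
    have := h fun i => l[i.1]
    rw [run_eq_runList] at this
    convert this using 3
    apply List.ext_getElem <;> simp [hl]
  have h2 := runList_of_halted h1 (l.drop m)
  rw [List.take_append_drop] at h2
  rw [h2]
  exact ⟨h1, rfl⟩

theorem HaltsWithin.mono {x : List Bool} {m m' : ℕ} (h : M.HaltsWithin x m) (hm : m ≤ m') :
    M.HaltsWithin x m' := fun r => by
  rw [run_eq_runList]
  exact (h.runList (by simpa using hm)).1

theorem outputProb_mono (x y : List Bool) {m m' : ℕ} (hm : m ≤ m') :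
    M.outputProb x m y ≤ M.outputProb x m' y := by
  unfold outputProb
  rw [← unifProb_comp (Fin.castLE_injective hm) fun r => (M.run x r).HaltedWith y]
  refine unifProb_mono fun r h => ?_
  rw [run_eq_runList] at h ⊢
  have : List.ofFn r = List.ofFn (fun i : Fin m => r (Fin.castLE hm i)) ++ (List.ofFn r).drop m := by
    conv_lhs => rw [← List.take_append_drop m (List.ofFn r)]
    congr 1
    apply List.ext_getElem
    · simp [hm]
    · intro i h1 h2
      simp
  rw [this, runList_of_halted h.1]
  exact h

/-- The condition includes the position `y.length`, where the cell is blank; this forces equal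
lengths. -/
theorem Cfg.HaltedWith.unique {c : M.Cfg} {y y' : List Bool} (h : c.HaltedWith y)
    (h' : c.HaltedWith y') : y = y' := by
  wlog hl : y.length ≤ y'.length generalizing y y'
  · exact (this h' h (by omega)).symm
  have e : ∀ j ≤ y.length, y[j]? = y'[j]? := fun j hj => by
    rw [← h.2 j hj, ← h'.2 j (hj.trans hl)]
  have hl' : y'.length ≤ y.length := by
    have := e y.length le_rfl
    rw [List.getElem?_eq_none le_rfl] at this
    exact List.getElem?_eq_none_iff.1 this.symm
  refine List.ext_getElem? fun j => ?_
  by_cases hj : j ≤ y.length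
  · exact e j hj
  · rw [List.getElem?_eq_none (by omega), List.getElem?_eq_none (by omega)]

/-- Two configurations that differ only in cells of the input tape that are at least `m` cells to
the right of the head. -/
def Agree (m : ℕ) (c c' : M.Cfg) : Prop :=
  c.state = c'.state ∧ (∀ k ≠ M.inp, c.tape k = c'.tape k) ∧
    ∀ i : ℤ, i < m → (c.tape M.inp).nth i = (c'.tape M.inp).nth i

/-- A head moves by at most one cell per step, so the distance to the first differing cell drops by
at most one. -/
theorem Agree.step {m : ℕ} {c c' : M.Cfg} (h : Agree (m + 1) c c') (b : Bool) :
    Agree m (M.step c b) (M.step c' b) := by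
  obtain ⟨h1, h2, h3⟩ := h
  have hh : (fun k => (c.tape k).head) = fun k => (c'.tape k).head := by
    funext k
    by_cases hk : k = M.inp
    · subst hk
      simpa using h3 0 (by omega)
    · rw [h2 k hk]
  unfold TM.step
  rw [hh, h1]
  split_ifs with hc
  · exact ⟨h1, h2, fun i hi => h3 i (by omega)⟩
  · refine ⟨rfl, fun k hk => by simp [h2 k hk], fun i hi => ?_⟩
    dsimp only
    generalize (M.δ c'.state (fun k => (c'.tape k).head) b).2.2 M.inp = d
    rcases d with _ | d | d
    · simp only [moveHead, Tape.write_nth]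
      rw [h3 i (by omega)]
    · simp only [moveHead, Tape.move_left_nth, Tape.write_nth]
      rw [h3 (i - 1) (by omega)]
    · simp only [moveHead, Tape.move_right_nth, Tape.write_nth]
      rw [h3 (i + 1) (by push_cast; omega)]

theorem Agree.foldl {c c' : M.Cfg} (l : List Bool) (h : Agree l.length c c') :
    Agree 0 (l.foldl M.step c) (l.foldl M.step c') := by
  induction l generalizing c c' with
  | nil => exact h
  | cons b l ih => exact ih (h.step b)

theorem nth_stk (l : List Bool) (j : ℕ) : (stk l).nth j = l[j]? := by
  simp only [stk, Tape.mk₁, Tape.mk₂, Tape.mk'_nth_nat, ListBlank.nth_mk, List.getI_eq_getElem?_getD]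
  simp only [List.getElem?_map]
  cases l[j]? <;> rfl

theorem nth_stk_neg (l : List Bool) (j : ℕ) : (stk l).nth (Int.negSucc j) = none := by
  simp only [stk, Tape.mk₁, Tape.mk₂, Tape.mk', Tape.nth, ListBlank.nth_mk]
  simp; rfl

theorem init_tape (M : TM) (x : List Bool) :
    (M.init x).tape = fun k => stk (Prog.initStacks M.inp x k) := by
  funext k
  by_cases h : k = M.inp <;> simp [TM.init, Prog.initStacks, upd, h, stk]

theorem agree_init {m : ℕ} {x x' : List Bool} (h : x.take m = x'.take m) :
    Agree m (M.init x) (M.init x') := by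
  refine ⟨rfl, fun k hk => by simp [init_tape, Prog.initStacks, upd, hk], fun i hi => ?_⟩
  simp only [init_tape, Prog.initStacks, upd_same]
  rcases i with j | j
  · have hj : j < m := by simpa using hi
    simp only [Int.ofNat_eq_natCast, nth_stk]
    rw [← List.getElem?_take_of_lt hj, h, List.getElem?_take_of_lt hj]
  · rw [nth_stk_neg, nth_stk_neg]

/-- A computation of `m` steps depends only on the first `m` symbols of the input. -/
theorem haltedWith_iff_of_take {x x' : List Bool} {m : ℕ} (h : x.take m = x'.take m)
    (r : Fin m → Bool) (y : List Bool) :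
    (M.run x r).HaltedWith y ↔ (M.run x' r).HaltedWith y := by
  obtain ⟨h1, h2, -⟩ := Agree.foldl (List.ofFn r) (by simpa using agree_init (M := M) h)
  change (List.foldl M.step (M.init x) (List.ofFn r)).HaltedWith y ↔
    (List.foldl M.step (M.init x') (List.ofFn r)).HaltedWith y
  rw [Cfg.HaltedWith, Cfg.HaltedWith, h1, h2 _ M.inp_ne_out.symm]

theorem outputProb_eq_of_take {x x' : List Bool} {m : ℕ} (h : x.take m = x'.take m)
    (y : List Bool) : M.outputProb x m y = M.outputProb x' m y :=
  unifProb_congr fun r => haltedWith_iff_of_take h r y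

/-- Different outputs are disjoint events, and two of probability 2/3 would add up to more than 1.
-/
theorem eq_of_outputProb {x : List Bool} {m : ℕ} {y y' : List Bool}
    (h : 2 / 3 ≤ M.outputProb x m y) (h' : 2 / 3 ≤ M.outputProb x m y') : y = y' := by
  by_contra hne
  have := unifProb_add_le (m := m) (P := fun r => (M.run x r).HaltedWith y)
    (Q := fun r => (M.run x r).HaltedWith y') fun r h1 h2 => hne (h1.unique h2)
  unfold outputProb at h h'
  linarith

end TM

/-! ### Binary fractions -/

theorem binValue_nil : binValue [] = 0 := by simp [binValue]

theorem binValue_cons (b : Bool) (y : List Bool) :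
    binValue (b :: y) = (if b then 1 else 0) + binValue y / 2 := by
  unfold binValue
  rw [Finset.sum_div]
  simp only [List.length_cons]
  rw [Fin.sum_univ_succ]
  refine congrArg₂ (· + ·) (by simp) (Finset.sum_congr rfl fun i _ => ?_)
  simp only [Fin.getElem_fin, Fin.val_succ, List.getElem_cons_succ, pow_succ]
  split_ifs <;> ring

theorem binValue_nonneg (y : List Bool) : 0 ≤ binValue y := by
  induction y with
  | nil => simp [binValue_nil]
  | cons b y ih => rw [binValue_cons]; split_ifs <;> linarith

theorem binValue_le_two (y : List Bool) : binValue y ≤ 2 := by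
  induction y with
  | nil => simp [binValue_nil]
  | cons b y ih => rw [binValue_cons]; split_ifs <;> linarith

/-- One of the first two digits is `1`. -/
def Large (y : List Bool) : Prop := y[0]? = some true ∨ y[1]? = some true

theorem Large.half_le {y : List Bool} (h : Large y) : 1 / 2 ≤ binValue y := by
  rcases y with _ | ⟨b, _ | ⟨c, y⟩⟩
  · simp [Large] at h
  · have : b = true := by simpa [Large] using h
    simp [binValue_cons, binValue_nil, this]; norm_num
  · have := binValue_nonneg y
    have h : b = true ∨ c = true := by simpa [Large] using h
    simp only [binValue_cons]
    rcases h with rfl | rfl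
    · simp; split_ifs <;> linarith
    · simp; split_ifs <;> linarith

/-- The first digit has weight 1, so the digits from the third on contribute at most 1/4 + 1/8 + ...
≤ 1/2. Both bounds at 1/2 are non-strict; the gap needed comes from the error 1/10. -/
theorem le_half_of_not_large {y : List Bool} (h : ¬ Large y) : binValue y ≤ 1 / 2 := by
  rcases y with _ | ⟨b, _ | ⟨c, y⟩⟩
  · simp [binValue_nil]
  · have : b = false := by simpa [Large] using h
    simp [binValue_cons, binValue_nil, this]
  · have := binValue_le_two y
    have h : b = false ∧ c = false := by simpa [Large] using h
    simp only [binValue_cons, h.1, h.2]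
    simp; linarith

/-! ### Encodings of circuits -/

/-- The encoding of the number with the binary digits `l`. -/
def encNum (l : List Bool) : List Bool := (l.flatMap fun c => [true, c]) ++ [false]

/-- Valid for every digit string, leading zeros included, so numbers may be written straight from a
counter of fixed width. -/
theorem parseNat_encNum (l w : List Bool) : parseNat (encNum l ++ w) = some (Prog.val l, w) := by
  induction l with
  | nil => simp [encNum, parseNat]
  | cons b l ih =>
    have : encNum (b :: l) ++ w = true :: b :: (encNum l ++ w) := by simp [encNum]
    rw [this, parseNat, ih]
    rfl

/-- The encoding of a gate. -/
def encGate : Gate → List Bool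
  | .const b => [true, false, false, b]
  | .input i => [true, false, true, false] ++ encNum (Nat.bits i)
  | .not i => [true, false, true, true] ++ encNum (Nat.bits i)
  | .and i j => [true, true, false, false] ++ encNum (Nat.bits i) ++ encNum (Nat.bits j)
  | .or i j => [true, true, false, true] ++ encNum (Nat.bits i) ++ encNum (Nat.bits j)

/-- The string `s` is read as the gates `gs`, whatever comes after it. -/
def Parses (s : List Bool) (gs : List Gate) : Prop :=
  gs.length ≤ s.length ∧ ∀ k w, parseGates (gs.length + k) (s ++ w) = gs ++ parseGates k w

theorem parses_nil : Parses [] [] := ⟨le_rfl, by simp⟩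

theorem parses_single {s : List Bool} {g : Gate} (hs : s ≠ [])
    (h : ∀ w, parseGate (s ++ w) = some (g, w)) : Parses s [g] := by
  refine ⟨List.length_pos_iff.2 hs, fun k w => ?_⟩
  rw [List.length_singleton, add_comm 1 k, parseGates, h]
  simp

theorem Parses.append {s s' gs gs'} (h : Parses s gs) (h' : Parses s' gs') :
    Parses (s ++ s') (gs ++ gs') := by
  refine ⟨by simpa using Nat.add_le_add h.1 h'.1, fun k w => ?_⟩
  rw [List.length_append, add_assoc, List.append_assoc, h.2, h'.2, List.append_assoc]

theorem Parses.flatMap {α : Type} {l : List α} {f : α → List Bool} {g : α → List Gate}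
    (h : ∀ i ∈ l, Parses (f i) (g i)) : Parses (l.flatMap f) (l.flatMap g) := by
  induction l with
  | nil => exact parses_nil
  | cons i l ih =>
    rw [List.flatMap_cons, List.flatMap_cons]
    exact (h i (by simp)).append (ih fun j hj => h j (by simp [hj]))

theorem parses_input (l : List Bool) :
    Parses ([true, false, true, false] ++ encNum l) [.input (Prog.val l)] :=
  parses_single (by simp) fun w => by
    rw [List.append_assoc]
    simp only [List.cons_append, List.nil_append, parseGate, parseNat_encNum, Option.map_some]

theorem parses_or (l l' : List Bool) :
    Parses ([true, true, false, true] ++ encNum l ++ encNum l')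
      [.or (Prog.val l) (Prog.val l')] :=
  parses_single (by simp) fun w => by
    rw [List.append_assoc, List.append_assoc]
    simp only [List.cons_append, List.nil_append, parseGate, parsePair, parseNat_encNum,
      Option.map_some, Option.bind_some]

theorem parses_encGate (g : Gate) : Parses (encGate g) [g] := by
  cases g with
  | const b => exact parses_single (by simp [encGate]) fun w => by simp [encGate, parseGate]
  | input i =>
    have := parses_input (Nat.bits i)
    rwa [Prog.val_bits] at this
  | not i =>
    exact parses_single (by simp [encGate]) fun w => by
      simp only [encGate, List.cons_append, List.nil_append, parseGate, parseNat_encNum,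
        Option.map_some, Prog.val_bits]
  | and i j =>
    exact parses_single (by simp [encGate]) fun w => by
      simp only [encGate, List.append_assoc, List.cons_append, List.nil_append, parseGate,
        parsePair, parseNat_encNum, Option.map_some, Option.bind_some, Prog.val_bits]
  | or i j =>
    have := parses_or (Nat.bits i) (Nat.bits j)
    rwa [Prog.val_bits, Prog.val_bits] at this

theorem parses_encGates (gs : List Gate) : Parses (gs.flatMap encGate) gs := by
  have := Parses.flatMap (l := gs) (f := encGate) (g := fun g => [g]) fun g _ => parses_encGate g
  simpa using this

/-- Every gate code begins with a 1, so the padding stops the parser. The length condition in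
`Parses` ensures that the bound on the number of gates read does not stop it earlier. -/
theorem Parses.decodeCircuit {s : List Bool} {gs : List Gate} (h : Parses s gs) {m : ℕ}
    (hm : s.length ≤ m) : decodeCircuit (padTo m s) = gs := by
  obtain ⟨k, hk⟩ := Nat.exists_eq_add_of_le (h.1.trans hm)
  rw [PseudoDet.decodeCircuit, length_padTo, hk, ← hk, padTo_eq hm, hk, h.2]
  have : ∀ (k n : ℕ), parseGates k (List.replicate n false) = [] := by
    intro k n
    cases k with
    | zero => rfl
    | succ k =>
      have : parseGate (List.replicate n false) = none := by
        cases n <;> simp [parseGate, List.replicate_succ]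
      simp [parseGates, this]
  rw [this, List.append_nil]

/-- The values of the gates, the most recent one first, on top of the values `v`. -/
def runGates {m : ℕ} (y : Fin m → Bool) (gs : List Gate) (v : List Bool) : List Bool :=
  gs.foldl (fun v g => g.eval y v :: v) v

theorem runGates_append {m : ℕ} (y : Fin m → Bool) (gs gs' : List Gate) (v : List Bool) :
    runGates y (gs ++ gs') v = runGates y gs' (runGates y gs v) := by
  simp [runGates]

theorem evalCircuit_eq {m : ℕ} (y : Fin m → Bool) (gs : List Gate) :
    evalCircuit gs y = (runGates y gs []).headD false := rfl

/-- The gates of a constant circuit. -/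
def constGates (q : ℕ) (b : Bool) : List Gate := List.replicate q (.const false) ++ [.const b]

theorem evalCircuit_constGates (q : ℕ) (b : Bool) {m : ℕ} (y : Fin m → Bool) :
    evalCircuit (constGates q b) y = b := by
  rw [evalCircuit_eq, constGates, runGates_append]
  simp [runGates, Gate.eval]

theorem length_constGates (q : ℕ) (b : Bool) :
    ((constGates q b).flatMap encGate).length = 4 * q + 4 := by
  simp [constGates, encGate, List.length_flatMap]
  omega

/-! ### The running time of an algorithm for the circuit problem -/

/-- `A` is a pseudodeterministic algorithm for the circuit problem with the running time
`a * T n + a`, and correct for `n ≥ n₀`. -/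
def Solves (C : ℕ) (T : ℕ → ℕ) (A : TM) (a n₀ : ℕ) : Prop :=
  ∀ n : ℕ, ∀ w : List Bool, w.length = cappSize C n →
    A.HaltsWithin (cappInput n w) (a * T n + a) ∧
    ∃ y : List Bool, 2 / 3 ≤ A.outputProb (cappInput n w) (a * T n + a) y ∧
      (n₀ ≤ n → IsCAPPSolution w y)

theorem le_cappSize {C n : ℕ} (hn : 2 ≤ n) : n ≤ cappSize C n :=
  Nat.le_mul_of_pos_right _ (pow_pos (Nat.log_pos (by norm_num) hn) C)

/-- An algorithm for the circuit problem must read almost all of its input. -/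
theorem Solves.cappSize_le {C : ℕ} {T : ℕ → ℕ} {A : TM} {a n₀ : ℕ} (h : Solves C T A a n₀) {n : ℕ}
    (hn : n₀ ≤ n) (hn4 : 4 ≤ n) : n + cappSize C n ≤ a * T n + a + 3 := by
  by_contra! hlt
  have hs := le_cappSize (C := C) (n := n) (by omega)
  -- A constant gate takes four bits. With as many dummy gates as fit, at most three padding bits
  -- follow the deciding bit, which explains the `+ 3` in the bound.
  obtain ⟨q, hq⟩ : ∃ q, 4 * q + 4 ≤ cappSize C n ∧ cappSize C n ≤ 4 * q + 7 :=
    ⟨cappSize C n / 4 - 1, by omega, by omega⟩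
  have hw : ∀ b, (padTo (cappSize C n) ((constGates q b).flatMap encGate)).length =
    cappSize C n := fun b => by simp
  have hd : ∀ b, decodeCircuit (padTo (cappSize C n) ((constGates q b).flatMap encGate)) =
    constGates q b := fun b => (parses_encGates _).decodeCircuit (by
      rw [length_constGates]; exact hq.1)
  obtain ⟨-, y0, hy0, hs0⟩ := h n _ (hw false)
  obtain ⟨-, y1, hy1, hs1⟩ := h n _ (hw true)
  obtain ⟨P, hP, he⟩ : ∃ P : List Bool, P.length = n + 4 * q + 4 ∧
      ∀ b, cappInput n (padTo (cappSize C n) ((constGates q b).flatMap encGate)) =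
        P ++ (b :: List.replicate (cappSize C n - (4 * q + 4)) false) := by
    refine ⟨List.replicate n true ++ false ::
      ((List.replicate q (Gate.const false)).flatMap encGate ++ [true, false, false]), ?_, ?_⟩
    · simp [List.length_flatMap, encGate]; omega
    · intro b
      rw [padTo_eq (by rw [length_constGates]; exact hq.1), length_constGates]
      simp [cappInput, constGates, encGate]
  have htake : (cappInput n (padTo (cappSize C n) ((constGates q false).flatMap encGate))).take
      (a * T n + a) =
      (cappInput n (padTo (cappSize C n) ((constGates q true).flatMap encGate))).take
      (a * T n + a) := by
    rw [he, he, List.take_append_of_le_length (by omega), List.take_append_of_le_length (by omega)]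
  -- Within the time bound both instances look alike, so their canonical outputs agree; one number
  -- would then be within 1/10 of both 0 and 1.
  rw [TM.outputProb_eq_of_take htake] at hy0
  obtain rfl := TM.eq_of_outputProb hy0 hy1
  have h0 := (hs0 hn).2
  have h1 := (hs1 hn).2
  rw [hd, unifProb_congr (Q := fun _ => False) fun z => by simp [evalCircuit_constGates],
    unifProb_false] at h0
  rw [hd, unifProb_congr (Q := fun _ => True) fun z => by simp [evalCircuit_constGates],
    unifProb_true] at h1
  rw [abs_le] at h0 h1
  linarith [h0.1, h0.2, h1.1, h1.2]

/-! ### The language of the circuits with large acceptance probability -/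

/-- The canonical output of `A` on the instance given by the (padded) string `x`. -/
noncomputable def canonical {C : ℕ} {T : ℕ → ℕ} {A : TM} {a n₀ : ℕ} (h : Solves C T A a n₀)
    (x : List Bool) : List Bool :=
  (h x.length (padTo (cappSize C x.length) x) (by simp)).2.choose

/-- The strings for which the canonical estimate of the acceptance probability is large. -/
def circuitLang {C : ℕ} {T : ℕ → ℕ} {A : TM} {a n₀ : ℕ} (h : Solves C T A a n₀) :
    Language Bool := {x | Large (canonical h x)}

/-! ### Circuits whose acceptance probability is bounded away from 1/2. -/

section circuitLang

variable {C : ℕ} {T : ℕ → ℕ} {A : TM} {a n₀ : ℕ} (h : Solves C T A a n₀)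

theorem outputProb_canonical (x : List Bool) :
    2 / 3 ≤ A.outputProb (cappInput x.length (padTo (cappSize C x.length) x))
      (a * T x.length + a) (canonical h x) :=
  (h x.length (padTo (cappSize C x.length) x) (by simp)).2.choose_spec.1

theorem abs_canonical_le {x : List Bool} {gs : List Gate} (hp : Parses x gs)
    (hn : n₀ ≤ x.length) (h2 : 2 ≤ x.length) :
    |unifProb (cappSize C x.length) (fun z => evalCircuit gs z = true) -
      binValue (canonical h x)| ≤ 1 / 10 := by
  have hs : IsCAPPSolution _ (canonical h x) :=
    (h x.length (padTo (cappSize C x.length) x) (by simp)).2.choose_spec.2 hn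
  have := hs.2
  rwa [hp.decodeCircuit (le_cappSize h2), length_padTo] at this

/-- The estimate is at least 2/3 - 1/10 > 1/2, so it cannot fail the digit test. -/
theorem mem_circuitLang {x : List Bool} {gs : List Gate} (hp : Parses x gs)
    (hn : n₀ ≤ x.length) (h2 : 2 ≤ x.length)
    (hx : 2 / 3 ≤ unifProb (cappSize C x.length) fun z => evalCircuit gs z = true) :
    x ∈ circuitLang h := by
  have hs := abs_canonical_le h hp hn h2
  by_contra hL
  have := le_half_of_not_large hL
  rw [abs_le] at hs
  linarith [hs.2]

theorem notMem_circuitLang {x : List Bool} {gs : List Gate} (hp : Parses x gs)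
    (hn : n₀ ≤ x.length) (h2 : 2 ≤ x.length)
    (hx : unifProb (cappSize C x.length) (fun z => evalCircuit gs z = true) ≤ 1 / 3) :
    x ∉ circuitLang h := by
  have hs := abs_canonical_le h hp hn h2
  intro hL
  have := Large.half_le hL
  rw [abs_le] at hs
  linarith [hs.1]

end circuitLang

/-! ### Calling a machine as a subroutine -/

/-- The machine that executes `pre`, then `M`, and then `post`. -/
noncomputable def callTM {K : Type} [Finite K] (M : TM) (pre post : Prog (K ⊕ M.K)) (i o : K)
    (hio : i ≠ o) : TM :=
  have := M.finK
  (pre.compile.seq ((M.frag.lift K).seq post.compile)).toTM (.inl i) (.inl o) (by simpa using hio)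

theorem callTM_det {K : Type} [Finite K] {M : TM} {pre post : Prog (K ⊕ M.K)} {i o : K}
    {hio : i ≠ o} (hM : M.Deterministic) : (callTM M pre post i o hio).Deterministic :=
  pre.det_compile.seq ((Frag.Det.lift (F := M.frag) hM).seq post.det_compile)

/-- The preparation takes a number `n₁` of steps that is independent of the coins, so the coins of
`M` form a fixed window. `M` may stop anywhere in it, but `post` ignores coins and is unaffected by
where it begins. The 2 counts the two handover steps. -/
theorem runList_callTM {K : Type} [Finite K] {M : TM} {pre post : Prog (K ⊕ M.K)} {i o : K}
    {hio : i ≠ o} {x z : List Bool} {N₁ N₂ m : ℕ} {τ₁ : Tapes K}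
    {Q : Tapes M.K → Tapes (K ⊕ M.K) → Prop}
    (hpre : pre.Run (fun k => stk (Prog.initStacks (.inl i) x k)) N₁
      (Sum.elim τ₁ (M.init z).tape))
    (hM : M.HaltsWithin z m)
    (hpost : ∀ l, l.length = m → ∃ τ', post.Run (Sum.elim τ₁ (M.runList z l).tape) N₂ τ' ∧
      Q (M.runList z l).tape τ') :
    ∃ n₁ ≤ N₁, ∀ l, N₁ + m + N₂ + 2 ≤ l.length →
      ((callTM M pre post i o hio).runList x l).state = (callTM M pre post i o hio).halt ∧
      Q (M.runList z ((l.drop (n₁ + 1)).take m)).tape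
        ((callTM M pre post i o hio).runList x l).tape := by
  have := M.finK
  obtain ⟨n₁, hn₁, hpre⟩ := hpre
  refine ⟨n₁, hn₁, fun l hl => ?_⟩
  have h1 := hpre.halts (l.take n₁) (by simp; omega)
  rcases hd : l.drop n₁ with _ | ⟨b, l₂⟩
  · have := congrArg List.length hd
    simp at this; omega
  have hl₂ := congrArg List.length hd
  have hd' : l.drop (n₁ + 1) = l₂ := by rw [← List.drop_drop, hd]; rfl
  simp only [List.length_drop, List.length_cons] at hl₂
  have hlen : (l₂.take m).length = m := by simp; omega
  have hh := hM.runList (l := l₂.take m) (by omega)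
  obtain ⟨τ', ⟨n₃, hn₃, hpost⟩, hQ⟩ := hpost _ hlen
  obtain ⟨r₁, r₂, hr, hp⟩ := TM.exists_path (l₂.take m) (M.init z) hh.1
  have h2 := hp.lift (K' := K) τ₁
  have hr₁ : r₁.length ≤ m := by
    have := congrArg List.length hr
    simp at this; omega
  have hl₂' : l₂ = r₁ ++ (r₂ ++ l₂.drop m) := by
    rw [← List.append_assoc, ← hr, List.take_append_drop]
  rcases hd3 : r₂ ++ l₂.drop m with _ | ⟨b', l₄⟩
  · have := congrArg List.length hl₂'
    rw [hd3] at this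
    simp at this; omega
  have hl₄ : l₂.length = r₁.length + (l₄.length + 1) := by
    conv_lhs => rw [hl₂', hd3]
    simp
  have h3 := hpost.halts (l₄.take n₃) (by simp; omega)
  have h4 := h1.seq b (Frag.Halts.seq (F := M.frag.lift K) h2 b' h3)
  have hl' : l = (l.take n₁ ++ b :: (r₁ ++ b' :: l₄.take n₃)) ++ l₄.drop n₃ := by
    conv_lhs => rw [← List.take_append_drop n₁ l, hd, hl₂', hd3, ← List.take_append_drop n₃ l₄]
    simp
  have h5 := h4.foldl_toTM (i := Sum.inl i) (o := Sum.inl o) (h := by simpa using hio)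
  have h6 : (callTM M pre post i o hio).runList x (l.take n₁ ++ b :: (r₁ ++ b' :: l₄.take n₃)) =
      ⟨(callTM M pre post i o hio).halt, τ'⟩ := by
    refine Eq.trans ?_ h5
    unfold TM.runList
    congr 1
    have := (callTM M pre post i o hio).init_tape x
    refine (congrArg (TM.Cfg.mk (M := callTM M pre post i o hio)
      (callTM M pre post i o hio).start) this)
  have h7 := TM.runList_of_halted (M := callTM M pre post i o hio) (by rw [h6])
    (l' := l₄.drop n₃)
  rw [← hl', h6] at h7
  rw [h7, hd']
  exact ⟨rfl, hQ⟩

theorem haltedWith_of_stk {M : TM} {c : M.Cfg} (h : c.state = M.halt) {y : List Bool}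
    (hy : c.tape M.out = stk y) : c.HaltedWith y :=
  ⟨h, fun j _ => by rw [hy, TM.nth_stk]⟩

theorem sum_stk {K K' : Type} (σ : K → List Bool) (σ' : K' → List Bool) :
    (fun k => stk (Sum.elim σ σ' k)) = Sum.elim (fun k => stk (σ k)) (fun k => stk (σ' k)) := by
  funext k; cases k <;> rfl

theorem initStacks_inl {K K' : Type} (i : K) (x : List Bool) :
    Prog.initStacks (Sum.inl i : K ⊕ K') x = Sum.elim (Prog.initStacks i x) (fun _ => []) := by
  rw [Prog.initStacks, Prog.initStacks, Prog.elim_upd_inl]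
  congr 1
  funext k; cases k <;> rfl

/-- Runs a program on some of the stacks and then moves one of them to the input tape of `M`. -/
theorem run_load {K : Type} {M : TM} {p : Prog K} {i k : K} {x z : List Bool} {N : ℕ}
    {σ : K → List Bool} (h : p.SRun (Prog.initStacks i x) N σ) (hk : σ k = z.reverse) :
    (p.lift M.K ;; Prog.move (.inl k) (.inr M.inp)).Run
      (fun j => stk (Prog.initStacks (.inl i) x j)) (N + (z.length * 9 + 1) + 1)
      (Sum.elim (fun j => stk (upd σ k [] j)) (M.init z).tape) := by
  have h1 := Prog.Run.lift h fun _ : M.K => stk []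
  have h2 := Prog.srun_move (a := Sum.inl k) (b := Sum.inr M.inp) (by simp)
    (Sum.elim σ fun _ : M.K => [])
  unfold Prog.SRun at h2
  simp only [Sum.elim_inl, Sum.elim_inr, hk, List.reverse_reverse, List.append_nil,
    List.length_reverse] at h2
  rw [← Prog.elim_upd_inl, ← Prog.elim_upd_inr, sum_stk, sum_stk] at h2
  rw [initStacks_inl, sum_stk, M.init_tape]
  exact h1.seq h2

namespace Prog

/-- Decides whether one of the first two symbols on the tape `a` is `1`. -/
def decideLarge {K : Type} (a o : K) : Prog K :=
  .branch a fun s => match s with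
    | none => push o false
    | some true => push o true
    | some false => .basic a none (some .right) ;; .branch a fun s => match s with
      | some true => push o true
      | _ => push o false

-- Formulated for arbitrary tapes: halting fixes the output tape only up to the first blank, so the
-- tape of `a` need not be a stack.
open Classical in
theorem run_decideLarge {K : Type} {a o : K} (hao : a ≠ o) (τ : Tapes K) (ho : τ o = stk []) :
    ∃ τ', (decideLarge a o).Run τ 10 τ' ∧ τ' o = stk [decide ((τ a).nth 0 = some true ∨
      ((τ a).nth 0 = some false ∧ (τ a).nth 1 = some true))] := by
  have hbr : ∀ b τ, τ o = stk [] → (push o b).Run τ 3 (upd τ o (stk [b])) :=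
    fun b τ h => run_push o b τ [] h
  rcases h : (τ a).head with _ | _ | _
  · refine ⟨_, (Run.branch (N := 3) (τ' := upd τ o (stk [false])) ?_).mono (by norm_num), ?_⟩
    · rw [h]; exact hbr _ _ ho
    · simp [h]
  · have e := run_basic a none (some .right) τ
    set τ₁ := upd τ a (Frag.basicTape none (some .right) (τ a)) with hτ₁
    have ho₁ : τ₁ o = stk [] := by rw [hτ₁, upd_ne _ _ hao.symm, ho]
    have h1 : (τ₁ a).head = (τ a).nth 1 := by
      rw [hτ₁, upd_same, Frag.basicTape]
      simp only [Option.getD_none, Tape.write_self, TM.moveHead]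
      rw [← Tape.nth_zero, Tape.move_right_nth]
      rfl
    refine ⟨upd τ₁ o (stk [decide ((τ a).nth 1 = some true)]), (Run.branch (N := 7) ?_).mono
      (by norm_num), ?_⟩
    · rw [h]
      refine (e.seq (Run.branch (N := 3) ?_)).mono (by norm_num)
      rw [h1]
      rcases (τ a).nth 1 with _ | _ | _
      · exact hbr _ _ ho₁
      · exact hbr _ _ ho₁
      · exact hbr _ _ ho₁
    · simp [h]
  · refine ⟨_, (Run.branch (N := 3) (τ' := upd τ o (stk [true])) ?_).mono (by norm_num), ?_⟩
    · rw [h]; exact hbr _ _ ho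
    · simp [h]

end Prog

/-- A linear bound that holds for large arguments holds for all arguments. -/
theorem exists_linear_bound {f T : ℕ → ℕ} {n₁ α : ℕ} (h : ∀ n ≥ n₁, f n ≤ α * T n + α) :
    ∃ β, ∀ n, f n ≤ β * T n + β := by
  refine ⟨α + ∑ n ∈ Finset.range n₁, f n, fun n => ?_⟩
  by_cases hn : n₁ ≤ n
  · refine (h n hn).trans ?_
    gcongr <;> omega
  · have := Finset.single_le_sum (f := f) (fun _ _ => Nat.zero_le _)
      (Finset.mem_range.2 (not_le.1 hn))
    omega

open Classical in
theorem circuitLang_mem_BPTIME {C : ℕ} {T : ℕ → ℕ} {A : TM} {a n₀ : ℕ}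
    (h : Solves C T A a n₀) : circuitLang h ∈ BPTIME T := by
  obtain ⟨c, hc⟩ := Prog.srun_padProg C
  -- For `n ≥ 2` the `log + 1` costs only a factor `2 ^ C`, and the instance size is O(T) by the
  -- reading bound. The finitely many smaller `n` are absorbed by `exists_linear_bound`.
  have hkey : ∀ n ≥ max n₀ 4, n * (Nat.log 2 n + 1) ^ C + n + cappSize C n ≤
      (2 ^ C + 1) * (a * T n + a + 3) := by
    intro n hn
    have h1 := h.cappSize_le (n := n) (by omega) (by omega)
    have h2 : Nat.log 2 n + 1 ≤ 2 * Nat.log 2 n := by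
      have := Nat.log_pos (b := 2) (by norm_num) (show 2 ≤ n by omega)
      omega
    have h3 : n * (Nat.log 2 n + 1) ^ C ≤ 2 ^ C * cappSize C n := by
      refine (Nat.mul_le_mul_left n (Nat.pow_le_pow_left h2 C)).trans (le_of_eq ?_)
      rw [mul_pow, cappSize]; ring
    calc _ ≤ 2 ^ C * cappSize C n + (n + cappSize C n) := by omega
      _ ≤ 2 ^ C * (a * T n + a + 3) + (a * T n + a + 3) :=
        Nat.add_le_add (Nat.mul_le_mul_left _ (by omega)) h1
      _ = _ := by ring
  obtain ⟨β, hβ⟩ := exists_linear_bound (T := T)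
    (f := fun n => c * (n * (Nat.log 2 n + 1) ^ C + 1) + ((n + 1 + cappSize C n) * 9 + 1) + 1 +
      (a * T n + a) + 10 + 2) (n₁ := max n₀ 4)
    (α := c * ((2 ^ C + 1) * (a + 3) + 1) + 9 * ((2 ^ C + 1) * (a + 3)) + a + 30) (by
      intro n hn
      have h1 := hkey n hn
      have h2 : (2 ^ C + 1) * (a * T n + a + 3) ≤ (2 ^ C + 1) * (a + 3) * T n +
        (2 ^ C + 1) * (a + 3) := by
        rw [mul_assoc, ← mul_add]
        exact Nat.mul_le_mul_left _ (by nlinarith)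
      set D := (2 ^ C + 1) * (a + 3)
      have h3 : c * (n * (Nat.log 2 n + 1) ^ C + 1) ≤ c * (D * T n + D + 1) :=
        Nat.mul_le_mul_left _ (by omega)
      have h4 : (n + 1 + cappSize C n) * 9 ≤ (D * T n + D + 1) * 9 :=
        Nat.mul_le_mul_right _ (by omega)
      nlinarith)
  let pre : Prog (PadStk ⊕ A.K) :=
    (Prog.padProg C).lift A.K ;; Prog.move (.inl .w) (.inr A.inp)
  let M := callTM A pre (Prog.decideLarge (.inr A.out) (.inl .out)) PadStk.inp PadStk.out (by simp)
  refine ⟨M, β, fun x => ?_⟩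
  obtain ⟨σ, hσ, hw, ho⟩ := hc x
  have hlen : (cappInput x.length (padTo (cappSize C x.length) x)).length =
      x.length + 1 + cappSize C x.length := by simp [cappInput]; omega
  have hrun := run_load (M := A) hσ hw
  rw [hlen] at hrun
  have hA := (h x.length (padTo (cappSize C x.length) x) (by simp)).1
  obtain ⟨n₁, hn₁, hM⟩ := runList_callTM (post := Prog.decideLarge (.inr A.out) (.inl PadStk.out))
    (o := PadStk.out) (hio := by simp) (N₂ := 10)
    (Q := fun τ τ' => τ' (.inl .out) = stk [decide ((τ A.out).nth 0 = some true ∨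
      ((τ A.out).nth 0 = some false ∧ (τ A.out).nth 1 = some true))]) hrun hA (by
    intro l _
    exact Prog.run_decideLarge (by simp) _ (by simp [upd, ho]))
  have hb := hβ x.length
  have hM' : ∀ r : Fin (β * T x.length + β) → Bool, _ := fun r => hM (List.ofFn r) (by
    rw [List.length_ofFn]; exact hb)
  have hM1 : M.HaltsWithin x (β * T x.length + β) := fun r => (hM' r).1
  refine ⟨hM1, (outputProb_canonical h x).trans ?_⟩
  have hle : n₁ + 1 + (a * T x.length + a) ≤ β * T x.length + β := by omega
  -- The window of coins that the simulated `A` uses.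
  let ι : Fin (a * T x.length + a) → Fin (β * T x.length + β) := fun i => ⟨n₁ + 1 + i.1, by omega⟩
  have hι : Function.Injective ι := fun i j hij => by
    simpa [ι, Fin.ext_iff] using hij
  unfold TM.outputProb
  rw [← unifProb_comp hι]
  refine unifProb_mono fun r hr => haltedWith_of_stk (hM1 r) ?_
  refine (hM' r).2.trans ?_
  have he : ((List.ofFn r).drop (n₁ + 1)).take (a * T x.length + a) =
      List.ofFn fun i => r (ι i) := by
    apply List.ext_getElem
    · simp; omega
    · intro i h1 h2
      simp [ι]
  rw [he]
  rw [TM.run_eq_runList] at hr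
  set y := canonical h x with hy
  have hmem : x ∈ circuitLang h ↔ Large y := Iff.rfl
  have h0 := hr.2 0 (Nat.zero_le _)
  congr 2
  refine decide_eq_decide.2 ?_
  rw [hmem, Large]
  rcases hy : y with _ | ⟨b, y'⟩
  -- For an empty output, only cell 0 is known to be blank and cell 1 may hold anything; the program
  -- looks at cell 1 only after a 0 in cell 0.
  · rw [hy] at h0
    simp only [Nat.cast_zero] at h0
    rw [h0]
    simp
  · have h1 := hr.2 1 (by rw [hy]; simp)
    rw [hy] at h0 h1
    simp only [Nat.cast_zero, Nat.cast_one] at h0 h1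
    rw [h0, h1]
    cases b <;> simp

/-! ### Circuits for Boolean functions -/

/-- The variables of a circuit as a sequence. -/
def coin {m : ℕ} (y : Fin m → Bool) (i : ℕ) : Bool := if h : i < m then y ⟨i, h⟩ else false

theorem getD_append_add (g v : List Bool) (i : ℕ) {n : ℕ} (hn : g.length = n) :
    (g ++ v).getD (n + i) false = v.getD i false := by
  subst hn
  simp [List.getD_eq_getElem?_getD, List.getElem?_append_right]

/-- Shannon expansion on the last argument. Distances count back from the current gate, so each
subcircuit shifts the arguments by its length. The extra values `g` are intermediate results. -/
theorem exists_gates (a : ℕ) (φ : (Fin a → Bool) → Bool) (o : ℕ) :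
    ∃ gs : List Gate, ∀ (m : ℕ) (y : Fin m → Bool) (v : List Bool), ∃ g : List Bool,
      g.length + 1 = gs.length ∧
      runGates y gs v = (φ (fun i => v.getD (o + i) false) :: g) ++ v := by
  induction a generalizing o with
  | zero =>
    refine ⟨[.const (φ Fin.elim0)], fun m y v => ⟨[], rfl, ?_⟩⟩
    simp only [runGates, List.foldl_cons, List.foldl_nil, Gate.eval, List.cons_append,
      List.nil_append]
    congr 2
    funext i; exact i.elim0
  | succ a ih =>
    obtain ⟨g1, h1⟩ := ih (fun z => φ (Fin.snoc z true)) o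
    obtain ⟨g0, h0⟩ := ih (fun z => φ (Fin.snoc z false)) (g1.length + o)
    -- A multiplexer. The `2 +` in its third gate skips the two values that its first two gates have
    -- just pushed.
    refine ⟨g1 ++ g0 ++ [.not (g0.length + (g1.length + (o + a))), .and 0 1,
      .and (2 + (g0.length + (g1.length + (o + a)))) (2 + g0.length), .or 0 1], fun m y v => ?_⟩
    obtain ⟨r1, hr1, e1⟩ := h1 m y v
    obtain ⟨r0, hr0, e0⟩ := h0 m y (runGates y g1 v)
    simp only [add_assoc] at e0
    rw [runGates_append, runGates_append, e0, e1]
    have e2 : ∀ i, ((φ (Fin.snoc (fun i : Fin a => v.getD (o + i) false) true) :: r1) ++ v).getD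
        (g1.length + i) false = v.getD i false := fun i => getD_append_add _ _ i (by simpa using hr1)
    simp only [e2]
    set p1 := φ (Fin.snoc (fun i : Fin a => v.getD (o + i) false) true) with hp1
    set p0 := φ (Fin.snoc (fun i : Fin a => v.getD (o + i) false) false) with hp0
    have e3 : ∀ i, ((p0 :: r0) ++ ((p1 :: r1) ++ v)).getD (g0.length + i) false =
      ((p1 :: r1) ++ v).getD i false := fun i => getD_append_add _ _ i (by simpa using hr0)
    have ex : ((p0 :: r0) ++ ((p1 :: r1) ++ v)).getD (g0.length + (g1.length + (o + a))) false =
      v.getD (o + a) false := by rw [e3, e2]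
    have ep : ((p0 :: r0) ++ ((p1 :: r1) ++ v)).getD g0.length false = p1 := by
      have := e3 0
      simpa using this
    set V := (p0 :: r0) ++ ((p1 :: r1) ++ v) with hV
    have hV0 : V.getD 0 false = p0 := rfl
    have hφ : φ (fun i => v.getD (o + i) false) =
        ((v.getD (o + a) false && p1) || (!v.getD (o + a) false && p0)) := by
      have : (fun i : Fin (a + 1) => v.getD (o + i) false) =
          Fin.snoc (α := fun _ => Bool) (fun i : Fin a => v.getD (o + i) false)
            (v.getD (o + a) false) := by
        funext i
        refine Fin.lastCases ?_ (fun i => ?_) i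
        · simp
        · simp
      rw [this]
      cases v.getD (o + a) false <;> simp [hp1, hp0]
    refine ⟨[v.getD (o + a) false && p1, !v.getD (o + a) false && p0, !v.getD (o + a) false] ++
      (p0 :: r0) ++ (p1 :: r1), ?_, ?_⟩
    · simp; omega
    · have h2 : ∀ (a b : Bool) (i : ℕ), (a :: b :: V).getD (2 + i) false = V.getD i false :=
        fun a b i => getD_append_add [a, b] V i rfl
      simp only [runGates, List.foldl_cons, List.foldl_nil, Gate.eval, h2, ex, ep, hφ]
      simp [hV]

/-- The last output sits at position 0, so it becomes the value of a circuit that ends with these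
gates. -/
theorem exists_gates_vec (a b : ℕ) (Φ : Fin b → (Fin a → Bool) → Bool) (o : ℕ) :
    ∃ (gs : List Gate) (pos : Fin b → ℕ), (∀ r, pos r < gs.length) ∧
      (∀ r : Fin b, r.1 + 1 = b → pos r = 0) ∧
      ∀ (m : ℕ) (y : Fin m → Bool) (v : List Bool), ∃ g : List Bool,
        g.length = gs.length ∧ runGates y gs v = g ++ v ∧
        ∀ r, g.getD (pos r) false = Φ r fun i => v.getD (o + i) false := by
  induction b generalizing o with
  | zero =>
    exact ⟨[], Fin.elim0, fun r => r.elim0, fun r => r.elim0, fun m y v => ⟨[], rfl, rfl, fun r => r.elim0⟩⟩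
  | succ b ih =>
    obtain ⟨gs, pos, hpos, -, h⟩ := ih (fun r => Φ r.castSucc) o
    obtain ⟨gs', h'⟩ := exists_gates a (Φ (Fin.last b)) (gs.length + o)
    have hl : 0 < gs'.length := by
      obtain ⟨g, hg, -⟩ := h' 0 Fin.elim0 []
      omega
    refine ⟨gs ++ gs', Fin.snoc (α := fun _ => ℕ) (fun r => gs'.length + pos r) 0, ?_, ?_, ?_⟩
    · intro r
      refine Fin.lastCases ?_ (fun r => ?_) r
      · simp; omega
      · have := hpos r
        simp; omega
    · intro r hr
      obtain rfl : r = Fin.last b := Fin.ext (by simpa using hr)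
      simp
    · intro m y v
      obtain ⟨g, hg, e, hr⟩ := h m y v
      obtain ⟨g', hg', e'⟩ := h' m y (g ++ v)
      refine ⟨(Φ (Fin.last b) (fun i => (g ++ v).getD (gs.length + o + i) false) :: g') ++ g,
        ?_, ?_, ?_⟩
      · simp; omega
      · rw [runGates_append, e, e', List.append_assoc]
      · intro r
        refine Fin.lastCases ?_ (fun r => ?_) r
        · simp only [Fin.snoc_last, List.cons_append, List.getD_cons_zero, add_assoc]
          congr 1
          funext i
          rw [getD_append_add _ _ _ hg]
        · simp only [Fin.snoc_castSucc]
          rw [getD_append_add _ _ _ (by simpa using hg'), hr]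

/-! ### Circuits for recurrences -/

/-- A template for bit strings: `none` stands for the digits of a number. -/
def inst (D : List Bool) (t : List (Option Bool)) : List Bool :=
  t.flatMap fun o => match o with
    | none => D.flatMap fun c => [true, c]
    | some c => [c]

theorem inst_append (D : List Bool) (t t' : List (Option Bool)) :
    inst D (t ++ t') = inst D t ++ inst D t' := by
  simp [inst]

theorem inst_some (D l : List Bool) : inst D (l.map some) = l := by
  induction l with
  | nil => rfl
  | cons b l ih =>
    rw [List.map_cons, ← List.singleton_append, inst_append, ih]
    simp [inst]

/-- The template for the number with the digits `l` followed by the variable digits. -/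
def numT (l : List Bool) : List (Option Bool) :=
  (l.flatMap fun c => [some true, some c]) ++ [none, some false]

theorem inst_numT (D l : List Bool) : inst D (numT l) = encNum (l ++ D) := by
  have : inst D (l.flatMap fun c => [some true, some c]) = l.flatMap fun c => [true, c] := by
    induction l with
    | nil => rfl
    | cons c l ih =>
      rw [List.flatMap_cons, inst_append, ih]
      simp [inst]
  rw [numT, inst_append, this]
  simp [inst, encNum]

theorem inst_flatMap {α : Type} (D : List Bool) (l : List α) (f : α → List (Option Bool)) :
    inst D (l.flatMap f) = l.flatMap fun i => inst D (f i) := by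
  simp [inst, List.flatMap_assoc]

/-- The code of two states and a coin. -/
def wire {S : Type} {b : ℕ} (code : S → Fin b → Bool) (s f : S) (z : Bool) : List Bool :=
  List.ofFn (code s) ++ List.ofFn (code f) ++ [z]

theorem wire_injective {S : Type} {b : ℕ} {code : S → Fin b → Bool}
    (hc : Function.Injective code) {s f s' f' : S} {z z' : Bool}
    (h : wire code s f z = wire code s' f' z') : s = s' ∧ f = f' ∧ z = z' := by
  unfold wire at h
  obtain ⟨h1, h2⟩ := List.append_inj h (by simp)
  obtain ⟨h3, h4⟩ := List.append_inj h1 (by simp)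
  exact ⟨hc (List.ofFn_injective h3), hc (List.ofFn_injective h4), by simpa using h2⟩

/-- For a row of mutually independent gates: the `p`th one sees `p` fresh values on top of `v` and
must reach past them. -/
theorem runGates_map {m : ℕ} (y : Fin m → Bool) {α : Type} (l : List α) (f : α → Gate)
    (h : α → Bool) (v : List Bool)
    (hf : ∀ p (hp : p < l.length), ∀ w : List Bool, w.length = p →
      (f l[p]).eval y (w ++ v) = h l[p]) :
    runGates y (l.map f) v = (l.map h).reverse ++ v := by
  induction l using List.reverseRecOn with
  | nil => rfl
  | append_singleton l a ih =>
    rw [List.map_append, runGates_append, ih]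
    · have := hf l.length (by simp) (l.map h).reverse (by simp)
      simp only [List.getElem_concat_length] at this
      simp [runGates, this]
    · intro p hp w hw
      have := hf p (by simp; omega) w hw
      simpa [List.getElem_append_left hp] using this

/-- For every recurrence on a finite set of states there are encoded blocks of gates, all of the
same length, that compute one step of the recurrence: from the previous state and from the one
that is `N` steps earlier (`mainT`, with the digits of `N` as a parameter), or from constant states
and a coin (`headT`, with the digits of the index of the coin as a parameter). -/
theorem exists_blocks {S : Type} [Finite S] (F : S → S → Bool → S) (acc : S → Bool) (d : S) :
    ∃ (mainT : List (Option Bool)) (headT : S → List (Option Bool)) (mainG : ℕ → List Gate)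
      (headG : S → ℕ → List Gate) (Rep : List Bool → List S → Prop),
      (∀ D, Parses (inst D mainT) (mainG (Prog.val D))) ∧
      (∀ D u, Parses (inst D (headT u)) (headG u (Prog.val D))) ∧
      Rep [] [] ∧
      (∀ v s ss, Rep v (s :: ss) → v.headD false = acc s) ∧
      (∀ (m : ℕ) (y : Fin m → Bool) v ss N s f, Rep v ss → ss[0]? = some s → ss[N]? = some f →
        Rep (runGates y (mainG N) v) (F s f false :: ss)) ∧
      (∀ (m : ℕ) (y : Fin m → Bool) v ss u i, Rep v ss →
        Rep (runGates y (headG u i) v) (F u d (coin y i) :: ss)) ∧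
      (∀ D u, inst D (headT u) ≠ []) := by
  classical
  obtain ⟨b, ⟨eS⟩⟩ := Finite.exists_equiv_fin S
  let code : S → Fin b → Bool := fun s r => decide (r = eS s)
  have hcode : Function.Injective code := by
    intro s s' h
    have := congrFun h (eS s)
    simp only [code, decide_true] at this
    exact eS.injective (by simpa using this.symm)
  have hinj : Function.Injective fun (p : S × S × Bool) (i : Fin (b + b + 1)) =>
      (wire code p.1 p.2.1 p.2.2).reverse.getD i false := by
    rintro ⟨s, f, z⟩ ⟨s', f', z'⟩ h
    have hl : ∀ s f z, (wire code s f z).reverse.length = b + b + 1 := by simp [wire]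
    have hw : wire code s f z = wire code s' f' z' := by
      rw [← List.reverse_inj]
      apply List.ext_getElem
      · rw [hl, hl]
      · intro i h1 h2
        have h3 := hl s f z ▸ h1
        have := congrFun h ⟨i, h3⟩
        simpa only [List.getD_eq_getElem?_getD, List.getElem?_eq_getElem h1,
          List.getElem?_eq_getElem h2, Option.getD_some] using this
    obtain ⟨rfl, rfl, rfl⟩ := wire_injective hcode hw
    rfl
  -- The Boolean function is prescribed only on codes of states; other bit patterns get the value
  -- `false`.
  have hdec : ∀ Ψ : S → Bool, ∃ φ : (Fin (b + b + 1) → Bool) → Bool, ∀ s f z,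
      φ (fun i => (wire code s f z).reverse.getD i false) = Ψ (F s f z) := fun Ψ =>
    ⟨Function.extend _ (fun p : S × S × Bool => Ψ (F p.1 p.2.1 p.2.2)) fun _ => false,
      fun s f z => hinj.extend_apply _ _ (s, f, z)⟩
  choose φ hφ using hdec
  obtain ⟨C, pos', hpos', hlast, hC⟩ := exists_gates_vec (b + b + 1) (b + 1)
    (Fin.snoc (α := fun _ => (Fin (b + b + 1) → Bool) → Bool)
      (fun r => φ fun s => code s r) (φ acc)) 0
  let pos : Fin b → ℕ := fun r => pos' r.castSucc
  have hpos : ∀ r, pos r < C.length := fun r => hpos' _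
  -- A block has `g` working gates: two copied states, a coin bit and the gates `C`. Another `π`
  -- dummy gates raise its size to `G = 2 ^ g`, so that a state `j` places back lies at distance `j
  -- * G`.
  set g := b + b + 1 + C.length with hg
  have hgG : g < 2 ^ g := Nat.lt_two_pow_self
  set G := 2 ^ g with hG
  set π := G - g with hπ
  let Rep : List Bool → List S → Prop := fun v ss =>
    (∀ j s, ss[j]? = some s → ∀ r, v.getD (j * G + pos r) false = code s r) ∧
    ∀ s ss', ss = s :: ss' → v.headD false = acc s
  have hblock : ∀ (m : ℕ) (y : Fin m → Bool) v ss cp s f z, Rep v ss →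
      runGates y cp v = (wire code s f z).reverse ++ (List.replicate π false ++ v) →
      Rep (runGates y (cp ++ C) v) (F s f z :: ss) := by
    intro m y v ss cp s f z hv hcp
    obtain ⟨w, hw, e, hr⟩ := hC m y (runGates y cp v)
    rw [runGates_append, e]
    have hin : (fun i : Fin (b + b + 1) => (runGates y cp v).getD (0 + i) false) =
        fun i : Fin (b + b + 1) => (wire code s f z).reverse.getD i false := by
      funext i
      rw [hcp, zero_add]
      have : i.1 < (wire code s f z).reverse.length := by
        have := i.2
        simpa [wire] using this
      simp only [List.getD_eq_getElem?_getD, List.getElem?_append_left this]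
    rw [hin] at hr
    have hget : ∀ r, (w ++ runGates y cp v).getD (pos' r) false = w.getD (pos' r) false := by
      intro r
      have : pos' r < w.length := hw ▸ hpos' r
      simp only [List.getD_eq_getElem?_getD, List.getElem?_append_left this]
    refine ⟨fun j s' hs' r => ?_, ?_⟩
    · rcases j with _ | j
      · obtain rfl : F s f z = s' := by simpa using hs'
        rw [zero_mul, zero_add, hget, hr]
        simp only [Fin.snoc_castSucc]
        rw [hφ]
      · have hlen : (w ++ (wire code s f z).reverse ++ List.replicate π false).length = G := by
          simp [wire, hw]; omega
        rw [hcp, ← List.append_assoc, ← List.append_assoc,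
          show (j + 1) * G + pos r = G + (j * G + pos r) by ring, getD_append_add _ _ _ hlen]
        exact hv.1 j s' (by simpa using hs') r
    · rintro s' ss' he
      obtain rfl : F s f z = s' := by simpa using (List.cons.inj he).1
      have h0 := hget (Fin.last b)
      rw [hr, hlast _ (by simp)] at h0
      simp only [Fin.snoc_last] at h0
      rw [hφ] at h0
      rw [← h0]
      cases w ++ runGates y cp v <;> rfl
  have hpads : ∀ (m : ℕ) (y : Fin m → Bool) v,
      runGates y (List.replicate π (.const false)) v = List.replicate π false ++ v := by
    intro m y v
    have := runGates_map y (List.replicate π false) Gate.const id v (by simp [Gate.eval])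
    simpa using this
  have hfin : ∀ p (hp : p < (List.finRange b).length), ((List.finRange b)[p]).1 = p := by simp
  let nearG : List Gate := (List.finRange b).map fun r =>
    .or (r + (π + pos r)) (r + (π + pos r))
  -- The distance passes `r` copies of this row, the `b` near copies, the padding and `N` whole
  -- blocks. Its part without `G * N` is below `2 ^ g`, so in binary it is `g` fixed digits followed
  -- by those of `N`. The copy is an OR of a bit with itself.
  let farG : ℕ → List Gate := fun N => (List.finRange b).map fun r =>
    .or ((r + (b + (π + pos r))) + G * N) ((r + (b + (π + pos r))) + G * N)
  let cG : S → List Gate := fun u => (List.finRange b).map fun r => .const (code u r)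
  let padT : List (Option Bool) :=
    ((List.replicate π (Gate.const false)).flatMap encGate).map some
  let CT : List (Option Bool) := (C.flatMap encGate).map some
  let farT : List (Option Bool) := (List.finRange b).flatMap fun r =>
    [true, true, false, true].map some ++ numT (Prog.dig g (r + (b + (π + pos r)))) ++
      numT (Prog.dig g (r + (b + (π + pos r))))
  let mainT : List (Option Bool) := padT ++ (nearG.flatMap encGate).map some ++ farT ++
    (encGate (.const false)).map some ++ CT
  let mainG : ℕ → List Gate := fun N =>
    List.replicate π (.const false) ++ nearG ++ farG N ++ [.const false] ++ C
  let headT : S → List (Option Bool) := fun u => padT ++ ((cG u).flatMap encGate).map some ++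
    ((cG d).flatMap encGate).map some ++ ([true, false, true, false].map some ++ numT []) ++ CT
  let headG : S → ℕ → List Gate := fun u i =>
    List.replicate π (.const false) ++ cG u ++ cG d ++ [.input i] ++ C
  refine ⟨mainT, headT, mainG, headG, Rep, fun D => ?_, fun D u => ?_, ?_, ?_, ?_, ?_, ?_⟩
  · simp only [mainT, mainG, padT, CT, inst_append, inst_some]
    refine ((((parses_encGates _).append (parses_encGates _)).append ?_).append
      (parses_encGate _)).append (parses_encGates _)
    simp only [farT, farG, inst_flatMap, inst_append, inst_some, inst_numT]
    rw [List.map_eq_flatMap]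
    refine Parses.flatMap fun r _ => ?_
    have hr : r.1 + (b + (π + pos r)) < 2 ^ g := by
      have := hpos r
      have := r.2
      omega
    have := parses_or (Prog.dig g (r + (b + (π + pos r))) ++ D)
      (Prog.dig g (r + (b + (π + pos r))) ++ D)
    rwa [Prog.val_append, Prog.length_dig, Prog.val_dig hr] at this
  · simp only [headT, headG, padT, CT, inst_append, inst_some, inst_numT]
    refine ((((parses_encGates _).append (parses_encGates _)).append (parses_encGates _)).append
      ?_).append (parses_encGates _)
    simpa using parses_input D
  · exact ⟨by simp, by simp⟩
  · exact fun v s ss h => h.2 s ss rfl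
  · intro m y v ss N s f hv hs hf
    refine hblock m y v ss _ s f false hv ?_
    have h3 : (List.replicate π false).length = π := by simp
    have h2 : (((List.finRange b).map (code s)).reverse : List Bool).length = b := by simp
    have e1 : runGates y nearG (List.replicate π false ++ v) =
        ((List.finRange b).map (code s)).reverse ++ (List.replicate π false ++ v) := by
      refine runGates_map y (List.finRange b) _ (code s) _ fun p hp w hw => ?_
      simp only [Gate.eval, hfin p hp, Bool.or_self]
      rw [getD_append_add _ _ _ hw, getD_append_add _ _ _ h3]
      have := hv.1 0 s hs (List.finRange b)[p]
      simpa using this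
    have e2 : runGates y (farG N) (((List.finRange b).map (code s)).reverse ++
        (List.replicate π false ++ v)) = ((List.finRange b).map (code f)).reverse ++
        (((List.finRange b).map (code s)).reverse ++ (List.replicate π false ++ v)) := by
      refine runGates_map y (List.finRange b) _ (code f) _ fun p hp w hw => ?_
      simp only [Gate.eval, hfin p hp, Bool.or_self]
      rw [add_assoc, getD_append_add _ _ _ hw, add_assoc, getD_append_add _ _ _ h2, add_assoc,
        getD_append_add _ _ _ h3, add_comm, mul_comm]
      exact hv.1 N f hf _
    rw [runGates_append, runGates_append, runGates_append, hpads, e1, e2]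
    simp [runGates, Gate.eval, wire, List.ofFn_eq_map]
  · intro m y v ss u i hv
    refine hblock m y v ss _ u d (coin y i) hv ?_
    have e1 : ∀ u v, runGates y (cG u) v = ((List.finRange b).map (code u)).reverse ++ v :=
      fun u v => runGates_map y (List.finRange b) _ (code u) _ fun p hp w hw => rfl
    rw [runGates_append, runGates_append, runGates_append, hpads, e1, e1]
    simp [runGates, Gate.eval, wire, List.ofFn_eq_map, coin]
  · intro D u
    simp only [headT, inst_append, inst_some]
    simp

/-- The states of a recurrence: the first `N + 1` states are given by `h`, and every later state
is computed from the previous one and the one that is `N + 1` steps earlier. -/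
def states {S : Type} (N : ℕ) (F : S → S → S) (h : ℕ → S) : ℕ → S
  | 0 => h 0
  | j + 1 => if j < N then h (j + 1) else F (states N F h j) (states N F h (j - N))
  decreasing_by all_goals omega

theorem states_le {S : Type} {N : ℕ} (F : S → S → S) (h : ℕ → S) {j : ℕ} (hj : j ≤ N) :
    states N F h j = h j := by
  cases j with
  | zero => rw [states]
  | succ j => rw [states, if_pos (by omega)]

theorem states_add {S : Type} (N : ℕ) (F : S → S → S) (h : ℕ → S) (j : ℕ) :
    states N F h (N + j + 1) = F (states N F h (N + j)) (states N F h j) := by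
  rw [states, if_neg (by omega), Nat.add_sub_cancel_left]

/-! ### Simulation of a machine by a recurrence

A layer of `N + 2` states represents a configuration: the first state holds the control (the state
of the machine and the scanned symbols), and the `i + 1`st one holds the symbols at distance `i + 1`
to the left and to the right of the heads, and the coin of the `i`th following step. -/

/-- The part of a configuration that is held by one state of the recurrence. -/
abbrev Content (M : TM) : Type :=
  (M.Q × (M.K → Option Bool)) ⊕ ((M.K → Option Bool) × (M.K → Option Bool) × Bool)

/-- A state of the recurrence: its own part of the configuration, the part of the previous
configuration next to it, the previous symbols one place nearer to the heads, the head moves, and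
whether the scanned output symbol is `1`. -/
structure SimState (M : TM) where
  own : Content M
  next : Content M
  inner : (M.K → Option Bool) × (M.K → Option Bool)
  dirs : M.K → Option Dir
  acc : Bool

instance (M : TM) : Finite (SimState M) := by
  have := M.finK
  have := M.finQ
  have : Finite Dir := by
    have : Fintype Dir := ⟨{.left, .right}, fun d => by cases d <;> simp⟩
    infer_instance
  exact Finite.of_injective
    (fun s : SimState M => (s.own, s.next, s.inner, s.dirs, s.acc)) fun s s' h => by
      cases s; cases s'; simpa using h

namespace SimState

variable {M : TM}

/-- The symbols and the coin that are held; blank if the control is held instead. -/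
def cell : Content M → (M.K → Option Bool) × (M.K → Option Bool) × Bool
  | .inl _ => (fun _ => none, fun _ => none, false)
  | .inr c => c

open Classical in
/-- The transition of the machine, including halted states. -/
noncomputable def action (M : TM) (q : M.Q) (s : M.K → Option Bool) (b : Bool) :
    M.Q × (M.K → Option Bool) × (M.K → Option Dir) :=
  if q = M.halt then (q, s, fun _ => none) else M.δ q s b

/-- Chooses between three values according to a head move. -/
def pick {α : Type} (d : Option Dir) (stay left right : α) : α :=
  match d with
  | none => stay
  | some .left => left
  | some .right => right

/-- The recurrence. -/
noncomputable def step (s f : SimState M) : SimState M :=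
  match s.next with
  | .inl c =>
    let a := action M c.1 c.2 (cell f.own).2.2
    let h := fun k => pick (a.2.2 k) (a.2.1 k) ((cell f.own).1 k) ((cell f.own).2.1 k)
    { own := .inl (a.1, h)
      next := f.own
      inner := (a.2.1, a.2.1)
      dirs := a.2.2
      acc := decide (h M.out = some true) }
  | .inr c =>
    { own := .inr (fun k => pick (s.dirs k) (c.1 k) ((cell f.own).1 k) (s.inner.1 k),
        fun k => pick (s.dirs k) (c.2.1 k) (s.inner.2 k) ((cell f.own).2.1 k), (cell f.own).2.2)
      next := f.own
      inner := (c.1, c.2.1)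
      dirs := s.dirs
      acc := s.acc }

open Classical in
/-- The initial states: `u` gives an input symbol, and says whether the control is held. -/
noncomputable def initial (M : TM) (u : Option Bool × Bool) (z : Bool) : SimState M where
  own := if u.2 then .inl (M.start, fun k => if k = M.inp then u.1 else none)
    else .inr (fun _ => none, fun k => if k = M.inp then u.1 else none, z)
  next := .inr (fun _ => none, fun _ => none, false)
  inner := (fun _ => none, fun _ => none)
  dirs := fun _ => none
  acc := false

theorem step_next (s f : SimState M) : (step s f).next = f.own := by
  unfold step
  split <;> rfl

theorem step_own_isLeft (s f : SimState M) : (step s f).own.isLeft = s.next.isLeft := by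
  unfold step
  split <;> rename_i h <;> rw [h] <;> rfl

/-- The configuration after `n` steps with the coins `c`. -/
noncomputable def cfg (M : TM) (x : List Bool) (c : ℕ → Bool) : ℕ → M.Cfg
  | 0 => M.init x
  | n + 1 => M.step (cfg M x c n) (c n)

/-- The control of a configuration. -/
def control (c : M.Cfg) : M.Q × (M.K → Option Bool) := (c.state, fun k => (c.tape k).head)

/-- The symbols at distance `i + 1` from the heads. -/
def symbols (c : M.Cfg) (i : ℕ) : (M.K → Option Bool) × (M.K → Option Bool) :=
  (fun k => (c.tape k).left.nth i, fun k => (c.tape k).right.nth i)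

theorem step_eq_action (c : M.Cfg) (b : Bool) :
    M.step c b = ⟨(action M (control c).1 (control c).2 b).1,
      fun k => TM.moveHead ((action M (control c).1 (control c).2 b).2.2 k)
        ((c.tape k).write ((action M (control c).1 (control c).2 b).2.1 k))⟩ := by
  unfold TM.step action control
  split_ifs with h
  · cases c
    simp [TM.moveHead]
  · rfl

theorem control_step (c : M.Cfg) (b : Bool) :
    control (M.step c b) = ((action M (control c).1 (control c).2 b).1, fun k =>
      pick ((action M (control c).1 (control c).2 b).2.2 k)
        ((action M (control c).1 (control c).2 b).2.1 k) ((symbols c 0).1 k)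
        ((symbols c 0).2 k)) := by
  rw [step_eq_action]
  generalize action M (control c).1 (control c).2 b = a
  simp only [control, symbols, Prod.mk.injEq, true_and]
  funext k
  rcases a.2.2 k with _ | _ | _ <;>
    simp [TM.moveHead, pick, Tape.move, Tape.write]

theorem symbols_step (c : M.Cfg) (b : Bool) (i : ℕ) :
    symbols (M.step c b) i =
      (fun k => pick ((action M (control c).1 (control c).2 b).2.2 k) ((symbols c i).1 k)
        ((symbols c (i + 1)).1 k)
        (if i = 0 then (action M (control c).1 (control c).2 b).2.1 k else (symbols c (i - 1)).1 k),
      fun k => pick ((action M (control c).1 (control c).2 b).2.2 k) ((symbols c i).2 k)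
        (if i = 0 then (action M (control c).1 (control c).2 b).2.1 k else (symbols c (i - 1)).2 k)
        ((symbols c (i + 1)).2 k)) := by
  rw [step_eq_action]
  generalize action M (control c).1 (control c).2 b = a
  simp only [symbols, Prod.mk.injEq]
  constructor <;> funext k <;> rcases a.2.2 k with _ | _ | _ <;> rcases i with _ | i <;>
    simp [TM.moveHead, pick, Tape.move, Tape.write, ListBlank.nth_succ]

/-! ### The recurrence follows the machine. -/

section simulation

variable (M) (N : ℕ) (x : List Bool) (c : ℕ → Bool)

/-- The sequence of states that simulates the machine with the coins `c`. -/
noncomputable def sim : ℕ → SimState M :=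
  states N step fun j => initial M (x[j]?, decide (j = 0)) (c (j - 1))

theorem sim_le {j : ℕ} (hj : j ≤ N) :
    sim M N x c j = initial M (x[j]?, decide (j = 0)) (c (j - 1)) := states_le _ _ hj

theorem sim_add (j : ℕ) : sim M N x c (N + j + 1) = step (sim M N x c (N + j)) (sim M N x c j) :=
  states_add _ _ _ j

theorem sim_next (j : ℕ) : (sim M N x c (N + j + 1)).next = (sim M N x c j).own := by
  rw [sim_add, step_next]

theorem sim_isLeft (j : ℕ) : (sim M N x c j).own.isLeft = decide (j % (N + 2) = 0) := by
  induction j using Nat.strong_induction_on with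
  | _ j ih =>
    by_cases h1 : j ≤ N
    · rw [sim_le _ _ _ _ h1, Nat.mod_eq_of_lt (by omega)]
      by_cases h0 : j = 0 <;> simp [initial, h0]
    · obtain ⟨i, rfl⟩ := Nat.exists_eq_add_of_le (show N + 1 ≤ j by omega)
      rw [show N + 1 + i = N + i + 1 by ring, sim_add, step_own_isLeft]
      rcases i with _ | i
      · rw [add_zero, sim_le _ _ _ _ le_rfl, Nat.mod_eq_of_lt (by omega)]
        simp [initial]
      · rw [← add_assoc, sim_next, ih i (by omega), show N + i + 1 + 1 = i + (N + 2) by ring,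
          Nat.add_mod_right]

/-- Rows have `N + 2` states but the recurrence reaches back only `N + 1`: it sees the right
neighbour in the preceding row. The middle state of that row is what the predecessor saw (`next`),
and the left neighbour's symbols arrive through `inner`. -/
theorem sim_step (τ i : ℕ) :
    sim M N x c ((τ + 1) * (N + 2) + i + 1) =
      step (sim M N x c ((τ + 1) * (N + 2) + i)) (sim M N x c (τ * (N + 2) + 1 + i + 1)) := by
  have := sim_add M N x c (τ * (N + 2) + 1 + i + 1)
  rwa [show N + (τ * (N + 2) + 1 + i + 1) = (τ + 1) * (N + 2) + i by ring] at this

theorem sim_step_next (τ i : ℕ) :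
    (sim M N x c ((τ + 1) * (N + 2) + i)).next = (sim M N x c (τ * (N + 2) + 1 + i)).own := by
  have := sim_next M N x c (τ * (N + 2) + 1 + i)
  rwa [show N + (τ * (N + 2) + 1 + i) + 1 = (τ + 1) * (N + 2) + i by ring] at this

theorem sim_control_step (τ : ℕ) :
    sim M N x c ((τ + 1) * (N + 2)) =
      step (sim M N x c (N + (τ * (N + 2)) + 1)) (sim M N x c (τ * (N + 2) + 1)) := by
  have := sim_add M N x c (τ * (N + 2) + 1)
  rwa [show N + (τ * (N + 2) + 1) + 1 = (τ + 1) * (N + 2) by ring] at this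

/-- A row has no proper right end, so wrong values enter there; they travel at most one place per
step towards the control, whence the restriction `i + τ < N`. The coins move inwards at the same
speed, and that of step `τ` reaches the first cell just in time. -/
theorem sim_correct (τ : ℕ) (hτ : τ < N) :
    (sim M N x c (τ * (N + 2))).own = .inl (control (cfg M x c τ)) ∧
    (∀ i, i + τ < N → (sim M N x c (τ * (N + 2) + 1 + i)).own =
      .inr ((symbols (cfg M x c τ) i).1, (symbols (cfg M x c τ) i).2, c (τ + i))) ∧
    (0 < τ → (sim M N x c (τ * (N + 2))).acc =
      decide ((control (cfg M x c τ)).2 M.out = some true)) := by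
  induction τ with
  | zero =>
    refine ⟨?_, fun i hi => ?_, fun h => absurd h (lt_irrefl 0)⟩
    · rw [sim_le _ _ _ _ (by omega)]
      simp only [initial, cfg, control, zero_mul, decide_true, if_true]
      congr 2
      funext k
      rw [TM.init_tape]
      by_cases hk : k = M.inp
      · simp [hk, Prog.initStacks, List.head?_eq_getElem?]
      · simp [hk, Prog.initStacks, upd]
    · rw [sim_le _ _ _ _ (by omega)]
      have e : ∀ (l : List Bool) j, (stk l).right.nth j = l[j + 1]? := fun l j =>
        TM.nth_stk l (j + 1)
      have e' : ∀ (l : List Bool) j, (stk l).left.nth j = none := fun l j =>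
        TM.nth_stk_neg l j
      simp only [initial, cfg, symbols, TM.init_tape, e, e']
      have : 0 * (N + 2) + 1 + i = i + 1 := by ring
      rw [this]
      simp only [Nat.succ_ne_zero, decide_false, Bool.false_eq_true, if_false, Nat.add_sub_cancel,
        zero_add]
      congr 3
      funext k
      by_cases hk : k = M.inp
      · simp [hk, Prog.initStacks]
      · simp [hk, Prog.initStacks, upd]
  | succ τ ih =>
    obtain ⟨h1, h2, -⟩ := ih (by omega)
    have h20 := h2 0 (by omega)
    have hctl : sim M N x c ((τ + 1) * (N + 2)) =
        { own := .inl (control (cfg M x c (τ + 1)))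
          next := (sim M N x c (τ * (N + 2) + 1)).own
          inner := ((action M (control (cfg M x c τ)).1 (control (cfg M x c τ)).2 (c τ)).2.1,
            (action M (control (cfg M x c τ)).1 (control (cfg M x c τ)).2 (c τ)).2.1)
          dirs := (action M (control (cfg M x c τ)).1 (control (cfg M x c τ)).2 (c τ)).2.2
          acc := decide ((control (cfg M x c (τ + 1))).2 M.out = some true) } := by
      rw [sim_control_step, step, sim_next, h1]
      simp only [add_zero] at h20
      simp only [h20, cell, cfg, control_step]
    have hcell : ∀ i, i + τ + 1 < N → sim M N x c ((τ + 1) * (N + 2) + i + 1) =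
        { own := .inr ((symbols (cfg M x c (τ + 1)) i).1, (symbols (cfg M x c (τ + 1)) i).2,
            c (τ + 1 + i))
          next := (sim M N x c (τ * (N + 2) + 1 + i + 1)).own
          inner := symbols (cfg M x c τ) i
          dirs := (action M (control (cfg M x c τ)).1 (control (cfg M x c τ)).2 (c τ)).2.2
          acc := decide ((control (cfg M x c (τ + 1))).2 M.out = some true) } := by
      intro i
      induction i with
      | zero =>
        intro hi
        have h21 := h2 1 (by omega)
        rw [sim_step M N x c τ 0, step, sim_step_next M N x c τ 0, h20]
        simp only [add_zero] at h21 ⊢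
        rw [hctl]
        simp only [h21, cell, cfg, symbols_step]
        simp
      | succ i ih =>
        intro hi
        have h2i := h2 (i + 1) (by omega)
        have h2i' := h2 (i + 1 + 1) (by omega)
        rw [sim_step, step, sim_step_next, h2i]
        rw [← add_assoc ((τ + 1) * (N + 2)) i 1, ih (by omega)]
        simp only [← add_assoc] at h2i' ⊢
        simp only [h2i', cell, cfg, symbols_step]
        simp [add_assoc, add_comm 1]
    refine ⟨by rw [hctl], fun i hi => ?_, fun _ => by rw [hctl]⟩
    rw [show (τ + 1) * (N + 2) + 1 + i = (τ + 1) * (N + 2) + i + 1 by ring, hcell i (by omega)]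

/-- Every non-control state copies the flag of its predecessor, so the answer may be read anywhere
in a row, even among cells with wrong contents. -/
theorem sim_acc (τ i : ℕ) (hτ : τ + 1 < N) (hi : i ≤ N + 1) :
    (sim M N x c ((τ + 1) * (N + 2) + i)).acc =
      decide (((cfg M x c (τ + 1)).tape M.out).head = some true) := by
  induction i with
  | zero => exact (sim_correct M N x c (τ + 1) hτ).2.2 (by omega)
  | succ i ih =>
    rw [← ih (by omega), ← add_assoc, sim_step, step]
    have h := sim_isLeft M N x c (τ * (N + 2) + 1 + i)
    rw [← sim_step_next] at h
    have h' : (τ * (N + 2) + 1 + i) % (N + 2) = i + 1 := by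
      rw [add_assoc, mul_comm, Nat.mul_add_mod, Nat.mod_eq_of_lt (by omega), add_comm]
    rw [h', decide_eq_false (by omega)] at h
    split
    · rename_i h''
      rw [h''] at h
      simp at h
    · rfl

end simulation

end SimState

/-! ### The circuit that simulates a machine -/

/-- The string that is put together from the blocks for `N + 1` initial states and for `N * N`
further states; numbers are written with `len` digits. -/
def circuitStr (mainT : List (Option Bool)) (headT : Option Bool → Bool → List (Option Bool))
    (len N : ℕ) (x : List Bool) : List Bool :=
  ((List.range (N + 1)).flatMap fun j =>
    inst (Prog.dig len (N - j)) (headT x[j]? (decide (j = 0)))) ++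
  (List.range (N * N)).flatMap fun _ => inst (Prog.dig len N) mainT

open Classical in
theorem exists_circuitStr (M : TM) :
    ∃ (mainT : List (Option Bool)) (headT : Option Bool → Bool → List (Option Bool)),
      (∀ D s b, inst D (headT s b) ≠ []) ∧
      ∀ len N, 2 ≤ N → N < 2 ^ len → ∀ x, ∃ gs, Parses (circuitStr mainT headT len N x) gs ∧
        ∀ (m : ℕ) (y : Fin m → Bool), evalCircuit gs y =
          decide (((SimState.cfg M x (fun τ => coin y (N - 1 - τ)) (N - 1)).tape M.out).head =
            some true) := by
  -- The left summand holds the constants that the initial blocks feed in; thus one function, and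
  -- one set of gates, serves both kinds of blocks.
  let F : (Option Bool × Bool) ⊕ SimState M → (Option Bool × Bool) ⊕ SimState M → Bool →
      (Option Bool × Bool) ⊕ SimState M := fun s f z =>
    match s, f with
    | .inl u, _ => .inr (SimState.initial M u z)
    | .inr s, .inl _ => .inr s
    | .inr s, .inr f => .inr (SimState.step s f)
  let acc : (Option Bool × Bool) ⊕ SimState M → Bool := fun s =>
    match s with
    | .inl _ => false
    | .inr s => s.acc
  obtain ⟨mainT, headT, mainG, headG, Rep, hmain, hhead, h0, hacc, hm, hh, hne⟩ :=
    exists_blocks F acc (.inl (none, false))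
  refine ⟨mainT, fun s b => headT (.inl (s, b)), fun _ _ _ => hne _ _, fun len N hN hlen x => ?_⟩
  have hdig : ∀ j, Prog.val (Prog.dig len (N - j)) = N - j := fun j =>
    Prog.val_dig (lt_of_le_of_lt (Nat.sub_le _ _) hlen)
  refine ⟨((List.range (N + 1)).flatMap fun j => headG (.inl (x[j]?, decide (j = 0))) (N - j)) ++
    (List.range (N * N)).flatMap fun _ => mainG N, ?_, fun m y => ?_⟩
  · refine (Parses.flatMap fun j _ => ?_).append (Parses.flatMap fun _ _ => ?_)
    · have := hhead (Prog.dig len (N - j)) (.inl (x[j]?, decide (j = 0)))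
      rwa [hdig] at this
    · have := hmain (Prog.dig len N)
      rwa [Prog.val_dig hlen] at this
  · set c : ℕ → Bool := fun τ => coin y (N - 1 - τ) with hc
    let hist : ℕ → List ((Option Bool × Bool) ⊕ SimState M) := fun J =>
      ((List.range J).map fun j => Sum.inr (SimState.sim M N x c j)).reverse
    have hist_succ : ∀ J, hist (J + 1) = .inr (SimState.sim M N x c J) :: hist J := fun J => by
      simp [hist, List.range_succ]
    have hist_get : ∀ J i, i < J → (hist J)[i]? = some (.inr (SimState.sim M N x c (J - 1 - i))) := by
      intro J i hi
      rw [List.getElem?_reverse (by simpa using hi)]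
      simp only [List.length_map, List.length_range, List.getElem?_map]
      rw [List.getElem?_range (by omega)]
      rfl
    have hinit : ∀ J ≤ N + 1, Rep (runGates y ((List.range J).flatMap fun j =>
        headG (.inl (x[j]?, decide (j = 0))) (N - j)) []) (hist J) := by
      intro J
      induction J with
      | zero => exact fun _ => h0
      | succ J ih =>
        intro hJ
        rw [List.range_succ, List.flatMap_append, runGates_append, hist_succ]
        have := hh m y _ _ (.inl (x[J]?, decide (J = 0))) (N - J) (ih (by omega))
        simp only [List.flatMap_cons, List.flatMap_nil, List.append_nil]
        convert this using 2
        simp only [F]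
        rw [SimState.sim_le _ _ _ _ (by omega)]
        congr 1
        -- State 0 holds the control and ignores its coin, so the mismatch of the coin indices there
        -- is harmless.
        rcases J with _ | J
        · simp [SimState.initial]
        · simp only [hc]
          congr 2
          omega
    have hnext : ∀ J, Rep (runGates y ((List.range J).flatMap fun _ => mainG N)
        (runGates y ((List.range (N + 1)).flatMap fun j =>
          headG (.inl (x[j]?, decide (j = 0))) (N - j)) [])) (hist (N + 1 + J)) := by
      intro J
      induction J with
      | zero => exact hinit _ le_rfl
      | succ J ih =>
        rw [List.range_succ, List.flatMap_append, runGates_append]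
        simp only [List.flatMap_cons, List.flatMap_nil, List.append_nil]
        have := hm m y _ _ N _ _ ih (hist_get _ 0 (by omega)) (hist_get _ N (by omega))
        rw [← add_assoc, hist_succ]
        convert this using 2
        simp only [F]
        rw [show N + 1 + J = N + J + 1 by ring, SimState.sim_add]
        congr 3
        omega
    have hfin := hnext (N * N)
    rw [← runGates_append, show N + 1 + N * N = N + N * N + 1 by ring, hist_succ] at hfin
    rw [evalCircuit_eq, hacc _ _ _ hfin]
    obtain ⟨n, rfl⟩ : ∃ n, N = n + 2 := ⟨N - 2, by omega⟩
    -- After `N + 1 + N * N` states the last one is at position 2 of row `N - 1`; it carries the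
    -- answer after `N - 1` steps.
    have := SimState.sim_acc M (n + 2) x c n 2 (by omega) (by omega)
    rw [show (n + 1) * (n + 2 + 2) + 2 = n + 2 + (n + 2) * (n + 2) by ring] at this
    simp only [acc, this]
    rfl

theorem cfg_eq_run (M : TM) (x : List Bool) (c : ℕ → Bool) (n : ℕ) :
    SimState.cfg M x c n = M.run x fun i : Fin n => c i := by
  induction n with
  | zero => rfl
  | succ n ih =>
    rw [SimState.cfg, ih, TM.run, TM.run, List.ofFn_succ', List.concat_eq_append,
      List.foldl_append]
    rfl

/-- The circuit uses the variables `1, ..., N - 1` as coins, in reverse order; the remaining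
variables do not influence the probability. -/
theorem unifProb_circuit {M : TM} {x : List Bool} {N m : ℕ} (hm : N ≤ m) {gs : List Gate}
    (hgs : ∀ y : Fin m → Bool, evalCircuit gs y =
      decide (((SimState.cfg M x (fun τ => coin y (N - 1 - τ)) (N - 1)).tape M.out).head =
        some true)) :
    unifProb m (fun y => evalCircuit gs y = true) =
      unifProb (N - 1) fun r => ((M.run x r).tape M.out).head = some true := by
  let ι : Fin (N - 1) → Fin m := fun i => ⟨N - 1 - i, by omega⟩
  have hι : Function.Injective ι := fun i j hij => by
    have := Fin.ext_iff.1 hij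
    simp only [ι] at this
    exact Fin.ext (by omega)
  rw [← unifProb_comp hι]
  refine unifProb_congr fun y => ?_
  rw [hgs, decide_eq_true_iff, cfg_eq_run]
  have : (fun i : Fin (N - 1) => coin y (N - 1 - i)) = fun i => y (ι i) := by
    funext i
    have : N - 1 - i.1 < m := by omega
    simp [coin, ι, this]
  rw [this]

open Classical in
theorem unifProb_head {M : TM} {x : List Bool} {t n : ℕ} (hn : t ≤ n) {b : Bool}
    (h : 2 / 3 ≤ M.outputProb x t [b]) :
    (b = true → 2 / 3 ≤ unifProb n fun r => ((M.run x r).tape M.out).head = some true) ∧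
    (b = false → unifProb n (fun r => ((M.run x r).tape M.out).head = some true) ≤ 1 / 3) := by
  have h1 := h.trans (TM.outputProb_mono (M := M) x [b] hn)
  have hh : ∀ r : Fin n → Bool, (M.run x r).HaltedWith [b] →
      ((M.run x r).tape M.out).head = some b := fun r hr => by
    simpa using hr.2 0 (Nat.zero_le _)
  constructor
  · rintro rfl
    exact h1.trans (unifProb_mono hh)
  · rintro rfl
    have := unifProb_add_le (m := n) (P := fun r => (M.run x r).HaltedWith [false])
      (Q := fun r => ((M.run x r).tape M.out).head = some true) fun r h1 h2 => by
        rw [hh r h1] at h2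
        simp at h2
    unfold TM.outputProb at h1
    linarith

/-! ### The program that writes the simulating circuit -/

namespace Prog

/-- Writes the digits of the number on the stack `k`, as an encoded number, onto the stack `e`. -/
def emitDigits {K : Type} (e k aux : K) : Prog K :=
  each k (fun c => push e true ;; push e c ;; push aux c) ;; move aux k

theorem srun_emitDigits {K : Type} {e k aux : K} (h1 : e ≠ k) (h2 : e ≠ aux) (h3 : k ≠ aux)
    (σ : K → List Bool) (ha : σ aux = []) :
    (emitDigits e k aux).SRun σ ((σ k).length * 26 + 3)
      (upd σ e (((σ k).flatMap fun c => [true, c]).reverse ++ σ e)) := by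
  have hloop : ∀ (l : List Bool) (σ : K → List Bool), σ k = l →
      (each k (fun c => push e true ;; push e c ;; push aux c)).SRun σ (l.length * 17 + 1)
        (upd (upd (upd σ k []) aux (l.reverse ++ σ aux)) e
          ((l.flatMap fun c => [true, c]).reverse ++ σ e)) := by
    intro l
    induction l with
    | nil =>
      intro σ h
      refine (srun_each_nil h).congr rfl (by simp) ?_
      funext j
      by_cases hk : j = k <;> by_cases he : j = e <;> by_cases ha : j = aux <;> simp_all [upd]
    | cons c l ih =>
      intro σ h
      refine (SRun.each_cons h ((srun_push e true _).seq ((srun_push e c _).seq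
        (srun_push aux c _))) (ih _ ?_)).congr rfl ?_ ?_
      · rw [upd_ne _ _ h3, upd_ne _ _ h1.symm, upd_ne _ _ h1.symm, upd_same]
      · simp only [List.length_cons]; omega
      · funext j
        by_cases hk : j = k <;> by_cases he : j = e <;> by_cases ha : j = aux <;> simp_all [upd]
  refine ((hloop _ σ rfl).seq (srun_move h3.symm _)).congr rfl ?_ ?_
  · simp [upd, ha, h2.symm]; omega
  · have h1' := h1.symm
    have h2' := h2.symm
    have h3' := h3.symm
    funext j
    by_cases hk : j = k <;> by_cases he : j = e <;> by_cases ha : j = aux <;> simp_all [upd]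

/-- Writes a template onto the stack `e`, with the digits from the stack `k`. -/
def emit {K : Type} (e k aux : K) : List (Option Bool) → Prog K
  | [] => skip e
  | some c :: t => push e c ;; emit e k aux t
  | none :: t => emitDigits e k aux ;; emit e k aux t

theorem srun_emit {K : Type} {e k aux : K} (h1 : e ≠ k) (h2 : e ≠ aux) (h3 : k ≠ aux)
    (t : List (Option Bool)) (σ : K → List Bool) (ha : σ aux = []) :
    (emit e k aux t).SRun σ (t.length * ((σ k).length * 26 + 4) + 1)
      (upd σ e ((inst (σ k) t).reverse ++ σ e)) := by
  induction t generalizing σ with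
  | nil => exact (srun_skip e σ).congr rfl (by simp) (by simp [inst])
  | cons o t ih =>
    cases o with
    | some c =>
      have := ih (upd σ e (c :: σ e)) (by rw [upd_ne _ _ h2.symm, ha])
      rw [upd_ne _ _ h1.symm] at this
      refine ((srun_push e c σ).seq this).congr rfl ?_ ?_
      · simp only [List.length_cons]; ring_nf; omega
      · simp [inst]
    | none =>
      have := ih (upd σ e (((σ k).flatMap fun c => [true, c]).reverse ++ σ e))
        (by rw [upd_ne _ _ h2.symm, ha])
      rw [upd_ne _ _ h1.symm] at this
      refine ((srun_emitDigits h1 h2 h3 σ ha).seq this).congr rfl ?_ ?_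
      · simp only [List.length_cons]; ring_nf; omega
      · simp [inst]

end Prog

theorem length_inst_le (D : List Bool) (t : List (Option Bool)) :
    (inst D t).length ≤ t.length * (2 * D.length + 1) := by
  induction t with
  | nil => simp [inst]
  | cons o t ih =>
    have h : inst D (o :: t) = inst D [o] ++ inst D t := inst_append D [o] t
    have h1 : (inst D [o]).length ≤ 2 * D.length + 1 := by
      cases o <;> simp [inst, List.length_flatMap]
      omega
    rw [h, List.length_append, List.length_cons, add_mul]
    omega

/-- The stacks of the program that writes the circuit. -/
inductive GenStk where
  | inp | out | x | u | t | d | c | c₁ | c₂ | e | aux | fl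
  deriving DecidableEq

instance : Finite GenStk :=
  have : Fintype GenStk :=
    ⟨{.inp, .out, .x, .u, .t, .d, .c, .c₁, .c₂, .e, .aux, .fl}, fun k => by cases k <;> simp⟩
  inferInstance

/-! ### Writing the blocks with binary counters. -/

namespace Prog

open GenStk

theorem flatMap_range_add {s : List Bool} (n m : ℕ) :
    ((List.range (n + m)).flatMap fun _ => s) =
      ((List.range n).flatMap fun _ => s) ++ (List.range m).flatMap fun _ => s := by
  rw [List.range_add, List.flatMap_append, List.flatMap_map]

/-- Writes the blocks of the further states. -/
def mainProg (mainT : List (Option Bool)) : Prog GenStk :=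
  copy d c₁ aux ;; forDec c₁ aux fl (copy d c₂ aux ;; forDec c₂ aux fl (emit e d aux mainT))

/-- Two nested loops produce the `N * N` copies, so `N * N` never has to be computed. -/
theorem srun_mainProg (mainT : List (Option Bool)) (len N : ℕ) (hN : N < 2 ^ len)
    (σ : GenStk → List Bool) (hd : σ d = dig len N) (h1 : σ c₁ = []) (h2 : σ c₂ = [])
    (ha : σ aux = []) (hf : σ fl = []) :
    (mainProg mainT).SRun σ
      (len * 22 + 4 + (N + 1) * ((len * 22 + 4 + (N + 1) *
        (mainT.length * (len * 26 + 4) + 1 + len * 22 + 15)) + len * 22 + 15))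
      (upd σ e (((List.range (N * N)).flatMap fun _ => inst (dig len N) mainT).reverse ++
        σ e)) := by
  set R : ℕ → List Bool := fun n => (List.range n).flatMap fun _ => inst (dig len N) mainT with hR
  have hR1 : ∀ n, R (n + 1) = R n ++ inst (dig len N) mainT := fun n => by
    simp [hR, List.range_succ]
  have hinner : ∀ σ : GenStk → List Bool, σ d = dig len N → σ aux = [] → σ fl = [] →
      (forDec c₂ aux fl (emit e d aux mainT)).SRun (upd σ c₂ (dig len N))
        ((N + 1) * (mainT.length * (len * 26 + 4) + 1 + len * 22 + 15))
        (upd (upd σ c₂ []) e ((R N).reverse ++ σ e)) := by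
    intro σ hd ha hf
    refine (srun_forDec (k := c₂) (aux := aux) (fl := fl) (by simp) (by simp) (by simp)
      (emit e d aux mainT) len (mainT.length * (len * 26 + 4) + 1) N hN
      (fun i => upd σ e ((R i).reverse ++ σ e)) (fun i hi => ?_) ?_ ?_).congr ?_ le_rfl ?_
    · refine (srun_emit (by simp) (by simp) (by simp) mainT _ (by simpa [upd] using ha)).congr rfl
        ?_ ?_
      · simp [upd, hd]
      · funext j; cases j <;> simp [upd, hd, hR1]
    · intro i; simpa [upd] using ha
    · intro i; simpa [upd] using hf
    · simp [hR]
    · funext j; cases j <;> simp [upd]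
  have houter : (forDec c₁ aux fl (copy d c₂ aux ;; forDec c₂ aux fl (emit e d aux mainT))).SRun
      (upd σ c₁ (dig len N))
      ((N + 1) * ((len * 22 + 4 + (N + 1) *
        (mainT.length * (len * 26 + 4) + 1 + len * 22 + 15)) + len * 22 + 15))
      (upd σ e ((R (N * N)).reverse ++ σ e)) := by
    refine (srun_forDec (k := c₁) (aux := aux) (fl := fl) (by simp) (by simp) (by simp)
      _ len (len * 22 + 4 + (N + 1) *
        (mainT.length * (len * 26 + 4) + 1 + len * 22 + 15)) N hN
      (fun i => upd σ e ((R (i * N)).reverse ++ σ e)) (fun i hi => ?_) ?_ ?_).congr ?_ le_rfl ?_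
    · set σ₁ := upd (upd σ e ((R (i * N)).reverse ++ σ e)) c₁ (dig len (N - 1 - i)) with hσ₁
      have e1 := srun_copy (a := d) (b := c₂) (aux := aux) (by simp) (by simp) (by simp) σ₁
        (by simpa [hσ₁, upd] using ha)
      have e2 := hinner σ₁ (by simpa [hσ₁, upd] using hd) (by simpa [hσ₁, upd] using ha)
        (by simpa [hσ₁, upd] using hf)
      have e3 : upd σ₁ c₂ (σ₁ d ++ σ₁ c₂) = upd σ₁ c₂ (dig len N) := by
        simp [hσ₁, upd, hd, h2]
      rw [e3] at e1
      refine (e1.seq e2).congr rfl ?_ ?_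
      · simp [hσ₁, upd, hd]
      · have hRi : R ((i + 1) * N) = R (i * N) ++ R N := by
          rw [add_mul, one_mul]
          exact flatMap_range_add _ _
        funext j; cases j <;> simp [hσ₁, upd, hRi, h2]
    · intro i; simpa [upd] using ha
    · intro i; simpa [upd] using hf
    · simp [hR]
    · funext j; cases j <;> simp [upd, h1]
  have e1 := srun_copy (a := d) (b := c₁) (aux := aux) (by simp) (by simp) (by simp) σ ha
  rw [hd, h1, List.append_nil] at e1
  exact (e1.seq houter).congr rfl (by simp only [length_dig]; omega) rfl

/-- Writes the blocks of the initial states. -/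
def headProg (headT : Option Bool → Bool → List (Option Bool)) : Prog GenStk :=
  copy d c aux ;; .branch inp (fun s => pop inp ;; emit e c aux (headT s true)) ;;
    forDec c aux fl (.branch inp fun s => pop inp ;; emit e c aux (headT s false))

/-- The falling counter doubles as the index `N - j` of the coin, which is why coins are numbered
backwards. When the input is used up, reading and popping the empty stack yields blanks. -/
theorem srun_headProg (headT : Option Bool → Bool → List (Option Bool)) (L : ℕ)
    (hL : ∀ s b, (headT s b).length ≤ L) (len N : ℕ) (hN : N < 2 ^ len)
    (σ : GenStk → List Bool) (hd : σ d = dig len N) (hc : σ c = [])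
    (ha : σ aux = []) (hf : σ fl = []) (he : σ e = []) :
    (headProg headT).SRun σ
      (len * 22 + 5 + (N + 2) * (L * (len * 26 + 4) + len * 22 + 20))
      (upd (upd σ inp ((σ inp).drop (N + 1))) e (((List.range (N + 1)).flatMap fun j =>
        inst (dig len (N - j)) (headT (σ inp)[j]? (decide (j = 0)))).reverse)) := by
  set X := σ inp with hX
  set R : ℕ → List Bool := fun J => (List.range J).flatMap fun j =>
        inst (dig len (N - j)) (headT X[j]? (decide (j = 0))) with hR
  have hR1 : ∀ J, R (J + 1) = R J ++ inst (dig len (N - J)) (headT X[J]? (decide (J = 0))) :=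
    fun n => by simp [hR, List.range_succ]
  have hbody : ∀ J b, b = decide (J = 0) → ∀ τ : GenStk → List Bool, τ c = dig len (N - J) →
      τ aux = [] → τ inp = X.drop J → τ e = (R J).reverse →
      (Prog.branch inp fun s => pop inp ;; emit e c aux (headT s b)).SRun τ
        (L * (len * 26 + 4) + 5) (upd (upd τ inp (X.drop (J + 1))) e (R (J + 1)).reverse) := by
    intro J b hb τ h1 h2 h3 h4
    refine (SRun.branch (N := L * (len * 26 + 4) + 3) ?_).mono (by omega)
    rw [h3, List.head?_drop]
    refine ((srun_pop inp τ).seq (srun_emit (by simp) (by simp) (by simp) _ _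
      (by simpa [upd] using h2))).congr rfl ?_ ?_
    · have : (upd τ inp (τ inp).tail c).length = len := by simp [upd, h1]
      rw [this]
      have := Nat.mul_le_mul_right (len * 26 + 4) (hL X[J]? b)
      omega
    · funext j; cases j <;> simp [upd, h1, h3, h4, hR1, hb]
  have hfor : (forDec c aux fl (.branch inp fun s => pop inp ;; emit e c aux (headT s false))).SRun
      (upd (upd (upd σ inp (X.drop 1)) e (R 1).reverse) c (dig len N))
      ((N + 1) * (L * (len * 26 + 4) + 5 + len * 22 + 15))
      (upd (upd σ inp (X.drop (N + 1))) e (R (N + 1)).reverse) := by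
    refine (srun_forDec (k := c) (aux := aux) (fl := fl) (by simp) (by simp) (by simp)
      _ len (L * (len * 26 + 4) + 5) N hN
      (fun i => upd (upd σ inp (X.drop (i + 1))) e (R (i + 1)).reverse)
      (fun i hi => ?_) ?_ ?_).congr ?_ le_rfl ?_
    · refine (hbody (i + 1) false (by simp) _ ?_ ?_ ?_ ?_).congr rfl le_rfl ?_
      · rw [upd_same, show N - 1 - i = N - (i + 1) by omega]
      · simpa [upd] using ha
      · simp [upd]
      · simp [upd]
      · funext j; cases j <;> simp [upd]
    · intro i; simpa [upd] using ha
    · intro i; simpa [upd] using hf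
    · rfl
    · funext j; cases j <;> simp [upd, hc]
  have e1 := srun_copy (a := d) (b := c) (aux := aux) (by simp) (by simp) (by simp) σ ha
  rw [hd, hc, List.append_nil] at e1
  have e2 := hbody 0 true (by simp) (upd σ c (dig len N)) (by simp) (by simpa [upd] using ha)
    (by simp [upd, hX]) (by simp [upd, he, hR])
  have e3 : upd (upd (upd σ c (dig len N)) inp (X.drop (0 + 1))) e (R (0 + 1)).reverse =
      upd (upd (upd σ inp (X.drop 1)) e (R 1).reverse) c (dig len N) := by
    funext j; cases j <;> simp [upd]
  rw [e3] at e2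
  refine (e1.seq (e2.seq hfor)).congr rfl ?_ rfl
  simp only [length_dig]
  ring_nf
  omega

/-- Writes the simulating circuit, for the time bound on the stack `t`. -/
def genProg (mainT : List (Option Bool)) (headT : Option Bool → Bool → List (Option Bool))
    (r : ℕ) : Prog GenStk :=
  (move t d ;; pushes d (List.replicate r true)) ;; headProg headT ;; mainProg mainT ;; move e out

theorem val_replicate_true (r : ℕ) : val (List.replicate r true) + 1 = 2 ^ r := by
  induction r with
  | zero => simp
  | succ r ih =>
    rw [List.replicate_succ, val_cons, Nat.bit_val, pow_succ, ← ih]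
    simp
    ring

theorem length_circuitStr_le {mainT : List (Option Bool)}
    {headT : Option Bool → Bool → List (Option Bool)} {L : ℕ}
    (hL : ∀ s b, (headT s b).length ≤ L) (hL' : mainT.length ≤ L) (len N : ℕ) (x : List Bool) :
    (circuitStr mainT headT len N x).length ≤ (N + 1 + N * N) * (L * (2 * len + 1)) := by
  have h1 : ∀ s b m, (inst (dig len m) (headT s b)).length ≤ L * (2 * len + 1) := fun s b m => by
    have := length_inst_le (dig len m) (headT s b)
    rw [length_dig] at this
    exact this.trans (Nat.mul_le_mul_right _ (hL s b))
  have h2 : (inst (dig len N) mainT).length ≤ L * (2 * len + 1) := by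
    have := length_inst_le (dig len N) mainT
    rw [length_dig] at this
    exact this.trans (Nat.mul_le_mul_right _ hL')
  rw [circuitStr, List.length_append, List.length_flatMap, List.length_flatMap, add_mul]
  refine Nat.add_le_add ?_ ?_
  · have := List.sum_le_card_nsmul ((List.range (N + 1)).map fun j =>
      (inst (dig len (N - j)) (headT x[j]? (decide (j = 0)))).length) (L * (2 * len + 1)) (by
        intro z hz
        obtain ⟨j, -, rfl⟩ := List.mem_map.1 hz
        exact h1 _ _ _)
    simpa using this
  · simpa using Nat.mul_le_mul_left (N * N) h2

/-- About `N * N` blocks are written, each at cost O(len); the crude `len ≤ N + 1` already gives a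
cubic bound. -/
theorem cost_genProg_le {len N L m S a b : ℕ} (hle : len ≤ N + 1) (hm : m ≤ L)
    (hS : S ≤ (N + 1 + N * N) * (L * (2 * len + 1))) (hab : a * 9 + b * 4 ≤ 9 * len) :
    a * 9 + 1 + (b * 4 + 1) + 1 +
      (len * 22 + 5 + (N + 2) * (L * (len * 26 + 4) + len * 22 + 20) +
        (len * 22 + 4 + (N + 1) * (len * 22 + 4 + (N + 1) *
          (m * (len * 26 + 4) + 1 + len * 22 + 15) + len * 22 + 15) + (S * 9 + 1) + 1) + 1) + 1 ≤
      (1000 * L + 1000) * (N + 1) ^ 3 := by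
  set P := N + 1 with hP
  have hP1 : 1 ≤ P := by omega
  have h1 : N + 1 + N * N ≤ 2 * (P * P) := by nlinarith
  have h2 : N + 2 ≤ 2 * P := by omega
  have hlen1 : 2 * len + 1 ≤ 3 * P := by omega
  have hlen2 : len * 26 + 4 ≤ 30 * P := by omega
  have hS' : S ≤ 2 * (P * P) * (L * (3 * P)) :=
    hS.trans (Nat.mul_le_mul h1 (Nat.mul_le_mul_left _ hlen1))
  have hA : (N + 2) * (L * (len * 26 + 4) + len * 22 + 20) ≤ 2 * P * (L * (30 * P) + 42 * P) :=
    Nat.mul_le_mul h2 (by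
      have := Nat.mul_le_mul_left L hlen2
      omega)
  have hB : m * (len * 26 + 4) + 1 + len * 22 + 15 ≤ L * (30 * P) + 38 * P := by
    have := Nat.mul_le_mul hm hlen2
    omega
  have hC : len * 22 + 4 + P * (m * (len * 26 + 4) + 1 + len * 22 + 15) + len * 22 + 15 ≤
      63 * P + P * (L * (30 * P) + 38 * P) := by
    have := Nat.mul_le_mul_left P hB
    omega
  have hD := Nat.mul_le_mul_left P hC
  have q1 : 1 ≤ P ^ 3 := Nat.one_le_pow _ _ hP1
  have q2 : P ≤ P ^ 3 := Nat.le_self_pow (by norm_num) P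
  have q3 : P ^ 2 ≤ P ^ 3 := Nat.pow_le_pow_right hP1 (by norm_num)
  have q4 := Nat.mul_le_mul_left L q3
  have q5 : len ≤ P := hle
  nlinarith

theorem exists_srun_genProg (mainT : List (Option Bool))
    (headT : Option Bool → Bool → List (Option Bool)) (r : ℕ) :
    ∃ α, ∀ (n : ℕ) (x : List Bool), ∃ σ,
      (genProg mainT headT r).SRun (upd (upd (fun _ => []) inp x) t (Nat.bits n).reverse)
        (α * (n + 1) ^ 3) σ ∧
      σ out = circuitStr mainT headT (r + (Nat.bits n).length) (2 ^ r * (n + 1) - 1) x := by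
  obtain ⟨L, hL, hL'⟩ : ∃ L, (∀ s b, (headT s b).length ≤ L) ∧ mainT.length ≤ L := by
    refine ⟨mainT.length + ∑ p : Option Bool × Bool, (headT p.1 p.2).length, fun s b => ?_,
      Nat.le_add_right _ _⟩
    exact (Finset.single_le_sum (f := fun p : Option Bool × Bool => (headT p.1 p.2).length)
      (fun _ _ => Nat.zero_le _) (Finset.mem_univ (s, b))).trans (Nat.le_add_left _ _)
  refine ⟨(1000 * L + 1000) * (2 ^ r) ^ 3, fun n x => ?_⟩
  -- Putting `r` ones below the digits of `n` gives `2 ^ r * (n + 1) - 1`, a multiple of the time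
  -- bound up to constants that needs no arithmetic to compute.
  set D := List.replicate r true ++ Nat.bits n with hD
  set len := r + (Nat.bits n).length with hlen
  set N := 2 ^ r * (n + 1) - 1 with hN
  have hDlen : D.length = len := by simp [hD, hlen]
  have hP : N + 1 = 2 ^ r * (n + 1) := by
    have : 0 < 2 ^ r * (n + 1) := by positivity
    omega
  have hval : val D = N := by
    have h1 := val_replicate_true r
    have h2 : val D + 1 = 2 ^ r * (n + 1) := by
      rw [hD, val_append, val_bits, List.length_replicate, mul_add, mul_one, ← h1]
      ring
    omega
  have hdig : dig len N = D := by rw [← hval, ← hDlen, dig_val]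
  have hNlt : N < 2 ^ len := by rw [← hval, ← hDlen]; exact val_lt D
  have hle : len ≤ N + 1 := by
    have h1 : (Nat.bits n).length ≤ n := by
      rw [Nat.size_eq_bits_len]
      exact Nat.size_le.2 Nat.lt_two_pow_self
    have h2 : r + 1 ≤ 2 ^ r := Nat.lt_two_pow_self
    rw [hP, hlen]
    nlinarith
  set σ₀ : GenStk → List Bool := upd (upd (fun _ => []) inp x) t (Nat.bits n).reverse with hσ₀
  set σ₁ : GenStk → List Bool := upd (upd (fun _ => []) inp x) d D with hσ₁
  have e1 := (srun_move (a := t) (b := d) (by simp) σ₀).seq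
    (srun_pushes d (List.replicate r true) _)
  have e2 := srun_headProg headT L hL len N hNlt σ₁ (by simp [hσ₁, hdig]) (by simp [hσ₁, upd])
    (by simp [hσ₁, upd]) (by simp [hσ₁, upd]) (by simp [hσ₁, upd])
  have e3 := srun_mainProg mainT len N hNlt (upd (upd σ₁ inp ((σ₁ inp).drop (N + 1))) e
    (((List.range (N + 1)).flatMap fun j =>
        inst (dig len (N - j)) (headT (σ₁ inp)[j]? (decide (j = 0)))).reverse))
    (by simp [hσ₁, upd, hdig]) (by simp [hσ₁, upd])
    (by simp [hσ₁, upd]) (by simp [hσ₁, upd]) (by simp [hσ₁, upd])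
  have hx : σ₁ inp = x := by simp [hσ₁, upd]
  have h1 : upd (upd (upd σ₀ t []) d ((σ₀ t).reverse ++ σ₀ d)) d ((List.replicate r true).reverse ++
      upd (upd σ₀ t []) d ((σ₀ t).reverse ++ σ₀ d) d) = σ₁ := by
    funext j; cases j <;> simp [hσ₀, hσ₁, upd, hD]
  have h3 : ((List.range (N * N)).flatMap fun _ => inst (dig len N) mainT).reverse ++
      ((List.range (N + 1)).flatMap fun j =>
        inst (dig len (N - j)) (headT (σ₁ inp)[j]? (decide (j = 0)))).reverse =
      (circuitStr mainT headT len N x).reverse := by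
    rw [circuitStr, List.reverse_append, hx]
  rw [upd_same, upd_upd, h3] at e3
  set σ₂ := upd (upd σ₁ inp ((σ₁ inp).drop (N + 1))) e (circuitStr mainT headT len N x).reverse
    with hσ₂
  have e4 := srun_move (a := e) (b := out) (by simp) σ₂
  have h4 : σ₂ e = (circuitStr mainT headT len N x).reverse := by simp [hσ₂]
  have h5 : σ₂ out = [] := by simp [hσ₂, hσ₁, upd]
  rw [h4, h5, List.reverse_reverse, List.append_nil, List.length_reverse] at e4
  rw [h1] at e1
  refine ⟨_, (e1.seq (e2.seq (e3.seq e4))).congr rfl ?_ rfl, upd_same _ _ _⟩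
  have h6 := length_circuitStr_le hL hL' len N x
  have h7 : (σ₀ t).length * 9 + (List.replicate r true).length * 4 ≤ 9 * len := by
    simp [hσ₀, hlen]; omega
  rw [mul_assoc, ← mul_pow, ← hP]
  generalize (circuitStr mainT headT len N x).length = S at h6 ⊢
  exact cost_genProg_le hle hL' h6 h7

end Prog

/-! ### Machines from programs -/

namespace Prog

/-- Moves the output of a machine onto a stack. -/
theorem run_unload {K : Type} {a b : K} (hab : a ≠ b) (y l : List Bool) (τ : Tapes K)
    (ha : ∀ j : ℕ, j ≤ y.length → (τ a).nth j = y[j]?) (hb : τ b = stk l) :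
    ∃ T', (move a b).Run τ (y.length * 9 + 1) (upd (upd τ a T') b (stk (y.reverse ++ l))) := by
  induction y generalizing τ l with
  | nil =>
    refine ⟨τ a, ?_⟩
    rw [upd_eq_self, List.reverse_nil, List.nil_append, ← hb, upd_eq_self]
    exact (run_loop_nil (by simpa using ha 0 le_rfl)).mono (by simp)
  | cons c y ih =>
    have h0 : (τ a).head = some c := by simpa using ha 0 (Nat.zero_le _)
    set τ₁ := upd τ a (Frag.basicTape (some none) (some .right) (τ a)) with hτ₁
    have e1 : (pop a).Run τ 1 τ₁ := run_basic a (some none) (some .right) τ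
    have hb₁ : τ₁ b = stk l := by rw [hτ₁, upd_ne _ _ hab.symm, hb]
    have e2 := run_push b c τ₁ l hb₁
    obtain ⟨T', e3⟩ := ih (c :: l) (upd τ₁ b (stk (c :: l))) (fun j hj => by
      rw [upd_ne _ _ hab, hτ₁, upd_same]
      simp only [Frag.basicTape, Option.getD_some, TM.moveHead, Tape.move_right_nth,
        Tape.write_nth]
      rw [if_neg (by omega)]
      have := ha (j + 1) (by simpa using hj)
      rw [List.getElem?_cons_succ] at this
      exact_mod_cast this) (upd_same _ _ _)
    refine ⟨T', ?_⟩
    have e4 : upd (upd (upd τ₁ b (stk (c :: l))) a T') b (stk (y.reverse ++ c :: l)) =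
        upd (upd τ a T') b (stk ((c :: y).reverse ++ l)) := by
      funext j
      by_cases h1 : j = a <;> by_cases h2 : j = b <;> simp_all [upd]
    rw [e4] at e3
    refine (Run.loop_cons (N := 7) (by simp [h0]) (Run.branch (N := 5) ?_) e3).mono ?_
    · rw [h0]
      exact e1.seq e2
    · simp only [List.length_cons]; omega

theorem computes_toTM {K : Type} [Finite K] {p : Prog K} {i o : K} (hio : i ≠ o) {x : List Bool}
    {N : ℕ} {σ : K → List Bool} (h : p.SRun (initStacks i x) N σ) :
    (p.compile.toTM i o hio).Computes x N (σ o) := by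
  obtain ⟨n, hn, h⟩ := h
  intro r
  have h1 := (h.halts ((List.ofFn r).take n) (by simp; omega)).foldl_toTM (h := hio)
  have h2 : (p.compile.toTM i o hio).runList x ((List.ofFn r).take n) =
      ⟨(p.compile.toTM i o hio).halt, fun k => stk (σ k)⟩ := by
    refine Eq.trans ?_ h1
    unfold TM.runList
    congr 1
    exact congrArg (TM.Cfg.mk (M := p.compile.toTM i o hio) (p.compile.toTM i o hio).start)
      ((p.compile.toTM i o hio).init_tape x)
  have h3 := TM.runList_of_halted (M := p.compile.toTM i o hio) (by rw [h2])
    (l' := (List.ofFn r).drop n)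
  rw [List.take_append_drop, h2] at h3
  rw [TM.run_eq_runList, h3]
  exact haltedWith_of_stk rfl rfl

/-- Looks up the value of `g` at the first `k` symbols on the stack `i`. -/
def lookup {K : Type} (i o : K) : ℕ → (List Bool → List Bool) → Prog K
  | 0, g => pushes o (g []).reverse
  | k + 1, g => .branch i fun s => match s with
    | none => pushes o (g []).reverse
    | some b => pop i ;; lookup i o k fun l => g (b :: l)

/-- The program is a finite decision tree, so one constant bounds its time for all inputs. -/
theorem exists_srun_lookup {K : Type} {i o : K} (hio : i ≠ o) (k : ℕ)
    (g : List Bool → List Bool) :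
    ∃ c, ∀ σ : K → List Bool, σ o = [] →
      ∃ σ', (lookup i o k g).SRun σ c σ' ∧ σ' o = g ((σ i).take k) := by
  induction k generalizing g with
  | zero =>
    refine ⟨_, fun σ h => ⟨_, srun_pushes o (g []).reverse σ, ?_⟩⟩
    simp [h]
  | succ k ih =>
    choose c hc using fun b : Bool => ih fun l => g (b :: l)
    refine ⟨(g []).reverse.length * 4 + 1 + c true + c false + 4, fun σ h => ?_⟩
    rcases hi : σ i with _ | ⟨b, l⟩
    · refine ⟨upd σ o (g []),
        (SRun.branch (N := (g []).reverse.length * 4 + 1) ?_).mono (by omega), ?_⟩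
      · rw [hi]
        exact (srun_pushes o (g []).reverse σ).congr rfl le_rfl (by simp [h])
      · simp
    · obtain ⟨σ', h1, h2⟩ := hc b (upd σ i l) (by rw [upd_ne _ _ hio.symm, h])
      refine ⟨σ', (SRun.branch (N := 1 + c b + 1) ?_).mono (by cases b <;> omega), ?_⟩
      · have h3 := srun_pop i σ
        rw [hi] at h3 ⊢
        exact h3.seq h1
      · rw [h2, upd_same, List.take_succ_cons]

end Prog

theorem computableInTime_take (t : ℕ → ℕ) (k : ℕ) (g : List Bool → List Bool) :
    ComputableInTime t fun x => g (x.take k) := by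
  obtain ⟨c, hc⟩ := Prog.exists_srun_lookup (i := true) (o := false) (by simp) k g
  refine ⟨(Prog.lookup true false k g).compile.toTM true false (by simp), Prog.det_compile _, c,
    fun x => ?_⟩
  obtain ⟨σ', h1, h2⟩ := hc (Prog.initStacks true x) (by simp [Prog.initStacks, upd])
  have := Prog.computes_toTM (o := false) (by simp) (h1.mono (Nat.le_add_left c (c * t x.length)))
  rwa [h2, Prog.initStacks, upd_same] at this

/-! ### The reduction -/

namespace Prog

open GenStk

/-- Writes the length of the input in unary onto the stack `u`. -/
def unaryProg : Prog GenStk := each inp (fun c => push x c ;; push u true) ;; move x inp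

theorem srun_unaryProg (y : List Bool) :
    unaryProg.SRun (initStacks inp y) (y.length * 22 + 3)
      (upd (initStacks inp y) u (List.replicate y.length true)) := by
  have hloop : ∀ (l : List Bool) (σ : GenStk → List Bool), σ inp = l →
      (each inp (fun c => push x c ;; push u true)).SRun σ (l.length * 13 + 1)
        (upd (upd (upd σ inp []) x (l.reverse ++ σ x)) u
          (List.replicate l.length true ++ σ u)) := by
    intro l
    induction l with
    | nil =>
      intro σ h
      refine (srun_each_nil h).congr rfl (by simp) ?_
      funext j; cases j <;> simp [upd, h]
    | cons c l ih =>
      intro σ h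
      refine (SRun.each_cons h ((srun_push x c _).seq (srun_push u true _)) (ih _ ?_)).congr rfl
        ?_ ?_
      · simp [upd]
      · simp only [List.length_cons]; omega
      · funext j
        cases j <;> simp [upd, List.replicate_succ']
  refine ((hloop y _ (by simp [initStacks])).seq (srun_move (by simp) _)).congr rfl ?_ ?_
  · simp [upd, initStacks]; omega
  · funext j; cases j <;> simp [upd, initStacks]

end Prog

theorem TM.Computes.mono {M : TM} {x y : List Bool} {m m' : ℕ} (h : M.Computes x m y)
    (hm : m ≤ m') : M.Computes x m' y := fun r => by
  have h1 : M.HaltsWithin x m := fun r => (h r).1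
  have h2 := (h1.runList (l := List.ofFn r) (by simpa using hm)).2
  rw [TM.run_eq_runList, h2]
  convert h fun i => r (Fin.castLE hm i) using 1
  rw [TM.run_eq_runList]
  congr 1
  apply List.ext_getElem
  · simp [hm]
  · intro i h1 h2
    simp

theorem TM.Computes.runList {M : TM} {x y : List Bool} {m : ℕ} (h : M.Computes x m y)
    {l : List Bool} (hl : l.length = m) : (M.runList x l).HaltedWith y := by
  subst hl
  have := h l.get
  rwa [TM.run_eq_runList, List.ofFn_get] at this

/-- The condition `hα` charges the linear cost of reading the input to `t`. The factor 8 in the time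
constant absorbs the passage from `(t + 1) ^ 3` to `t ^ 3 + 1`. -/
theorem computableInTime_circuitStr {t : ℕ → ℕ} {M : TM} (hM : M.Deterministic) {α : ℕ}
    (ht : ∀ n, M.Computes (List.replicate n true) (α * t n + α) (Nat.bits (t n)))
    (hα : ∀ n, n ≤ α * t n + α) (mainT : List (Option Bool))
    (headT : Option Bool → Bool → List (Option Bool)) (r : ℕ) :
    ComputableInTime (fun n => t n ^ 3) fun x => circuitStr mainT headT
      (r + (Nat.bits (t x.length)).length) (2 ^ r * (t x.length + 1) - 1) x := by
  obtain ⟨β, hβ⟩ := Prog.exists_srun_genProg mainT headT r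
  let pre : Prog (GenStk ⊕ M.K) :=
    Prog.unaryProg.lift M.K ;; Prog.move (.inl .u) (.inr M.inp)
  let post : Prog (GenStk ⊕ M.K) :=
    Prog.move (.inr M.out) (.inl .t) ;; (Prog.genProg mainT headT r).lift M.K
  refine ⟨callTM M pre post GenStk.inp GenStk.out (by simp), callTM_det hM,
    8 * (32 * α + 30 + β), fun x => ?_⟩
  set n := x.length with hn
  obtain ⟨σ, hσ, ho⟩ := hβ (t n) x
  have hpre := run_load (M := M) (k := GenStk.u) (z := List.replicate n true)
    (Prog.srun_unaryProg x) (by simp [hn])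
  obtain ⟨n₁, hn₁, hrun⟩ := runList_callTM (post := post)
    (o := GenStk.out) (hio := by simp)
    (N₂ := (Nat.bits (t n)).length * 9 + 1 + β * (t n + 1) ^ 3 + 1)
    (Q := fun _ τ' => τ' (.inl .out) = stk (circuitStr mainT headT
      (r + (Nat.bits (t n)).length) (2 ^ r * (t n + 1) - 1) x)) hpre
    (fun r => (ht n r).1) (by
      intro l hl
      obtain ⟨T', h1⟩ := Prog.run_unload (a := Sum.inr M.out) (b := Sum.inl GenStk.t) (by simp)
        (Nat.bits (t n)) [] (Sum.elim (fun j => stk (upd (upd (Prog.initStacks GenStk.inp x)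
          GenStk.u (List.replicate x.length true)) GenStk.u [] j))
          (M.runList (List.replicate n true) l).tape) ((ht n).runList hl).2 (by simp [upd, Prog.initStacks])
      have h2 := Prog.Run.lift hσ (upd (M.runList (List.replicate n true) l).tape M.out T')
      have h3 : upd (upd (Sum.elim (fun j => stk (upd (upd (Prog.initStacks GenStk.inp x)
          GenStk.u (List.replicate x.length true)) GenStk.u [] j))
          (M.runList (List.replicate n true) l).tape) (.inr M.out) T') (.inl .t)
            (stk ((Nat.bits (t n)).reverse ++ [])) =
          Sum.elim (fun k => stk (upd (upd (fun _ => []) GenStk.inp x) GenStk.t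
            (Nat.bits (t n)).reverse k))
          (upd (M.runList (List.replicate n true) l).tape M.out T') := by
        rw [← Prog.elim_upd_inr, ← Prog.elim_upd_inl]
        congr 1
        funext j; cases j <;> simp [upd, Prog.initStacks]
      rw [h3] at h1
      exact ⟨_, h1.seq h2, by simp [ho]⟩)
  intro r'
  have hbits : (Nat.bits (t n)).length ≤ t n := by
    rw [Nat.size_eq_bits_len]
    exact Nat.size_le.2 Nat.lt_two_pow_self
  have hlen := hrun (List.ofFn r') (by
    rw [List.length_ofFn, List.length_replicate]
    have h1 := hα n
    have h2 : t n + 1 ≤ (t n + 1) ^ 3 := Nat.le_self_pow (by norm_num) _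
    have h3 : (t n + 1) ^ 3 ≤ 8 * (t n ^ 3 + 1) := by
      rcases Nat.eq_zero_or_pos (t n) with h | h
      · simp [h]
      · calc (t n + 1) ^ 3 ≤ (2 * t n) ^ 3 := Nat.pow_le_pow_left (by omega) 3
          _ ≤ _ := by rw [mul_pow]; omega
    have h4 := Nat.mul_le_mul_left (32 * α + 30 + β) h3
    have h5 := Nat.mul_le_mul_left α h2
    nlinarith)
  exact haltedWith_of_stk hlen.1 hlen.2

/-! ### Hardness -/

theorem TM.Computes.unique {M : TM} {x y y' : List Bool} {m m' : ℕ} (h : M.Computes x m y)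
    (h' : M.Computes x m' y') : y = y' :=
  (h.mono (le_max_left m m') fun _ => true).unique (h'.mono (le_max_right m m') fun _ => true)

theorem TM.Computes.of_take {M : TM} {x x' y : List Bool} {m : ℕ} (h : M.Computes x m y)
    (hx : x.take m = x'.take m) : M.Computes x' m y := fun r =>
  (TM.haltedWith_iff_of_take hx r y).1 (h r)

/-- A time-constructible function that is sublinear somewhere is eventually constant. -/
theorem eq_of_computes {t : ℕ → ℕ} {M : TM} {α : ℕ}
    (ht : ∀ n, M.Computes (List.replicate n true) (α * t n + α) (Nat.bits (t n))) {n₁ n : ℕ}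
    (h₁ : α * t n₁ + α ≤ n₁) (hn : α * t n₁ + α ≤ n) : t n = t n₁ := by
  have h1 := ((ht n₁).of_take (x' := List.replicate n true) (by
    rw [List.take_replicate, List.take_replicate, min_eq_left h₁, min_eq_left hn])).unique (ht n)
  have h2 := congrArg Prog.val h1
  rwa [Prog.val_bits, Prog.val_bits, eq_comm] at h2

/-- Each of the `N + 1` initial blocks is nonempty. Hence the string is long enough for its own
instance to have a variable for every coin. -/
theorem lt_length_circuitStr {mainT : List (Option Bool)}
    {headT : Option Bool → Bool → List (Option Bool)} (h : ∀ D s b, inst D (headT s b) ≠ [])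
    (len N : ℕ) (x : List Bool) : N < (circuitStr mainT headT len N x).length := by
  have : ∀ (J : ℕ), J ≤ ((List.range J).flatMap fun j =>
      inst (Prog.dig len (N - j)) (headT x[j]? (decide (j = 0)))).length := by
    intro J
    induction J with
    | zero => simp
    | succ J ih =>
      rw [List.range_succ, List.flatMap_append, List.length_append, List.flatMap_singleton]
      have := List.length_pos_iff.2 (h (Prog.dig len (N - J)) x[J]? (decide (J = 0)))
      omega
  rw [circuitStr, List.length_append]
  have := this (N + 1)
  omega

/-! ### Reductions to the circuit language. -/

section

variable {C : ℕ} {T : ℕ → ℕ} {A : TM} {a₀ n₀ : ℕ} (h : Solves C T A a₀ n₀)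

/-- A member and a nonmember serve as values of the lookup table. The dummy gates make the
description long enough for the algorithm to be correct. -/
theorem exists_constGates_mem (b : Bool) : ∃ w, w ∈ circuitLang h ↔ b = true := by
  have hl := length_constGates (n₀ + 1) b
  refine ⟨(constGates (n₀ + 1) b).flatMap encGate, ?_⟩
  cases b with
  | true =>
    refine iff_of_true (mem_circuitLang h (parses_encGates _) (by omega) (by omega) ?_) rfl
    rw [unifProb_congr (Q := fun _ => True) fun z => by simp [evalCircuit_constGates],
      unifProb_true]
    norm_num
  | false =>
    refine iff_of_false (notMem_circuitLang h (parses_encGates _) (by omega) (by omega) ?_)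
      (by simp)
    rw [unifProb_congr (Q := fun _ => False) fun z => by simp [evalCircuit_constGates],
      unifProb_false]
    norm_num

open Classical in
/-- The reduction of a language that depends only on the first symbols of its inputs. -/
theorem exists_reduction_of_take (t : ℕ → ℕ) {L' : Language Bool} {k : ℕ}
    (hk : ∀ x, x ∈ L' ↔ x.take k ∈ L') :
    ∃ f : List Bool → List Bool, ComputableInTime t f ∧ ∀ x, x ∈ L' ↔ f x ∈ circuitLang h := by
  choose w hw using exists_constGates_mem h
  refine ⟨_, computableInTime_take t k fun l => w (decide (l ∈ L')), fun x => ?_⟩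
  rw [hw, decide_eq_true_iff, ← hk]

open Classical in
/-- The reduction of a language that is decided by a machine, through the simulating circuit. -/
theorem exists_reduction_of_le {t : ℕ → ℕ} {M : TM} (hM : M.Deterministic) {α : ℕ}
    (ht : ∀ n, M.Computes (List.replicate n true) (α * t n + α) (Nat.bits (t n)))
    (hα : ∀ n, n ≤ α * t n + α) {L' : Language Bool} {B : TM} {a : ℕ}
    (hB : ∀ x, 2 / 3 ≤ B.outputProb x (a * t x.length + a) [decide (x ∈ L')]) :
    ∃ f : List Bool → List Bool, ComputableInTime (fun n => t n ^ 3) f ∧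
      ∀ x, x ∈ L' ↔ f x ∈ circuitLang h := by
  obtain ⟨mainT, headT, hne, hcirc⟩ := exists_circuitStr B
  -- Since `2 ^ r ≥ r + 1`, this gives `N - 1 ≥ a * n + a`, enough steps for `B`, as well as `N ≥ 2`
  -- and `N ≥ n₀`.
  set r := a + n₀ + 3 with hr
  refine ⟨_, computableInTime_circuitStr hM ht hα mainT headT r, fun x => ?_⟩
  set n := t x.length with hn
  have hr2 : r < 2 ^ r := Nat.lt_two_pow_self
  have hNr : (r + 1) * (n + 1) ≤ 2 ^ r * (n + 1) := Nat.mul_le_mul_right _ hr2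
  set N := 2 ^ r * (n + 1) - 1 with hN
  have hr3 : r * (n + 1) = a * n + a + (n₀ + 3) * (n + 1) := by rw [hr]; ring
  have hr4 : (n₀ + 3) * 1 ≤ (n₀ + 3) * (n + 1) := Nat.mul_le_mul_left _ (by omega)
  rw [add_mul, one_mul] at hNr
  have hlt : N < 2 ^ (r + (Nat.bits n).length) := by
    have h1 : n < 2 ^ (Nat.bits n).length := by
      have := Prog.val_lt (Nat.bits n)
      rwa [Prog.val_bits] at this
    have h2 := Nat.mul_le_mul_left (2 ^ r) h1
    rw [← pow_add] at h2
    have : 0 < 2 ^ (r + (Nat.bits n).length) := by positivity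
    rw [Nat.succ_eq_add_one] at h2
    omega
  obtain ⟨gs, hp, hgs⟩ := hcirc (r + (Nat.bits n).length) N (by omega) hlt x
  have hlen := lt_length_circuitStr (mainT := mainT) hne (r + (Nat.bits n).length) N x
  set s := circuitStr mainT headT (r + (Nat.bits n).length) N x with hs
  have hm : N ≤ cappSize C s.length := hlen.le.trans (le_cappSize (by omega))
  have hprob := unifProb_circuit hm (hgs _)
  have hhead := unifProb_head (n := N - 1) (by rw [← hn]; omega) (hB x)
  rw [← hprob] at hhead
  by_cases hx : x ∈ L'
  · exact iff_of_true hx (mem_circuitLang h hp (by omega) (by omega) (hhead.1 (by simpa using hx)))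
  · exact iff_of_false hx
      (notMem_circuitLang h hp (by omega) (by omega) (hhead.2 (by simpa using hx)))

open Classical in
theorem bptimeHard_circuitLang : BPTIMEHard (circuitLang h) := by
  refine ⟨3, by norm_num, fun t ⟨M, hM, α, ht⟩ L' ⟨B, a, hB⟩ => ?_⟩
  by_cases hα : ∀ n, n ≤ α * t n + α
  · exact exists_reduction_of_le h hM ht hα fun x => (hB x).2
  push Not at hα
  obtain ⟨n₁, hn₁⟩ := hα
  -- The first part ensures that `t` takes the value `t n₁` from length `k` on, the second that `B`
  -- sees no more than `k` symbols of such inputs. Truncation to length `k` then preserves the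
  -- decision.
  set k := α * t n₁ + α + (a * t n₁ + a) with hk
  refine exists_reduction_of_take h _ (k := k) fun x => ?_
  rcases le_or_gt x.length k with hx | hx
  · rw [List.take_of_length_le hx]
  · have hl : (x.take k).length = k := by simp; omega
    have h1 := (hB x).2
    have h2 := (hB (x.take k)).2
    rw [hl, eq_of_computes ht hn₁.le (by omega)] at h2
    rw [eq_of_computes ht hn₁.le (by omega), TM.outputProb_eq_of_take (x' := x.take k) (by
      rw [List.take_take, min_eq_left (by omega)])] at h1
    simpa using TM.eq_of_outputProb h1 h2

end

/-! ### Polynomial time bounds and the conclusion. -/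

theorem BPTIME_mono {t t' : ℕ → ℕ} {c : ℕ} (h : ∀ n, t n ≤ t' n + c) : BPTIME t ⊆ BPTIME t' := by
  rintro L ⟨M, a, hM⟩
  refine ⟨M, a * c + a, fun x => ?_⟩
  have hle : a * t x.length + a ≤ (a * c + a) * t' x.length + (a * c + a) := by
    have := Nat.mul_le_mul_left a (h x.length)
    rw [mul_add] at this
    have h2 : a * t' x.length ≤ (a * c + a) * t' x.length := Nat.mul_le_mul_right _ (by omega)
    omega
  exact ⟨(hM x).1.mono hle, (hM x).2.trans (TM.outputProb_mono _ _ hle)⟩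

end PseudoDet

theorem theorem4p6 (C : ℕ) (hC : 1 ≤ C) (T : ℕ → ℕ) (hT : PseudoDet.TimeConstructible T)
    (hA : PseudoDet.HasPseudodetCAPP C T) :
    (∃ L : Language Bool, L ∈ PseudoDet.BPTIME T ∧ PseudoDet.BPTIMEHard L) ∧
    ((∃ k : ℕ, ∀ n : ℕ, T n ≤ n ^ k + k) → ∃ L : Language Bool, PseudoDet.BPPComplete L) := by
  obtain ⟨A, a, n₀, h⟩ := hA
  have h1 := PseudoDet.circuitLang_mem_BPTIME (T := T) h
  have h2 := PseudoDet.bptimeHard_circuitLang (T := T) h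
  exact ⟨⟨_, h1, h2⟩, fun ⟨k, hk⟩ => ⟨_, h2, k, PseudoDet.BPTIME_mono hk h1⟩⟩
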